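/- **Setting.** Let $\mathcal I\subseteq\mathbb R$ be a nondegenerate interval. A pair $\{E,F\}$ of $n\times n$ matrix functions on $\mathcal I$ is transformed by $L,K$ into $\{E',F'\}$, written $\{E,F\}\overset{L,K}{\sim}\{E',F'\}$, if $L,K$ are pointwise nonsingular and $E'=LEK$, $F'=LFK+LEK'$; the transformation is of class $m\in\{0,1,2,\dots,\infty\}$ if $L\in C^m$, $K\in C^{m+1}$. A standard canonical form (SCF) is a pair $\{\operatorname{diag}(I_d,N),\operatorname{diag}(\Omega,I_a)\}$ with $N$ pointwise strictly upper, or pointwise strictly lower, triangular. If $L,K$ (of class $0$) transform $\{E,F\}$ into an SCF, then $\Pi_{can}:=K\operatorname{diag}(I_d,0)K^{-1}$ is called a canonical projector of $\{E,F\}$. Fix $\mu,d\ge 0$ and block sizes $\ell_1,\dots,\ell_\mu\ge 0$, $a=\sum_i\ell_i$. All $a\times a$ matrices below are partitioned accordingly. BUT means block upper triangular, SUT strictly block upper triangular. Let $N^{(E)}$ be the constant SUT matrix whose only nonzero blocks are $N^{(E)}_{i,i+1}$, with ones on their main diagonal: $N^{(E)}_{i,i+1}=\begin{bmatrix}I_{\ell_{i+1}}\\0\end{bmatrix}$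 if $\ell_1\ge\dots\ge\ell_\mu$ (then $N^{(E)}=:N^{(E_c)}$), and $N^{(E)}_{i,i+1}=\begin{bmatrix}I_{\ell_i}&0\end{bmatrix}$ if $\ell_1\le\dots\le\ell_\mu$ (then $N^{(E)}=:N^{(E_r)}$). A pair $\{\operatorname{diag}(I_d,N^{(E)}),F\}$, with decreasing or increasing block sizes, is in PreSCF if $F_{22}$ is BUT and nonsingular and $F_{21}F_{12}$ is BUT. For such a pair, put $F^{(0)}=F$ and, for $i=1,\dots,\mu$ (Step 1), $A_i=F^{(i-1)}_{12}(F^{(i-1)}_{22})^{-1}N^{(E)}$ and $$F^{(i)}=\begin{bmatrix}I&-F^{(i-1)}_{12}(F^{(i-1)}_{22})^{-1}\\0&I\end{bmatrix}F^{(i-1)}\begin{bmatrix}I&A_i\\0&I\end{bmatrix}+\begin{bmatrix}0&A_i'\\0&0\end{bmatrix},$$ then, for $j=1,\dots,\mu$ (Step 2), $B_j=-(F^{(\mu+j-1)}_{22})^{-1}F^{(\mu+j-1)}_{21}$ and $$F^{(\mu+j)}=\begin{bmatrix}I&0\\-N^{(E)}B_j&I\end{bmatrix}F^{(\mu+j-1)}\begin{bmatrix}I&0\\B_j&I\end{bmatrix}+\begin{bmatrix}0&0\\N^{(E)}B_j'&0\end{bmatrix}.$$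 Let $A=\sum_{i=1}^\mu A_i$ and $B=\sum_{j=1}^\mu B_j$. A pair $\left\{\begin{bmatrix}I_d&0\\0&N\end{bmatrix},\begin{bmatrix}\Omega&0\\F_{21}&I_a\end{bmatrix}\right\}$ is in T-canonical form if $N$ is SUT and all blocks $N_{i,i+1}$ have full column rank pointwise. A pair $\left\{\begin{bmatrix}I_d&E_{12}\\0&N\end{bmatrix},\begin{bmatrix}\Omega&0\\0&I_a\end{bmatrix}\right\}$ is in S-canonical form if $N$ is SUT, all blocks $N_{i,i+1}$ have full row rank pointwise, and the first block column of $E_{12}$ is zero. The form is normalized if $N_{i,i+1}=\begin{bmatrix}R_i\\0\end{bmatrix}$ (T), respectively $N_{i,i+1}=\begin{bmatrix}R_i&0\end{bmatrix}$ (S), with pointwise nonsingular square $R_i$. **Statement.** For every $\mu$ there is $k\in\mathbb N$ such that for all $m\in\{0,1,\dots,\infty\}$, all $d,\ell_1,\dots,\ell_\mu$ and all $\mathcal I$ the following holds. (T0) Every T-canonical form with $N,\Omega,F_{21}\in C^{m+1}$ is equivalent, by a transformation of class $m$, to a normalized T-canonical form with the same block sizes and the same $\Omega$ and with $C^m$ entries.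 (T) Consider a normalized T-canonical form $\{E_T,F_T\}$ with $N,\Omega,F_{21}\in C^{m+k}$, and set $R^c=N(N^{(E)})^T+(I-N^{(E)}(N^{(E)})^T)$, $R^{-c}=(R^c)^{-1}$. Then $\ell_1\ge\dots\ge\ell_\mu$ (so $N^{(E)}=N^{(E_c)}$), $R^c$ is nonsingular, $R^c$ and $R^{-c}$ are BUT, $R^{-c}N=N^{(E_c)}$, and $L_c=\operatorname{diag}(I_d,R^{-c})$, $K_c=I$ are a transformation of class $m$ from $\{E_T,F_T\}$ into $$\left\{\begin{bmatrix}I_d&0\\0&N^{(E_c)}\end{bmatrix},\begin{bmatrix}\Omega&0\\R^{-c}F_{21}&R^{-c}\end{bmatrix}\right\},$$ which is in PreSCF. For this PreSCF, $A=0$, Step 1 changes nothing, and Step 2 leads to the second matrix $\operatorname{diag}(\Omega,R^{-c})$. The PreSCF is equivalent to $\{\operatorname{diag}(I_d,N^{(E_c)}),\operatorname{diag}(\Omega,R^{-c})\}$, which is equivalent to $\{\operatorname{diag}(I_d,N^{(E_c)}),\operatorname{diag}(\Omega,I_a)\}$ (both in class $m$). If $\{E,F\}\overset{L_T,K_T}{\sim}\{E_T,F_T\}$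 (class $0$), then $\{E,F\}$ has exactly one canonical projector, namely $$\Pi_{can}=K_T\begin{bmatrix}I_d&0\\B&0\end{bmatrix}K_T^{-1}.$$ (S0) Every S-canonical form with $N,\Omega,E_{12}\in C^{m+1}$ is equivalent, by a transformation of class $m$, to a normalized S-canonical form with the same block sizes and the same $\Omega$ and with $C^m$ entries. (S) Consider a normalized S-canonical form $\{E_S,F_S\}$ with $N,\Omega,E_{12}\in C^{m+k}$, and set $R^r=(N^{(E)})^TN+(I-(N^{(E)})^TN^{(E)})$, $R^{-r}=(R^r)^{-1}$. Then $\ell_1\le\dots\le\ell_\mu$ (so $N^{(E)}=N^{(E_r)}$), $R^r$ is nonsingular, $R^r$ and $R^{-r}$ are BUT, $NR^{-r}=N^{(E_r)}$, and $L_r=I$, $K_r=\begin{bmatrix}I_d&-E_{12}R^{-r}\\0&R^{-r}\end{bmatrix}$ are a transformation of class $m$ from $\{E_S,F_S\}$ into $$\left\{\begin{bmatrix}I_d&0\\0&N^{(E_r)}\end{bmatrix},\begin{bmatrix}\Omega&-\Omega E_{12}R^{-r}-(E_{12}R^{-r})'+E_{12}(R^{-r})'\\0&R^{-r}+N(R^{-r})'\end{bmatrix}\right\},$$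 which is in PreSCF. For this PreSCF, $B=0$, Step 1 leads to the second matrix $\operatorname{diag}(\Omega,R^{-r}+N(R^{-r})')$ and Step 2 leaves it unchanged. The PreSCF is equivalent to $\{\operatorname{diag}(I_d,N^{(E_r)}),\operatorname{diag}(\Omega,R^{-r}+N(R^{-r})')\}$, which is equivalent to $\{\operatorname{diag}(I_d,N^{(E_r)}),\operatorname{diag}(\Omega,I_a)\}$ (both in class $m$). If $\{E,F\}\overset{L_S,K_S}{\sim}\{E_S,F_S\}$ (class $0$), then $\{E,F\}$ has exactly one canonical projector, namely $$\Pi_{can}=K_SK_r\begin{bmatrix}I_d&-A\\0&0\end{bmatrix}K_r^{-1}K_S^{-1}.$$ -/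

import Mathlib

open Matrix
open scoped ContDiff

noncomputable section

namespace DAE

/-! ### Matrix functions on an interval and equivalence of pairs -/

/-- A matrix function is of class `C^n` on `I` (entrywise). -/
def SmoothMat {ι κ : Type*} (n : WithTop ℕ∞) (I : Set ℝ) (A : ℝ → Matrix ι κ ℝ) : Prop :=
  ∀ i j, ContDiffOn ℝ n (fun t => A t i j) I

/-- The (entrywise) derivative of a matrix function on `I`; one-sided at end points of `I`. -/
def matDeriv {ι κ : Type*} (I : Set ℝ) (A : ℝ → Matrix ι κ ℝ) : ℝ → Matrix ι κ ℝ :=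
  fun t => Matrix.of fun i j => derivWithin (fun s => A s i j) I t

/-- `L, K` transform the pair `{E, F}` on `I` into the pair `{E', F'}`, that is
`E' = L E K` and `F' = L F K + L E K'`, where `L` is `C^m`, `K` is `C^(m+1)` and both are
pointwise nonsingular. -/
structure Transforms {n : Type*} [Fintype n] [DecidableEq n] (m : ℕ∞) (I : Set ℝ)
    (L K E F E' F' : ℝ → Matrix n n ℝ) : Prop where
  smooth_L : SmoothMat (m : WithTop ℕ∞) I L
  smooth_K : SmoothMat ((m + 1 : ℕ∞) : WithTop ℕ∞) I K
  isUnit_L : ∀ t ∈ I, IsUnit (L t)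
  isUnit_K : ∀ t ∈ I, IsUnit (K t)
  eq_E : ∀ t ∈ I, E' t = L t * E t * K t
  eq_F : ∀ t ∈ I, F' t = L t * F t * K t + L t * E t * matDeriv I K t

/-- Equivalence `{E, F} ∼ {E', F'}` of pairs of matrix functions on `I`. -/
def Equivalent {n : Type*} [Fintype n] [DecidableEq n] (m : ℕ∞) (I : Set ℝ)
    (E F E' F' : ℝ → Matrix n n ℝ) : Prop :=
  ∃ L K : ℝ → Matrix n n ℝ, Transforms m I L K E F E' F'

/-! ### Standard canonical form and canonical projector -/

/-- `N` is pointwise strictly upper triangular on `I`, or pointwise strictly lower triangular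
on `I` (triangular and pointwise nilpotent). -/
def IsStrictlyTriangular {a : ℕ} (I : Set ℝ) (N : ℝ → Matrix (Fin a) (Fin a) ℝ) : Prop :=
  (∀ t ∈ I, ∀ i j, j ≤ i → N t i j = 0) ∨ (∀ t ∈ I, ∀ i j, i ≤ j → N t i j = 0)

/-- `P` is a canonical projector function of `{E, F}` on `I`: some `L, K` transform `{E, F}`
into a standard canonical form `{diag (I_d, N), diag (Ω, I_a)}`, and
`P = K diag (I_d, 0) K⁻¹`. The bijection `e` enumerates the index set as `d + a` coordinates. -/
def IsCanonicalProjector {n : Type*} [Fintype n] [DecidableEq n] (I : Set ℝ)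
    (E F P : ℝ → Matrix n n ℝ) : Prop :=
  ∃ (d a : ℕ) (e : n ≃ Fin d ⊕ Fin a) (Ω : ℝ → Matrix (Fin d) (Fin d) ℝ)
    (N : ℝ → Matrix (Fin a) (Fin a) ℝ) (L K : ℝ → Matrix n n ℝ),
    IsStrictlyTriangular I N ∧
    Transforms 0 I L K E F
      (fun t => (fromBlocks 1 0 0 (N t)).submatrix e e)
      (fun t => (fromBlocks (Ω t) 0 0 1).submatrix e e) ∧
    ∀ t ∈ I, P t = K t * (fromBlocks 1 0 0 0 : Matrix (Fin d ⊕ Fin a) (Fin d ⊕ Fin a) ℝ).submatrix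
      e e * (K t)⁻¹

/-- `P` is the canonical projector function of `{E, F}` on `I`: it is one, and every other one
coincides with it on `I`. -/
def IsTheCanonicalProjector {n : Type*} [Fintype n] [DecidableEq n] (I : Set ℝ)
    (E F P : ℝ → Matrix n n ℝ) : Prop :=
  IsCanonicalProjector I E F P ∧
    ∀ Q : ℝ → Matrix n n ℝ, IsCanonicalProjector I E F Q → ∀ t ∈ I, Q t = P t

/-! ### Block structured matrices -/

section Blocks

variable {μ : ℕ}

/-- Index set of `ℓ 0 + ⋯ + ℓ (μ - 1)` coordinates, grouped in `μ` consecutive blocks. -/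
abbrev BlockIdx (ℓ : Fin μ → ℕ) : Type := Σ i : Fin μ, Fin (ℓ i)

/-- The `(i, j)` block of a block structured matrix. -/
def block {ℓ : Fin μ → ℕ} (M : Matrix (BlockIdx ℓ) (BlockIdx ℓ) ℝ) (i j : Fin μ) :
    Matrix (Fin (ℓ i)) (Fin (ℓ j)) ℝ :=
  Matrix.of fun p q => M ⟨i, p⟩ ⟨j, q⟩

/-- Block upper triangular. -/
def IsBUT {ℓ : Fin μ → ℕ} (M : Matrix (BlockIdx ℓ) (BlockIdx ℓ) ℝ) : Prop :=
  ∀ i j : Fin μ, j < i → block M i j = 0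

/-- Strictly block upper triangular. -/
def IsSUT {ℓ : Fin μ → ℕ} (M : Matrix (BlockIdx ℓ) (BlockIdx ℓ) ℝ) : Prop :=
  ∀ i j : Fin μ, j ≤ i → block M i j = 0

/-- On `I`, `N` is strictly block upper triangular and all blocks `N_{i,i+1}` have full column
rank. -/
def IsSUTColumn (ℓ : Fin μ → ℕ) (I : Set ℝ)
    (N : ℝ → Matrix (BlockIdx ℓ) (BlockIdx ℓ) ℝ) : Prop :=
  ∀ t ∈ I, IsSUT (N t) ∧ ∀ i j : Fin μ, i.val + 1 = j.val → (block (N t) i j).rank = ℓ j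

/-- On `I`, `N` is strictly block upper triangular and all blocks `N_{i,i+1}` have full row
rank. -/
def IsSUTRow (ℓ : Fin μ → ℕ) (I : Set ℝ)
    (N : ℝ → Matrix (BlockIdx ℓ) (BlockIdx ℓ) ℝ) : Prop :=
  ∀ t ∈ I, IsSUT (N t) ∧ ∀ i j : Fin μ, i.val + 1 = j.val → (block (N t) i j).rank = ℓ i

/-- On `I`, every block `N_{i,i+1}` consists of a nonsingular square matrix of size `ℓ_{i+1}`
on top of zero rows. -/
def HasColumnPattern (ℓ : Fin μ → ℕ) (I : Set ℝ)
    (N : ℝ → Matrix (BlockIdx ℓ) (BlockIdx ℓ) ℝ) : Prop :=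
  ∀ t ∈ I, ∀ i j : Fin μ, i.val + 1 = j.val →
    ∃ R : Matrix (Fin (ℓ j)) (Fin (ℓ j)) ℝ, IsUnit R ∧
      ∀ p q, block (N t) i j p q = if h : p.val < ℓ j then R ⟨p.val, h⟩ q else 0

/-- On `I`, every block `N_{i,i+1}` consists of a nonsingular square matrix of size `ℓ_i`
followed by zero columns. -/
def HasRowPattern (ℓ : Fin μ → ℕ) (I : Set ℝ)
    (N : ℝ → Matrix (BlockIdx ℓ) (BlockIdx ℓ) ℝ) : Prop :=
  ∀ t ∈ I, ∀ i j : Fin μ, i.val + 1 = j.val →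
    ∃ R : Matrix (Fin (ℓ i)) (Fin (ℓ i)) ℝ, IsUnit R ∧
      ∀ p q, block (N t) i j p q = if h : q.val < ℓ i then R p ⟨q.val, h⟩ else 0

/-- The elementary nilpotent matrix: its only nonzero blocks are the `(i, i+1)` blocks, which have
ones on their main diagonal. For decreasing `ℓ` these blocks are `[I; 0]` (the matrix `N^(E_c)`),
for increasing `ℓ` they are `[I 0]` (the matrix `N^(E_r)`). -/
def elemN (ℓ : Fin μ → ℕ) : Matrix (BlockIdx ℓ) (BlockIdx ℓ) ℝ :=
  Matrix.of fun x y => if x.1.val + 1 = y.1.val ∧ x.2.val = y.2.val then 1 else 0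

/-- `R^c = N (N^(E_c))ᵀ + (I - N^(E_c) (N^(E_c))ᵀ)`. -/
def Rc (ℓ : Fin μ → ℕ) (N : ℝ → Matrix (BlockIdx ℓ) (BlockIdx ℓ) ℝ) :
    ℝ → Matrix (BlockIdx ℓ) (BlockIdx ℓ) ℝ :=
  fun t => N t * (elemN ℓ)ᵀ + (1 - elemN ℓ * (elemN ℓ)ᵀ)

/-- `R^r = (N^(E_r))ᵀ N + (I - (N^(E_r))ᵀ N^(E_r))`. -/
def Rr (ℓ : Fin μ → ℕ) (N : ℝ → Matrix (BlockIdx ℓ) (BlockIdx ℓ) ℝ) :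
    ℝ → Matrix (BlockIdx ℓ) (BlockIdx ℓ) ℝ :=
  fun t => (elemN ℓ)ᵀ * N t + (1 - (elemN ℓ)ᵀ * elemN ℓ)

end Blocks

/-! ### Pairs in block form -/

/-- The constant leading matrix `diag (I, M)`. -/
def leading {ι κ : Type*} [DecidableEq ι] (M : Matrix κ κ ℝ) : ℝ → Matrix (ι ⊕ κ) (ι ⊕ κ) ℝ :=
  fun _ => fromBlocks 1 0 0 M

section Forms

variable {μ d : ℕ} {ℓ : Fin μ → ℕ}

/-- `{E, F}` with blocks of sizes `d` and `a = ∑ ℓ i` is in T-canonical form on `I`, with the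
indicated blocks `E = [[I, 0], [0, N]]`, `F = [[F₁₁, 0], [F₂₁, I]]`. -/
structure IsTCanonical (I : Set ℝ) (N : ℝ → Matrix (BlockIdx ℓ) (BlockIdx ℓ) ℝ)
    (F₁₁ : ℝ → Matrix (Fin d) (Fin d) ℝ) (F₂₁ : ℝ → Matrix (BlockIdx ℓ) (Fin d) ℝ)
    (E F : ℝ → Matrix (Fin d ⊕ BlockIdx ℓ) (Fin d ⊕ BlockIdx ℓ) ℝ) : Prop where
  column : IsSUTColumn ℓ I N
  eq_E : ∀ t ∈ I, E t = fromBlocks 1 0 0 (N t)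
  eq_F : ∀ t ∈ I, F t = fromBlocks (F₁₁ t) 0 (F₂₁ t) 1

/-- `{E, F}` with blocks of sizes `d` and `a = ∑ ℓ i` is in S-canonical form on `I`, with the
indicated blocks `E = [[I, E₁₂], [0, N]]`, `F = [[F₁₁, 0], [0, I]]`, where the first block column
of `E₁₂` vanishes. -/
structure IsSCanonical (I : Set ℝ) (N : ℝ → Matrix (BlockIdx ℓ) (BlockIdx ℓ) ℝ)
    (F₁₁ : ℝ → Matrix (Fin d) (Fin d) ℝ) (E₁₂ : ℝ → Matrix (Fin d) (BlockIdx ℓ) ℝ)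
    (E F : ℝ → Matrix (Fin d ⊕ BlockIdx ℓ) (Fin d ⊕ BlockIdx ℓ) ℝ) : Prop where
  row : IsSUTRow ℓ I N
  first_zero : ∀ t ∈ I, ∀ p (x : BlockIdx ℓ), x.1.val = 0 → E₁₂ t p x = 0
  eq_E : ∀ t ∈ I, E t = fromBlocks 1 (E₁₂ t) 0 (N t)
  eq_F : ∀ t ∈ I, F t = fromBlocks (F₁₁ t) 0 0 1

/-- `{E, F}` is in PreSCF on `I` (with the elementary matrix of block sizes `ℓ`):
`E = diag (I, N^(E))`, `F₂₂` is block upper triangular and nonsingular, and `F₂₁ F₁₂` is block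
upper triangular. The block sizes are decreasing (then `N^(E) = N^(E_c)`) or increasing (then
`N^(E) = N^(E_r)`). -/
structure IsPreSCF (ℓ : Fin μ → ℕ) (I : Set ℝ)
    (E F : ℝ → Matrix (Fin d ⊕ BlockIdx ℓ) (Fin d ⊕ BlockIdx ℓ) ℝ) : Prop where
  monotone : Antitone ℓ ∨ Monotone ℓ
  eq_E : ∀ t ∈ I, E t = fromBlocks 1 0 0 (elemN ℓ)
  but₂₂ : ∀ t ∈ I, IsBUT (F t).toBlocks₂₂
  isUnit₂₂ : ∀ t ∈ I, IsUnit (F t).toBlocks₂₂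
  but₂₁₁₂ : ∀ t ∈ I, IsBUT ((F t).toBlocks₂₁ * (F t).toBlocks₁₂)

end Forms

/-! ### The two elimination steps for a pair `{diag (I, M), F}` -/

section Steps

variable {ι κ : Type*} [Fintype ι] [DecidableEq ι] [Fintype κ] [DecidableEq κ]

/-- `F₁₂ F₂₂⁻¹ M`. -/
def coefA (M : Matrix κ κ ℝ) (F : ℝ → Matrix (ι ⊕ κ) (ι ⊕ κ) ℝ) : ℝ → Matrix ι κ ℝ :=
  fun t => (F t).toBlocks₁₂ * ((F t).toBlocks₂₂)⁻¹ * M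

/-- One iteration of Step 1: `F` is replaced by `L F K + L diag (I, M) K'` with
`L = [[I, -F₁₂ F₂₂⁻¹], [0, I]]`, `K = [[I, F₁₂ F₂₂⁻¹ M], [0, I]]`. -/
def step1 (I : Set ℝ) (M : Matrix κ κ ℝ) (F : ℝ → Matrix (ι ⊕ κ) (ι ⊕ κ) ℝ) :
    ℝ → Matrix (ι ⊕ κ) (ι ⊕ κ) ℝ :=
  fun t =>
    fromBlocks 1 (-((F t).toBlocks₁₂ * ((F t).toBlocks₂₂)⁻¹)) 0 1 * F t *
        fromBlocks 1 (coefA M F t) 0 1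
      + fromBlocks 0 (matDeriv I (coefA M F) t) 0 0

/-- `-F₂₂⁻¹ F₂₁`. -/
def coefB (F : ℝ → Matrix (ι ⊕ κ) (ι ⊕ κ) ℝ) : ℝ → Matrix κ ι ℝ :=
  fun t => -(((F t).toBlocks₂₂)⁻¹ * (F t).toBlocks₂₁)

/-- One iteration of Step 2: `F` is replaced by `L F K + L diag (I, M) K'` with
`L = [[I, 0], [M F₂₂⁻¹ F₂₁, I]]`, `K = [[I, 0], [-F₂₂⁻¹ F₂₁, I]]`. -/
def step2 (I : Set ℝ) (M : Matrix κ κ ℝ) (F : ℝ → Matrix (ι ⊕ κ) (ι ⊕ κ) ℝ) :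
    ℝ → Matrix (ι ⊕ κ) (ι ⊕ κ) ℝ :=
  fun t =>
    fromBlocks 1 0 (-(M * coefB F t)) 1 * F t * fromBlocks 1 0 (coefB F t) 1
      + fromBlocks 0 0 (M * matDeriv I (coefB F) t) 0

/-- Result `F^(μ)` of Step 1 (`μ` iterations). -/
def afterStep1 (μ : ℕ) (I : Set ℝ) (M : Matrix κ κ ℝ) (F : ℝ → Matrix (ι ⊕ κ) (ι ⊕ κ) ℝ) :
    ℝ → Matrix (ι ⊕ κ) (ι ⊕ κ) ℝ :=
  (step1 I M)^[μ] F

/-- Result `F^(2μ)` of Step 2 (`μ` iterations) after Step 1. -/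
def afterStep2 (μ : ℕ) (I : Set ℝ) (M : Matrix κ κ ℝ) (F : ℝ → Matrix (ι ⊕ κ) (ι ⊕ κ) ℝ) :
    ℝ → Matrix (ι ⊕ κ) (ι ⊕ κ) ℝ :=
  (step2 I M)^[μ] (afterStep1 μ I M F)

/-- `A = A_1 + ⋯ + A_μ`, the upper right block of the transformation `K₁` of Step 1. -/
def totalA (μ : ℕ) (I : Set ℝ) (M : Matrix κ κ ℝ) (F : ℝ → Matrix (ι ⊕ κ) (ι ⊕ κ) ℝ) :
    ℝ → Matrix ι κ ℝ :=
  fun t => ∑ i ∈ Finset.range μ, coefA M ((step1 I M)^[i] F) t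

/-- `B = B_1 + ⋯ + B_μ`, the lower left block of the transformation `K₂` of Step 2. -/
def totalB (μ : ℕ) (I : Set ℝ) (M : Matrix κ κ ℝ) (F : ℝ → Matrix (ι ⊕ κ) (ι ⊕ κ) ℝ) :
    ℝ → Matrix κ ι ℝ :=
  fun t => ∑ j ∈ Finset.range μ, coefB ((step2 I M)^[j] (afterStep1 μ I M F)) t

end Steps

/-! ### The explicit transformations and transformed pairs -/

section Explicit

variable {μ d : ℕ}

/-- `L_c = diag (I, (R^c)⁻¹)`. -/
def Lc (ℓ : Fin μ → ℕ) (N : ℝ → Matrix (BlockIdx ℓ) (BlockIdx ℓ) ℝ) :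
    ℝ → Matrix (Fin d ⊕ BlockIdx ℓ) (Fin d ⊕ BlockIdx ℓ) ℝ :=
  fun t => fromBlocks 1 0 0 (Rc ℓ N t)⁻¹

/-- The second matrix `[[Ω, 0], [(R^c)⁻¹ F₂₁, (R^c)⁻¹]]` obtained from a T-canonical form. -/
def preT (ℓ : Fin μ → ℕ) (N : ℝ → Matrix (BlockIdx ℓ) (BlockIdx ℓ) ℝ)
    (Ω : ℝ → Matrix (Fin d) (Fin d) ℝ) (F₂₁ : ℝ → Matrix (BlockIdx ℓ) (Fin d) ℝ) :
    ℝ → Matrix (Fin d ⊕ BlockIdx ℓ) (Fin d ⊕ BlockIdx ℓ) ℝ :=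
  fun t => fromBlocks (Ω t) 0 ((Rc ℓ N t)⁻¹ * F₂₁ t) (Rc ℓ N t)⁻¹

/-- `K_r = [[I, -E₁₂ (R^r)⁻¹], [0, (R^r)⁻¹]]`. -/
def Kr (ℓ : Fin μ → ℕ) (N : ℝ → Matrix (BlockIdx ℓ) (BlockIdx ℓ) ℝ)
    (E₁₂ : ℝ → Matrix (Fin d) (BlockIdx ℓ) ℝ) :
    ℝ → Matrix (Fin d ⊕ BlockIdx ℓ) (Fin d ⊕ BlockIdx ℓ) ℝ :=
  fun t => fromBlocks 1 (-(E₁₂ t * (Rr ℓ N t)⁻¹)) 0 (Rr ℓ N t)⁻¹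

/-- `(R^r)⁻¹ + N ((R^r)⁻¹)'`. -/
def preS₂₂ (ℓ : Fin μ → ℕ) (I : Set ℝ) (N : ℝ → Matrix (BlockIdx ℓ) (BlockIdx ℓ) ℝ) :
    ℝ → Matrix (BlockIdx ℓ) (BlockIdx ℓ) ℝ :=
  fun t => (Rr ℓ N t)⁻¹ + N t * matDeriv I (fun s => (Rr ℓ N s)⁻¹) t

/-- The second matrix
`[[Ω, -Ω E₁₂ (R^r)⁻¹ - (E₁₂ (R^r)⁻¹)' + E₁₂ ((R^r)⁻¹)'], [0, (R^r)⁻¹ + N ((R^r)⁻¹)']]`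
obtained from an S-canonical form. -/
def preS (ℓ : Fin μ → ℕ) (I : Set ℝ) (N : ℝ → Matrix (BlockIdx ℓ) (BlockIdx ℓ) ℝ)
    (Ω : ℝ → Matrix (Fin d) (Fin d) ℝ) (E₁₂ : ℝ → Matrix (Fin d) (BlockIdx ℓ) ℝ) :
    ℝ → Matrix (Fin d ⊕ BlockIdx ℓ) (Fin d ⊕ BlockIdx ℓ) ℝ :=
  fun t => fromBlocks (Ω t)
    (-(Ω t * E₁₂ t * (Rr ℓ N t)⁻¹) - matDeriv I (fun s => E₁₂ s * (Rr ℓ N s)⁻¹) t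
      + E₁₂ t * matDeriv I (fun s => (Rr ℓ N s)⁻¹) t)
    0 (preS₂₂ ℓ I N t)

end Explicit

end DAE

end

namespace DAE

/-! ### Calculus of matrix functions -/

section Calculus

variable {ι κ ν : Type*} {n : WithTop ℕ∞} {I : Set ℝ}

/-! Everything rests on grading the algebraic coordinates by block number. A matrix raising the
grade by at least one is nilpotent, so invertibility of a block upper triangular matrix depends only
on its part of degree 0. The operator `1 + c N d/dt` with `N` of degree 1 is likewise inverted by a
finite Neumann series (`nilRes`), without integration or initial values. Each application of `N
d/dt` costs one derivative, whence the loss `k` depending on `μ` alone.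

Normalization: full-rank blocks on the secondary diagonal are completed smoothly to nonsingular
matrices. A generic constant vector avoids the span of a moving frame as long as dimensions permit,
and the cofactor vector does the last step. Conjugation with the resulting block diagonal matrix
normalizes `N`; the derivative terms enter only beyond the secondary diagonal.

PreSCF and elimination: `N = R^c N^(E_c)`, respectively `N = N^(E_r) R^r`, with a block upper
triangular nonsingular factor that is moved into the second matrix. The pair is then block
triangular, and each elimination step leaves a remainder carrying one more factor `N^(E)`, so the
coupling vanishes after `μ` steps.

Reduction to the identity: undoing the factor leads back to `{N, 1}`, so `{N, 1} ∼ {N^(E), 1}` is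
what must be shown. This needs `K` with `(K + N K') N^(E) = N K`. The relation fixes `K` on the
range of `N^(E)` through the Neumann series, and columns of grade `g` involve only columns of grade
`g + 1`. Hence a fixed-point iteration becomes stationary after finitely many steps
(`exists_intertwiner`). The row case is the transposed problem.

Projector: if two SCFs belong to one pair, the off-diagonal corners of the transition matrix solve
homogeneous equations with a strictly triangular factor and vanish (`SCFData.projector_eq`). So the
projector is unique and can be read off from any chain of transformations. The final factor `diag(I,
K)` commutes with `diag(I, 0)` and drops out, leaving only the elimination corner `A` or `B`. -/

theorem uniqueDiffOn_interval (hI : I.OrdConnected) (hn : I.Nontrivial) : UniqueDiffOn ℝ I := by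
  refine uniqueDiffOn_convex hI.convex ?_
  obtain ⟨x, hx, y, hy, hxy⟩ := hn.exists_lt
  refine ⟨(x + y) / 2, interior_mono (hI.out hx hy) ?_⟩
  rw [interior_Icc]
  exact ⟨by linarith, by linarith⟩

theorem SmoothMat.of_le {A : ℝ → Matrix ι κ ℝ} {p q : ℕ∞}
    (h : SmoothMat (p : WithTop ℕ∞) I A) (hqp : q ≤ p) : SmoothMat (q : WithTop ℕ∞) I A :=
  fun i j => (h i j).of_le (by exact_mod_cast hqp)

theorem SmoothMat.one_of_succ {A : ℝ → Matrix ι κ ℝ} {p : ℕ∞}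
    (h : SmoothMat ((p + 1 : ℕ∞) : WithTop ℕ∞) I A) : SmoothMat ((1 : ℕ∞) : WithTop ℕ∞) I A :=
  h.of_le le_add_self

theorem smoothMat_const (A : Matrix ι κ ℝ) : SmoothMat n I fun _ => A :=
  fun _ _ => contDiffOn_const

theorem SmoothMat.add {A B : ℝ → Matrix ι κ ℝ} (hA : SmoothMat n I A) (hB : SmoothMat n I B) :
    SmoothMat n I fun t => A t + B t :=
  fun i j => (hA i j).add (hB i j)

theorem SmoothMat.sub {A B : ℝ → Matrix ι κ ℝ} (hA : SmoothMat n I A) (hB : SmoothMat n I B) :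
    SmoothMat n I fun t => A t - B t :=
  fun i j => (hA i j).sub (hB i j)

theorem SmoothMat.neg {A : ℝ → Matrix ι κ ℝ} (hA : SmoothMat n I A) :
    SmoothMat n I fun t => -A t :=
  fun i j => (hA i j).neg

theorem SmoothMat.smul {A : ℝ → Matrix ι κ ℝ} (hA : SmoothMat n I A) (c : ℝ) :
    SmoothMat n I fun t => c • A t :=
  fun i j => (hA i j).const_smul c

theorem SmoothMat.transpose {A : ℝ → Matrix ι κ ℝ} (hA : SmoothMat n I A) :
    SmoothMat n I fun t => (A t)ᵀ :=
  fun i j => hA j i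

theorem SmoothMat.mul [Fintype κ] {A : ℝ → Matrix ι κ ℝ} {B : ℝ → Matrix κ ν ℝ}
    (hA : SmoothMat n I A) (hB : SmoothMat n I B) : SmoothMat n I fun t => A t * B t := by
  intro i j
  simp only [Matrix.mul_apply]
  exact ContDiffOn.sum fun k _ => (hA i k).mul (hB k j)

theorem SmoothMat.fromBlocks {ι' κ' : Type*} {A : ℝ → Matrix ι κ ℝ} {B : ℝ → Matrix ι κ' ℝ}
    {C : ℝ → Matrix ι' κ ℝ} {D : ℝ → Matrix ι' κ' ℝ} (hA : SmoothMat n I A)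
    (hB : SmoothMat n I B) (hC : SmoothMat n I C) (hD : SmoothMat n I D) :
    SmoothMat n I fun t => Matrix.fromBlocks (A t) (B t) (C t) (D t) := by
  rintro (i | i) (j | j)
  exacts [hA i j, hB i j, hC i j, hD i j]

theorem SmoothMat.contDiffOn_det [Fintype ι] [DecidableEq ι] {A : ℝ → Matrix ι ι ℝ}
    (hA : SmoothMat n I A) : ContDiffOn ℝ n (fun t => (A t).det) I := by
  simp only [Matrix.det_apply]
  exact ContDiffOn.sum fun σ _ => (contDiffOn_prod fun i _ => hA (σ i) i).const_smul _

/-- Cramer's rule: the entries are cofactor determinants divided by a nonvanishing determinant. -/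
theorem SmoothMat.inv [Fintype ι] [DecidableEq ι] {A : ℝ → Matrix ι ι ℝ}
    (hA : SmoothMat n I A) (hu : ∀ t ∈ I, IsUnit (A t)) : SmoothMat n I fun t => (A t)⁻¹ := by
  intro i j
  have hd : ∀ t ∈ I, (A t).det ≠ 0 := fun t ht =>
    ((Matrix.isUnit_iff_isUnit_det _).1 (hu t ht)).ne_zero
  have h1 : ContDiffOn ℝ n (fun t => (A t).adjugate i j) I := by
    simp only [Matrix.adjugate_apply]
    refine SmoothMat.contDiffOn_det fun k l => ?_
    by_cases h : k = j
    · subst h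
      simpa using contDiffOn_const
    · simpa [Matrix.updateRow_ne h] using hA k l
  have h2 := ((hA.contDiffOn_det).inv hd).mul h1
  refine h2.congr fun t _ => ?_
  simp [Matrix.inv_def, Ring.inverse_eq_inv']

theorem SmoothMat.differentiableWithinAt {A : ℝ → Matrix ι κ ℝ}
    (hA : SmoothMat ((1 : ℕ∞) : WithTop ℕ∞) I A) {t : ℝ} (ht : t ∈ I) (i : ι) (j : κ) :
    DifferentiableWithinAt ℝ (fun s => A s i j) I t :=
  ((hA i j).differentiableOn (by norm_num)) t ht

theorem SmoothMat.deriv {A : ℝ → Matrix ι κ ℝ} {p : ℕ∞} (hI : UniqueDiffOn ℝ I)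
    (hA : SmoothMat ((p + 1 : ℕ∞) : WithTop ℕ∞) I A) :
    SmoothMat (p : WithTop ℕ∞) I (matDeriv I A) :=
  fun i j => (hA i j).derivWithin hI (by push_cast; exact le_rfl)

theorem matDeriv_congr {A B : ℝ → Matrix ι κ ℝ} (h : ∀ t ∈ I, A t = B t) {t : ℝ} (ht : t ∈ I) :
    matDeriv I A t = matDeriv I B t := by
  ext i j
  exact derivWithin_congr (fun s hs => by simp only [h s hs]) (by simp only [h t ht])

@[simp] theorem matDeriv_const (A : Matrix ι κ ℝ) (t : ℝ) : matDeriv I (fun _ => A) t = 0 := by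
  ext i j
  simp [matDeriv]

theorem matDeriv_fromBlocks {ι' κ' : Type*} (A : ℝ → Matrix ι κ ℝ) (B : ℝ → Matrix ι κ' ℝ)
    (C : ℝ → Matrix ι' κ ℝ) (D : ℝ → Matrix ι' κ' ℝ) (t : ℝ) :
    matDeriv I (fun s => Matrix.fromBlocks (A s) (B s) (C s) (D s)) t =
      Matrix.fromBlocks (matDeriv I A t) (matDeriv I B t) (matDeriv I C t) (matDeriv I D t) := by
  ext (i | i) (j | j) <;> rfl

theorem matDeriv_transpose (A : ℝ → Matrix ι κ ℝ) (t : ℝ) :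
    matDeriv I (fun s => (A s)ᵀ) t = (matDeriv I A t)ᵀ := rfl

theorem matDeriv_neg (A : ℝ → Matrix ι κ ℝ) (t : ℝ) :
    matDeriv I (fun s => -A s) t = -matDeriv I A t := by
  ext i j
  simp [matDeriv, derivWithin.fun_neg]

theorem matDeriv_add {A B : ℝ → Matrix ι κ ℝ} (hA : SmoothMat ((1 : ℕ∞) : WithTop ℕ∞) I A)
    (hB : SmoothMat ((1 : ℕ∞) : WithTop ℕ∞) I B) {t : ℝ} (ht : t ∈ I) :
    matDeriv I (fun s => A s + B s) t = matDeriv I A t + matDeriv I B t := by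
  ext i j
  exact derivWithin_fun_add (hA.differentiableWithinAt ht i j) (hB.differentiableWithinAt ht i j)

theorem matDeriv_mul [Fintype κ] {A : ℝ → Matrix ι κ ℝ} {B : ℝ → Matrix κ ν ℝ}
    (hA : SmoothMat ((1 : ℕ∞) : WithTop ℕ∞) I A) (hB : SmoothMat ((1 : ℕ∞) : WithTop ℕ∞) I B)
    {t : ℝ} (ht : t ∈ I) :
    matDeriv I (fun s => A s * B s) t = matDeriv I A t * B t + A t * matDeriv I B t := by
  ext i j
  simp only [matDeriv, Matrix.of_apply, Matrix.add_apply, Matrix.mul_apply]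
  rw [derivWithin_fun_sum, ← Finset.sum_add_distrib]
  · refine Finset.sum_congr rfl fun k _ => ?_
    exact derivWithin_fun_mul (hA.differentiableWithinAt ht i k) (hB.differentiableWithinAt ht k j)
  · exact fun k _ => (hA.differentiableWithinAt ht i k).mul (hB.differentiableWithinAt ht k j)

theorem matDeriv_const_mul [Fintype κ] (A : Matrix ι κ ℝ) {B : ℝ → Matrix κ ν ℝ}
    (hB : SmoothMat ((1 : ℕ∞) : WithTop ℕ∞) I B) {t : ℝ} (ht : t ∈ I) :
    matDeriv I (fun s => A * B s) t = A * matDeriv I B t := by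
  rw [matDeriv_mul (smoothMat_const A) hB ht, matDeriv_const, Matrix.zero_mul, zero_add]

theorem matDeriv_mul_const [Fintype κ] {A : ℝ → Matrix ι κ ℝ} (B : Matrix κ ν ℝ)
    (hA : SmoothMat ((1 : ℕ∞) : WithTop ℕ∞) I A) {t : ℝ} (ht : t ∈ I) :
    matDeriv I (fun s => A s * B) t = matDeriv I A t * B := by
  rw [matDeriv_mul hA (smoothMat_const B) ht, matDeriv_const, Matrix.mul_zero, add_zero]

theorem matDeriv_entry_zero {A : ℝ → Matrix ι κ ℝ} {i : ι} {j : κ} (h : ∀ t ∈ I, A t i j = 0)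
    {t : ℝ} (ht : t ∈ I) : matDeriv I A t i j = 0 := by
  have : derivWithin (fun s => A s i j) I t = derivWithin (fun _ => (0 : ℝ)) I t :=
    derivWithin_congr (fun s hs => h s hs) (h t ht)
  simpa [matDeriv] using this

theorem inv_mul_of_isUnit [Fintype ι] [DecidableEq ι] {A : Matrix ι ι ℝ} (h : IsUnit A) :
    A⁻¹ * A = 1 :=
  Matrix.nonsing_inv_mul _ ((Matrix.isUnit_iff_isUnit_det _).1 h)

theorem mul_inv_of_isUnit [Fintype ι] [DecidableEq ι] {A : Matrix ι ι ℝ} (h : IsUnit A) :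
    A * A⁻¹ = 1 :=
  Matrix.mul_nonsing_inv _ ((Matrix.isUnit_iff_isUnit_det _).1 h)

theorem isUnit_inv [Fintype ι] [DecidableEq ι] {A : Matrix ι ι ℝ} (h : IsUnit A) :
    IsUnit A⁻¹ :=
  .of_mul_eq_one_right _ (mul_inv_of_isUnit h)

theorem isUnit_fromBlocks_zero₂₁ [Fintype ι] [DecidableEq ι] [Fintype κ] [DecidableEq κ]
    {A : Matrix ι ι ℝ} {B : Matrix ι κ ℝ} {D : Matrix κ κ ℝ} (hA : IsUnit A) (hD : IsUnit D) :
    IsUnit (Matrix.fromBlocks A B 0 D) :=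
  Matrix.isUnit_fromBlocks_zero₂₁.2 ⟨hA, hD⟩

theorem isUnit_fromBlocks_zero₁₂ [Fintype ι] [DecidableEq ι] [Fintype κ] [DecidableEq κ]
    {A : Matrix ι ι ℝ} {C : Matrix κ ι ℝ} {D : Matrix κ κ ℝ} (hA : IsUnit A) (hD : IsUnit D) :
    IsUnit (Matrix.fromBlocks A 0 C D) :=
  Matrix.isUnit_fromBlocks_zero₁₂.2 ⟨hA, hD⟩

/-- The product rule for `K⁻¹ K = 1`. -/
theorem matDeriv_inv_mul [Fintype ι] [DecidableEq ι] {K : ℝ → Matrix ι ι ℝ}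
    (hK : SmoothMat ((1 : ℕ∞) : WithTop ℕ∞) I K) (hu : ∀ t ∈ I, IsUnit (K t)) {t : ℝ}
    (ht : t ∈ I) :
    matDeriv I (fun s => (K s)⁻¹) t * K t + (K t)⁻¹ * matDeriv I K t = 0 := by
  rw [← matDeriv_mul (hK.inv hu) hK ht,
    matDeriv_congr (B := fun _ => 1) (fun s hs => inv_mul_of_isUnit (hu s hs)) ht, matDeriv_const]

end Calculus

/-! ### Transformations form a groupoid -/

section Groupoid

variable {n : Type*} [Fintype n] [DecidableEq n] {m : ℕ∞} {I : Set ℝ}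

theorem Transforms.of_le {m' : ℕ∞} (hm : m' ≤ m) {L K E F E' F' : ℝ → Matrix n n ℝ}
    (h : Transforms m I L K E F E' F') : Transforms m' I L K E F E' F' :=
  ⟨h.smooth_L.of_le hm, h.smooth_K.of_le (by gcongr), h.isUnit_L, h.isUnit_K, h.eq_E, h.eq_F⟩

theorem Transforms.trans {L K L' K' E F E' F' E'' F'' : ℝ → Matrix n n ℝ}
    (h : Transforms m I L K E F E' F') (h' : Transforms m I L' K' E' F' E'' F'') :
    Transforms m I (fun t => L' t * L t) (fun t => K t * K' t) E F E'' F'' where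
  smooth_L := h'.smooth_L.mul h.smooth_L
  smooth_K := h.smooth_K.mul h'.smooth_K
  isUnit_L t ht := (h'.isUnit_L t ht).mul (h.isUnit_L t ht)
  isUnit_K t ht := (h.isUnit_K t ht).mul (h'.isUnit_K t ht)
  eq_E t ht := by rw [h'.eq_E t ht, h.eq_E t ht]; simp only [Matrix.mul_assoc]
  eq_F t ht := by
    rw [h'.eq_F t ht, h.eq_F t ht, h.eq_E t ht,
      matDeriv_mul h.smooth_K.one_of_succ h'.smooth_K.one_of_succ ht]
    noncomm_ring

theorem Transforms.symm {L K E F E' F' : ℝ → Matrix n n ℝ}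
    (h : Transforms m I L K E F E' F') :
    Transforms m I (fun t => (L t)⁻¹) (fun t => (K t)⁻¹) E' F' E F where
  smooth_L := h.smooth_L.inv h.isUnit_L
  smooth_K := h.smooth_K.inv h.isUnit_K
  isUnit_L t ht := isUnit_inv (h.isUnit_L t ht)
  isUnit_K t ht := isUnit_inv (h.isUnit_K t ht)
  eq_E t ht := by
    have hL := inv_mul_of_isUnit (h.isUnit_L t ht)
    have hK := mul_inv_of_isUnit (h.isUnit_K t ht)
    rw [h.eq_E t ht]
    calc E t = ((L t)⁻¹ * L t) * E t * (K t * (K t)⁻¹) := by rw [hL, hK]; simp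
      _ = _ := by noncomm_ring
  eq_F t ht := by
    have hL := inv_mul_of_isUnit (h.isUnit_L t ht)
    have hK := mul_inv_of_isUnit (h.isUnit_K t ht)
    have hK' := inv_mul_of_isUnit (h.isUnit_K t ht)
    have hd := matDeriv_inv_mul h.smooth_K.one_of_succ h.isUnit_K ht
    -- This is `(K⁻¹ K)' = 0`, multiplied by `K` on the left and by `K⁻¹` on the right.
    have hd' : K t * matDeriv I (fun s => (K s)⁻¹) t = -(matDeriv I K t * (K t)⁻¹) := by
      rw [eq_neg_iff_add_eq_zero]
      calc _ = K t * (matDeriv I (fun s => (K s)⁻¹) t * (K t * (K t)⁻¹))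
            + (K t * (K t)⁻¹) * matDeriv I K t * (K t)⁻¹ := by rw [hK]; simp
        _ = K t * (matDeriv I (fun s => (K s)⁻¹) t * K t + (K t)⁻¹ * matDeriv I K t)
            * (K t)⁻¹ := by noncomm_ring
        _ = 0 := by rw [hd]; simp
    rw [h.eq_F t ht, h.eq_E t ht]
    calc F t = ((L t)⁻¹ * L t) * F t * (K t * (K t)⁻¹) := by rw [hL, hK]; simp
      _ = (L t)⁻¹ * L t * F t * (K t * (K t)⁻¹) + (L t)⁻¹ * L t * E t * (matDeriv I K t * (K t)⁻¹)
          + (L t)⁻¹ * L t * E t * -(matDeriv I K t * (K t)⁻¹) := by noncomm_ring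
      _ = _ := by rw [← hd']; noncomm_ring

theorem Transforms.congr {L K E F E' F' G H : ℝ → Matrix n n ℝ}
    (h : Transforms m I L K E F E' F') (hE : ∀ t ∈ I, G t = E' t) (hF : ∀ t ∈ I, H t = F' t) :
    Transforms m I L K E F G H :=
  { h with
    eq_E := fun t ht => by rw [hE t ht, h.eq_E t ht]
    eq_F := fun t ht => by rw [hF t ht, h.eq_F t ht] }

/-- A transformation of the second diagonal block extends to a block diagonal pair. -/
theorem Transforms.fromBlocks_one {ι κ : Type*} [Fintype ι] [DecidableEq ι] [Fintype κ]
    [DecidableEq κ] {L K E F E' F' : ℝ → Matrix κ κ ℝ} (Ω : ℝ → Matrix ι ι ℝ)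
    (h : Transforms m I L K E F E' F') :
    Transforms m I (fun t => fromBlocks (1 : Matrix ι ι ℝ) 0 0 (L t))
      (fun t => fromBlocks 1 0 0 (K t)) (fun t => fromBlocks 1 0 0 (E t))
      (fun t => fromBlocks (Ω t) 0 0 (F t)) (fun t => fromBlocks 1 0 0 (E' t))
      (fun t => fromBlocks (Ω t) 0 0 (F' t)) where
  smooth_L := (smoothMat_const _).fromBlocks (smoothMat_const _) (smoothMat_const _) h.smooth_L
  smooth_K := (smoothMat_const _).fromBlocks (smoothMat_const _) (smoothMat_const _) h.smooth_K
  isUnit_L t ht := isUnit_fromBlocks_zero₂₁ isUnit_one (h.isUnit_L t ht)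
  isUnit_K t ht := isUnit_fromBlocks_zero₂₁ isUnit_one (h.isUnit_K t ht)
  eq_E t ht := by simp [fromBlocks_multiply, h.eq_E t ht]
  eq_F t ht := by
    simp [fromBlocks_multiply, h.eq_F t ht, matDeriv_fromBlocks, fromBlocks_add]

end Groupoid

end DAE

namespace DAE

/-! ### Uniqueness of the canonical projector -/

section Uniqueness

variable {ι κ : Type*} [Fintype ι] [Fintype κ] {I : Set ℝ}

/-- Rows vanish from the largest grade downwards: row `x` of the right-hand side sees only rows of
larger grade, and where these vanish on all of `I` so do their derivatives. -/
theorem eq_zero_of_strict {b : κ → ℕ} {N : ℝ → Matrix κ κ ℝ}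
    (hN : ∀ t ∈ I, ∀ x y, b y ≤ b x → N t x y = 0) {X : ℝ → Matrix κ ι ℝ}
    {Ω : ℝ → Matrix ι ι ℝ} {c : ℝ}
    (h : ∀ t ∈ I, X t = N t * (X t * Ω t + c • matDeriv I X t)) : ∀ t ∈ I, X t = 0 := by
  -- For `j = 0` the condition exceeds every grade, so the induction starts vacuously.
  have key : ∀ j : ℕ, ∀ x, Finset.univ.sup b + 1 ≤ b x + j → ∀ t ∈ I, ∀ i, X t x i = 0 := by
    intro j
    induction j with
    | zero =>
      intro x hx
      have := Finset.le_sup (f := b) (Finset.mem_univ x)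
      omega
    | succ j ih =>
      intro x hx t ht i
      rw [h t ht, Matrix.mul_apply]
      refine Finset.sum_eq_zero fun y _ => ?_
      rcases le_or_gt (b y) (b x) with hxy | hxy
      · rw [hN t ht x y hxy, zero_mul]
      · have hy := ih y (by omega)
        have h1 : (X t * Ω t) y i = 0 := by
          rw [Matrix.mul_apply]
          exact Finset.sum_eq_zero fun z _ => by rw [hy t ht z, zero_mul]
        have h2 : matDeriv I X t y i = 0 := matDeriv_entry_zero (fun s hs => hy s hs i) ht
        simp [h1, h2]
  intro t ht
  ext x i
  exact key (Finset.univ.sup b + 1) x (by omega) t ht i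

variable {n : Type*} [Fintype n] [DecidableEq n]

/-- `L, K` transform `{E, F}` into a standard canonical form `{D + N, Ω + (1 - D)}`, the
projection `D` separating the differential from the algebraic part. -/
structure SCFData (I : Set ℝ) (E F : ℝ → Matrix n n ℝ) (D : Matrix n n ℝ)
    (N Ω L K : ℝ → Matrix n n ℝ) (b : n → ℕ) : Prop where
  idem : D * D = D
  mulN : ∀ t, D * N t = 0
  Nmul : ∀ t, N t * D = 0
  mulΩ : ∀ t, D * Ω t = Ω t
  Ωmul : ∀ t, Ω t * D = Ω t
  strict : ∀ t ∈ I, ∀ x y, b y ≤ b x → N t x y = 0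
  transforms : Transforms 0 I L K E F (fun t => D + N t) (fun t => Ω t + (1 - D))

/-- The splitting `d + a` and its enumeration are absorbed into a projection `D` and a grade `b`.
Two standard canonical forms with a priori different `d`, and with upper or lower triangular `N`,
then live in the same matrix algebra. -/
theorem IsCanonicalProjector.exists_scfData {E F P : ℝ → Matrix n n ℝ}
    (h : IsCanonicalProjector I E F P) :
    ∃ (D : Matrix n n ℝ) (N Ω L K : ℝ → Matrix n n ℝ) (b : n → ℕ),
      SCFData I E F D N Ω L K b ∧ ∀ t ∈ I, P t = K t * D * (K t)⁻¹ := by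
  obtain ⟨d, a, e, Ω, N, L, K, hN, hT, hP⟩ := h
  have hb : ∃ c : Fin a → ℕ, ∀ t ∈ I, ∀ x y, c y ≤ c x → N t x y = 0 := by
    rcases hN with hN | hN
    · exact ⟨fun x => x, fun t ht x y hxy => hN t ht x y (Fin.le_def.2 hxy)⟩
    -- A lower triangular `N` is upper triangular for the reversed grade.
    · exact ⟨fun x => a - x, fun t ht x y hxy => hN t ht x y (Fin.le_def.2 (by
        have : a - (y : ℕ) ≤ a - x := hxy
        omega))⟩
  obtain ⟨c, hc⟩ := hb
  refine ⟨(fromBlocks 1 0 0 0 : Matrix (Fin d ⊕ Fin a) (Fin d ⊕ Fin a) ℝ).submatrix e e,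
    fun t => (fromBlocks (0 : Matrix (Fin d) (Fin d) ℝ) 0 0 (N t)).submatrix e e,
    fun t => (fromBlocks (Ω t) 0 0 (0 : Matrix (Fin a) (Fin a) ℝ)).submatrix e e, L, K,
    fun x => Sum.elim (fun _ => 0) c (e x), ⟨?_, ?_, ?_, ?_, ?_, ?_, ?_⟩, hP⟩
  · simp [Matrix.submatrix_mul_equiv, fromBlocks_multiply]
  · intro t; simp [Matrix.submatrix_mul_equiv, fromBlocks_multiply, Matrix.fromBlocks_zero]
  · intro t; simp [Matrix.submatrix_mul_equiv, fromBlocks_multiply, Matrix.fromBlocks_zero]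
  · intro t; simp [Matrix.submatrix_mul_equiv, fromBlocks_multiply]
  · intro t; simp [Matrix.submatrix_mul_equiv, fromBlocks_multiply]
  · intro t ht x y hxy
    rcases hx : e x with i | i <;> rcases hy : e y with j | j <;>
      simp only [Matrix.submatrix_apply, hx, hy, fromBlocks_apply₁₁, fromBlocks_apply₁₂,
        fromBlocks_apply₂₁, fromBlocks_apply₂₂, Matrix.zero_apply]
    simp only [hx, hy, Sum.elim_inr] at hxy
    exact hc t ht i j hxy
  · refine hT.congr (fun t _ => ?_) (fun t _ => ?_)
    · ext x y
      rcases hx : e x with i | i <;> rcases hy : e y with j | j <;> simp [hx, hy]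
    · have h1 : ∀ x y, (1 : Matrix n n ℝ) x y =
          (fromBlocks 1 0 0 1 : Matrix (Fin d ⊕ Fin a) (Fin d ⊕ Fin a) ℝ) (e x) (e y) := by
        simp [fromBlocks_one, Matrix.one_apply]
      ext x y
      rcases hx : e x with i | i <;> rcases hy : e y with j | j <;>
        simp [h1, hx, hy, -fromBlocks_one]

/-- For the transition matrix `T = K₁⁻¹ K₂`, the corner `X = (1 - D₁) T D₂` satisfies `X = N₁ (X Ω₂
- X')`, and `Z = D₁ T (1 - D₂)` satisfies `Z = (Ω₁ Z + Z') N₂`. Both vanish, so `D₁ T = T D₂`, which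
is equality of the projectors. -/
theorem SCFData.projector_eq {E F : ℝ → Matrix n n ℝ}
    {D₁ D₂ : Matrix n n ℝ} {N₁ Ω₁ L₁ K₁ N₂ Ω₂ L₂ K₂ : ℝ → Matrix n n ℝ} {b₁ b₂ : n → ℕ}
    (h₁ : SCFData I E F D₁ N₁ Ω₁ L₁ K₁ b₁) (h₂ : SCFData I E F D₂ N₂ Ω₂ L₂ K₂ b₂) :
    ∀ t ∈ I, K₁ t * D₁ * (K₁ t)⁻¹ = K₂ t * D₂ * (K₂ t)⁻¹ := by
  have hT := h₁.transforms.symm.trans h₂.transforms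
  set T : ℝ → Matrix n n ℝ := fun t => (K₁ t)⁻¹ * K₂ t with hTdef
  set M : ℝ → Matrix n n ℝ := fun t => (L₂ t * (L₁ t)⁻¹)⁻¹ with hM
  have hTs := hT.smooth_K.one_of_succ
  have e1 : ∀ t ∈ I, (D₁ + N₁ t) * T t = M t * (D₂ + N₂ t) := fun t ht => by
    have := hT.eq_E t ht
    rw [this, hM]
    simp only [← Matrix.mul_assoc]
    rw [Matrix.mul_assoc _ (L₂ t) (L₁ t)⁻¹, inv_mul_of_isUnit (hT.isUnit_L t ht), Matrix.one_mul]
  have e2 : ∀ t ∈ I, (Ω₁ t + (1 - D₁)) * T t + (D₁ + N₁ t) * matDeriv I T t =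
      M t * (Ω₂ t + (1 - D₂)) := fun t ht => by
    have := hT.eq_F t ht
    rw [this, hM, Matrix.mul_add]
    simp only [← Matrix.mul_assoc]
    rw [Matrix.mul_assoc _ (L₂ t) (L₁ t)⁻¹, inv_mul_of_isUnit (hT.isUnit_L t ht), Matrix.one_mul]
    simp only [hTdef, Matrix.one_mul]
  have X0 : ∀ t ∈ I, (1 - D₁) * T t * D₂ = 0 := by
    refine eq_zero_of_strict (X := fun t => (1 - D₁) * T t * D₂) (Ω := Ω₂) (c := -1)
      h₁.strict fun t ht => ?_
    have hd : matDeriv I (fun t => (1 - D₁) * T t * D₂) t = (1 - D₁) * matDeriv I T t * D₂ := by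
      rw [matDeriv_mul_const _ ((smoothMat_const _).mul hTs) ht, matDeriv_const_mul _ hTs ht]
    rw [hd]
    have a1 : N₁ t * T t * D₂ = (1 - D₁) * M t * D₂ := by
      have := congrArg (fun A => (1 - D₁) * A * D₂) (e1 t ht)
      calc N₁ t * T t * D₂ = ((D₁ - D₁ * D₁) + (N₁ t - D₁ * N₁ t)) * T t * D₂ := by
            rw [h₁.idem, h₁.mulN]; simp
        _ = (1 - D₁) * ((D₁ + N₁ t) * T t) * D₂ := by noncomm_ring
        _ = (1 - D₁) * (M t * (D₂ + N₂ t)) * D₂ := this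
        _ = (1 - D₁) * M t * (D₂ * D₂ + N₂ t * D₂) := by noncomm_ring
        _ = _ := by rw [h₂.idem, h₂.Nmul, add_zero]
    have a2 : (1 - D₁) * T t * D₂ + N₁ t * matDeriv I T t * D₂ = (1 - D₁) * M t * Ω₂ t := by
      have := congrArg (fun A => (1 - D₁) * A * D₂) (e2 t ht)
      calc (1 - D₁) * T t * D₂ + N₁ t * matDeriv I T t * D₂
          = ((Ω₁ t - D₁ * Ω₁ t) + (1 - D₁ - D₁ + D₁ * D₁)) * T t * D₂
            + ((D₁ - D₁ * D₁) + (N₁ t - D₁ * N₁ t)) * matDeriv I T t * D₂ := by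
            rw [h₁.idem, h₁.mulN, h₁.mulΩ]; simp
        _ = (1 - D₁) * ((Ω₁ t + (1 - D₁)) * T t + (D₁ + N₁ t) * matDeriv I T t) * D₂ := by
            noncomm_ring
        _ = (1 - D₁) * (M t * (Ω₂ t + (1 - D₂))) * D₂ := this
        _ = (1 - D₁) * M t * (Ω₂ t * D₂ + (D₂ - D₂ * D₂)) := by noncomm_ring
        _ = _ := by rw [h₂.idem, h₂.Ωmul, sub_self, add_zero]
    have a3 : (1 - D₁) * M t * Ω₂ t = N₁ t * T t * Ω₂ t := by
      rw [← h₂.mulΩ t, ← Matrix.mul_assoc, ← Matrix.mul_assoc, a1]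
    calc (1 - D₁) * T t * D₂ = N₁ t * T t * Ω₂ t - N₁ t * matDeriv I T t * D₂ := by
          rw [← a3, ← a2]; simp
      _ = (N₁ t - N₁ t * D₁) * T t * (D₂ * Ω₂ t) -
          (N₁ t - N₁ t * D₁) * matDeriv I T t * D₂ := by rw [h₁.Nmul, h₂.mulΩ]; simp
      _ = _ := by rw [neg_smul, one_smul]; noncomm_ring
  have Z0 : ∀ t ∈ I, (D₁ * T t * (1 - D₂))ᵀ = 0 := by
    -- In the equation for `Z` the nilpotent factor stands on the right. Transposition moves it to
    -- the left and reverses the grade, hence `c`.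
    obtain ⟨c, hc⟩ : ∃ c : n → ℕ, ∀ x y, c y ≤ c x → b₂ x ≤ b₂ y :=
      ⟨fun x => Finset.univ.sup b₂ - b₂ x, fun x y hxy => by
        have hxy' : Finset.univ.sup b₂ - b₂ y ≤ Finset.univ.sup b₂ - b₂ x := hxy
        have h1 := Finset.le_sup (f := b₂) (Finset.mem_univ x)
        have h2 := Finset.le_sup (f := b₂) (Finset.mem_univ y)
        omega⟩
    refine eq_zero_of_strict (X := fun t => (D₁ * T t * (1 - D₂))ᵀ) (N := fun t => (N₂ t)ᵀ)
      (Ω := fun t => (Ω₁ t)ᵀ) (c := 1) (b := c)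
      (fun t ht x y hxy => h₂.strict t ht y x (hc x y hxy)) fun t ht => ?_
    have hd : matDeriv I (fun t => D₁ * T t * (1 - D₂)) t = D₁ * matDeriv I T t * (1 - D₂) := by
      rw [matDeriv_mul_const _ ((smoothMat_const _).mul hTs) ht, matDeriv_const_mul _ hTs ht]
    rw [matDeriv_transpose, hd, one_smul, ← Matrix.transpose_mul, ← Matrix.transpose_add,
      ← Matrix.transpose_mul]
    congr 1
    have a1 : D₁ * T t * (1 - D₂) = D₁ * M t * N₂ t := by
      have := congrArg (fun A => D₁ * A * (1 - D₂)) (e1 t ht)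
      calc D₁ * T t * (1 - D₂) = (D₁ * D₁ + D₁ * N₁ t) * T t * (1 - D₂) := by
            rw [h₁.idem, h₁.mulN, add_zero]
        _ = D₁ * ((D₁ + N₁ t) * T t) * (1 - D₂) := by noncomm_ring
        _ = D₁ * (M t * (D₂ + N₂ t)) * (1 - D₂) := this
        _ = D₁ * M t * ((D₂ - D₂ * D₂) + (N₂ t - N₂ t * D₂)) := by noncomm_ring
        _ = _ := by rw [h₂.idem, h₂.Nmul]; simp
    have a2 : Ω₁ t * T t * (1 - D₂) + D₁ * matDeriv I T t * (1 - D₂) = D₁ * M t * (1 - D₂) := by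
      have := congrArg (fun A => D₁ * A * (1 - D₂)) (e2 t ht)
      calc Ω₁ t * T t * (1 - D₂) + D₁ * matDeriv I T t * (1 - D₂)
          = (D₁ * Ω₁ t + (D₁ - D₁ * D₁)) * T t * (1 - D₂)
            + (D₁ * D₁ + D₁ * N₁ t) * matDeriv I T t * (1 - D₂) := by
            rw [h₁.idem, h₁.mulN, h₁.mulΩ]; simp
        _ = D₁ * ((Ω₁ t + (1 - D₁)) * T t + (D₁ + N₁ t) * matDeriv I T t) * (1 - D₂) := by
            noncomm_ring
        _ = D₁ * (M t * (Ω₂ t + (1 - D₂))) * (1 - D₂) := this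
        _ = D₁ * M t * ((Ω₂ t - Ω₂ t * D₂) + (1 - D₂ - D₂ + D₂ * D₂)) := by noncomm_ring
        _ = _ := by rw [h₂.idem, h₂.Ωmul]; simp
    have a3 : N₂ t = (1 - D₂) * N₂ t := by rw [Matrix.sub_mul, h₂.mulN]; simp
    have a4 : Ω₁ t * (D₁ * T t * (1 - D₂)) = Ω₁ t * T t * (1 - D₂) := by
      rw [← Matrix.mul_assoc, ← Matrix.mul_assoc, h₁.Ωmul]
    rw [a4, a2, a1, Matrix.mul_assoc (D₁ * M t) (1 - D₂), ← a3]
  intro t ht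
  have hK₁ := mul_inv_of_isUnit (h₁.transforms.isUnit_K t ht)
  have hK₂ := mul_inv_of_isUnit (h₂.transforms.isUnit_K t ht)
  have hc : D₁ * T t = T t * D₂ := by
    have z1 := X0 t ht
    have z2 : D₁ * T t * (1 - D₂) = 0 := by
      rw [← Matrix.transpose_transpose (D₁ * T t * (1 - D₂)), Z0 t ht, Matrix.transpose_zero]
    have : D₁ * T t - T t * D₂ = D₁ * T t * (1 - D₂) - (1 - D₁) * T t * D₂ := by noncomm_ring
    rw [← sub_eq_zero, this, z1, z2, sub_zero]
  calc K₁ t * D₁ * (K₁ t)⁻¹ = K₁ t * D₁ * (K₁ t)⁻¹ * (K₂ t * (K₂ t)⁻¹) := by rw [hK₂]; simp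
    _ = K₁ t * (D₁ * T t) * (K₂ t)⁻¹ := by simp only [hTdef]; noncomm_ring
    _ = K₁ t * (K₁ t)⁻¹ * K₂ t * D₂ * (K₂ t)⁻¹ := by rw [hc]; simp only [hTdef]; noncomm_ring
    _ = _ := by rw [hK₁, Matrix.one_mul]

theorem IsCanonicalProjector.unique {E F P Q : ℝ → Matrix n n ℝ}
    (hP : IsCanonicalProjector I E F P) (hQ : IsCanonicalProjector I E F Q) :
    ∀ t ∈ I, Q t = P t := by
  obtain ⟨D₁, N₁, Ω₁, L₁, K₁, b₁, h₁, e₁⟩ := hP.exists_scfData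
  obtain ⟨D₂, N₂, Ω₂, L₂, K₂, b₂, h₂, e₂⟩ := hQ.exists_scfData
  intro t ht
  rw [e₁ t ht, e₂ t ht, h₁.projector_eq h₂ t ht]

end Uniqueness

end DAE

namespace DAE

/-! ### Matrices that raise the block index -/

section Degree

variable {κ : Type*} {b : κ → ℕ}

/-- All entries `X x y` with `b y < b x + k` vanish: with respect to the grading `b`, the matrix is
block upper triangular for `k = 0`, strictly block upper triangular for `k = 1`, and so on. -/
def UpperDeg (b : κ → ℕ) (k : ℕ) (X : Matrix κ κ ℝ) : Prop :=
  ∀ x y, b y < b x + k → X x y = 0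

variable {k l : ℕ} {X Y : Matrix κ κ ℝ}

theorem UpperDeg.mono (h : UpperDeg b k X) (hl : l ≤ k) : UpperDeg b l X :=
  fun x y hxy => h x y (by omega)

theorem UpperDeg.add (hX : UpperDeg b k X) (hY : UpperDeg b k Y) : UpperDeg b k (X + Y) :=
  fun x y h => by rw [Matrix.add_apply, hX x y h, hY x y h, add_zero]

theorem UpperDeg.sub (hX : UpperDeg b k X) (hY : UpperDeg b k Y) : UpperDeg b k (X - Y) :=
  fun x y h => by rw [Matrix.sub_apply, hX x y h, hY x y h, sub_zero]

theorem UpperDeg.smul (hX : UpperDeg b k X) (c : ℝ) : UpperDeg b k (c • X) :=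
  fun x y h => by rw [Matrix.smul_apply, hX x y h, smul_zero]

theorem UpperDeg.one [DecidableEq κ] : UpperDeg b 0 (1 : Matrix κ κ ℝ) :=
  fun x y h => Matrix.one_apply_ne fun e => by subst e; omega

theorem UpperDeg.mul [Fintype κ] (hX : UpperDeg b k X) (hY : UpperDeg b l Y) :
    UpperDeg b (k + l) (X * Y) := by
  intro x y h
  rw [Matrix.mul_apply]
  refine Finset.sum_eq_zero fun z _ => ?_
  rcases lt_or_ge (b z) (b x + k) with hz | hz
  · rw [hX x z hz, zero_mul]
  · rw [hY z y (by omega), mul_zero]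

theorem UpperDeg.mul_left [Fintype κ] (hX : UpperDeg b 0 X) (hY : UpperDeg b k Y) :
    UpperDeg b k (X * Y) := by
  simpa using hX.mul hY

theorem UpperDeg.transpose {ν : ℕ} (hb : ∀ x, b x ≤ ν) (hX : UpperDeg b k X) :
    UpperDeg (fun x => ν - b x) k Xᵀ :=
  fun x y hxy => hX y x (by have := hb x; have := hb y; simp only at hxy; omega)

theorem UpperDeg.of_transpose {ν : ℕ} (hb : ∀ x, b x ≤ ν)
    (hX : UpperDeg (fun x => ν - b x) k Xᵀ) : UpperDeg b k X :=
  fun x y hxy => hX y x (by have := hb x; have := hb y; simp only; omega)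

theorem UpperDeg.matDeriv {X : ℝ → Matrix κ κ ℝ} {I : Set ℝ} (h : ∀ t ∈ I, UpperDeg b k (X t))
    {t : ℝ} (ht : t ∈ I) : UpperDeg b k (matDeriv I X t) :=
  fun x y hxy => matDeriv_entry_zero (fun s hs => h s hs x y hxy) ht

/-! ### Invertibility modulo higher degree, and shift matrices. -/

variable [Fintype κ] [DecidableEq κ]

theorem UpperDeg.inv (hX : UpperDeg b 0 X) (hu : IsUnit X) : UpperDeg b 0 X⁻¹ := by
  have := hu.invertible
  exact fun x y h => Matrix.blockTriangular_inv_of_blockTriangular (b := b)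
    (fun i j hij => hX i j hij) h

theorem UpperDeg.isNilpotent (hX : UpperDeg b 1 X) : IsNilpotent X := by
  have hpow : ∀ j, UpperDeg b j (X ^ j) := by
    intro j
    induction j with
    | zero => simpa using UpperDeg.one
    | succ j ih => rw [pow_succ]; exact ih.mul hX
  refine ⟨Finset.univ.sup b + 1, ?_⟩
  ext x y
  have := Finset.le_sup (f := b) (Finset.mem_univ y)
  exact hpow _ x y (by omega)

/-- `X + Y = X (1 + X⁻¹ Y)`, where `X⁻¹ Y` has degree 1 and is nilpotent: terms of positive degree
never affect invertibility. -/
theorem UpperDeg.isUnit_add (hX : UpperDeg b 0 X) (hu : IsUnit X) (hY : UpperDeg b 1 Y) :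
    IsUnit (X + Y) := by
  have h : X + Y = X * (1 + X⁻¹ * Y) := by
    rw [Matrix.mul_add, Matrix.mul_one, ← Matrix.mul_assoc, mul_inv_of_isUnit hu, Matrix.one_mul]
  rw [h]
  exact hu.mul ((hX.inv hu).mul_left hY).isNilpotent.isUnit_one_add

/-- A matrix `M` that raises the block index by one, whose columns with positive block index are
orthonormal and whose other columns vanish. -/
structure IsShift (b : κ → ℕ) (M : Matrix κ κ ℝ) : Prop where
  entry : ∀ x y, b y ≠ b x + 1 → M x y = 0
  gram : Mᵀ * M = Matrix.diagonal fun y => if b y = 0 then 0 else 1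

variable {M : Matrix κ κ ℝ}

theorem IsShift.upperDeg (hM : IsShift b M) : UpperDeg b 1 M :=
  fun x y h => hM.entry x y (by omega)

/-- `Mᵀ M` is the projection that deletes the columns of grade 0, and a matrix of degree 1 has only
zeros there. -/
theorem IsShift.mul_gram (hM : IsShift b M) (hX : UpperDeg b 1 X) : X * (Mᵀ * M) = X := by
  ext x y
  rw [hM.gram, Matrix.mul_diagonal]
  split_ifs with h
  · rw [hX x y (by omega), zero_mul]
  · rw [mul_one]

theorem IsShift.mul_gram_self (hM : IsShift b M) : M * Mᵀ * M = M := by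
  rw [Matrix.mul_assoc, hM.mul_gram hM.upperDeg]

theorem IsShift.mul_transpose (hM : IsShift b M) (hX : UpperDeg b (k + 1) X) :
    UpperDeg b k (X * Mᵀ) := by
  intro x y h
  rw [Matrix.mul_apply]
  refine Finset.sum_eq_zero fun z _ => ?_
  by_cases hz : b z = b y + 1
  · rw [hX x z (by omega), zero_mul]
  · rw [Matrix.transpose_apply, hM.entry y z hz, mul_zero]

theorem IsShift.upperDeg_compl (hM : IsShift b M) : UpperDeg b 0 (1 - M * Mᵀ) :=
  UpperDeg.one.sub (hM.mul_transpose hM.upperDeg)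

theorem IsShift.conj_upperDeg (hM : IsShift b M) (hX : UpperDeg b 0 X) :
    UpperDeg b 0 (M * X * Mᵀ + (1 - M * Mᵀ)) :=
  (hM.mul_transpose (by simpa using hM.upperDeg.mul hX)).add hM.upperDeg_compl

/-- The inverse is the same expression with `X⁻¹`: since `M X` has degree 1, it absorbs the
projection `Mᵀ M` in the product. -/
theorem IsShift.isUnit_conj (hM : IsShift b M) (hX : UpperDeg b 0 X) (hu : IsUnit X) :
    IsUnit (M * X * Mᵀ + (1 - M * Mᵀ)) := by
  refine .of_mul_eq_one (M * X⁻¹ * Mᵀ + (1 - M * Mᵀ)) ?_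
  have h1 : M * Mᵀ * M = M := hM.mul_gram_self
  have h2 : Mᵀ * M * Mᵀ = Mᵀ := by
    have := congrArg Matrix.transpose h1
    simpa [Matrix.mul_assoc] using this
  have h3 : M * X * (Mᵀ * M) = M * X := hM.mul_gram (by simpa using hM.upperDeg.mul hX)
  calc _ = (M * X * (Mᵀ * M)) * X⁻¹ * Mᵀ + (M * X * Mᵀ - M * X * (Mᵀ * M * Mᵀ))
        + (M - M * Mᵀ * M) * X⁻¹ * Mᵀ + (1 - M * Mᵀ - M * Mᵀ + M * Mᵀ * M * Mᵀ) := by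
        noncomm_ring
    _ = M * (X * X⁻¹) * Mᵀ + (1 - M * Mᵀ) := by rw [h1, h2, h3]; noncomm_ring
    _ = 1 := by rw [mul_inv_of_isUnit hu]; simp

end Degree

/-! ### Pairs `{N, 1}` with strictly upper triangular `N` -/

section Strict

variable {κ : Type*} [Fintype κ] [DecidableEq κ] {b : κ → ℕ} {m : ℕ∞} {I : Set ℝ}
  {N V : ℝ → Matrix κ κ ℝ}

theorem isUnit_add_mul_deriv (hN : ∀ t ∈ I, UpperDeg b 1 (N t)) (hV : ∀ t ∈ I, UpperDeg b 0 (V t))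
    (hu : ∀ t ∈ I, IsUnit (V t)) {t : ℝ} (ht : t ∈ I) :
    IsUnit (V t + N t * matDeriv I V t) :=
  (hV t ht).isUnit_add (hu t ht) ((hN t ht).mul (UpperDeg.matDeriv hV ht))

omit [DecidableEq κ] in
theorem smoothMat_add_mul_deriv (hI : UniqueDiffOn ℝ I) (hNs : SmoothMat (m : WithTop ℕ∞) I N)
    (hVs : SmoothMat ((m + 1 : ℕ∞) : WithTop ℕ∞) I V) :
    SmoothMat (m : WithTop ℕ∞) I fun t => V t + N t * matDeriv I V t :=
  (hVs.of_le le_self_add).add (hNs.mul (hVs.deriv hI))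

/-- With `K = V` the second matrix becomes `V + N V'`; its inverse as left factor restores the
identity. -/
theorem transforms_strict (hI : UniqueDiffOn ℝ I) (hN : ∀ t ∈ I, UpperDeg b 1 (N t))
    (hV : ∀ t ∈ I, UpperDeg b 0 (V t)) (hu : ∀ t ∈ I, IsUnit (V t))
    (hNs : SmoothMat (m : WithTop ℕ∞) I N)
    (hVs : SmoothMat ((m + 1 : ℕ∞) : WithTop ℕ∞) I V) :
    Transforms m I (fun t => (V t + N t * matDeriv I V t)⁻¹) V N (fun _ => 1)
      (fun t => (V t + N t * matDeriv I V t)⁻¹ * N t * V t) (fun _ => 1) where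
  smooth_L := (smoothMat_add_mul_deriv hI hNs hVs).inv fun _ => isUnit_add_mul_deriv hN hV hu
  smooth_K := hVs
  isUnit_L t ht := isUnit_inv (isUnit_add_mul_deriv hN hV hu ht)
  isUnit_K := hu
  eq_E _ _ := rfl
  eq_F t ht := by
    rw [Matrix.mul_one, Matrix.mul_assoc, ← Matrix.mul_add,
      inv_mul_of_isUnit (isUnit_add_mul_deriv hN hV hu ht)]

/-- `(V + N V')⁻¹ - V⁻¹` contains a factor `N`, and the transformed leading matrix contributes
another. On the secondary diagonal the transformation therefore acts like conjugation with `V`. -/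
theorem strict_transform_sub (hN : ∀ t ∈ I, UpperDeg b 1 (N t))
    (hV : ∀ t ∈ I, UpperDeg b 0 (V t)) (hu : ∀ t ∈ I, IsUnit (V t)) {t : ℝ} (ht : t ∈ I) :
    UpperDeg b 2 ((V t + N t * matDeriv I V t)⁻¹ * N t * V t - (V t)⁻¹ * N t * V t) := by
  set W := V t + N t * matDeriv I V t with hW
  have hWu : IsUnit W := isUnit_add_mul_deriv hN hV hu ht
  have hV' := UpperDeg.matDeriv hV ht
  have hWd : UpperDeg b 0 W := (hV t ht).add (((hN t ht).mul hV').mono (by omega))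
  have h : W⁻¹ * N t * V t - (V t)⁻¹ * N t * V t =
      -1 • (W⁻¹ * N t * (matDeriv I V t * (V t)⁻¹ * N t) * V t) := by
    have h1 : W⁻¹ - (V t)⁻¹ = -(W⁻¹ * N t * matDeriv I V t * (V t)⁻¹) := by
      calc W⁻¹ - (V t)⁻¹ = W⁻¹ * (V t * (V t)⁻¹) - W⁻¹ * W * (V t)⁻¹ := by
            rw [inv_mul_of_isUnit hWu, mul_inv_of_isUnit (hu t ht)]; simp
        _ = _ := by rw [hW]; noncomm_ring
    rw [← Matrix.sub_mul, ← Matrix.sub_mul, h1]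
    noncomm_ring
  have hi := (hV t ht).inv (hu t ht)
  rw [h]
  have := ((((hWd.inv hWu).mul (hN t ht)).mul ((hV'.mul hi).mul (hN t ht))).mul (hV t ht)).smul (-1)
  simpa using this

end Strict

end DAE

namespace DAE

/-! ### Reduction of `{N, 1}` to a constant shift -/

section ShiftForm

variable {κ : Type*} [Fintype κ] {b : κ → ℕ} {c : ℝ} {I : Set ℝ} {N : ℝ → Matrix κ κ ℝ}

/-- The sum of the first `j` terms of `∑ (-c N d/dt)^i X`. -/
noncomputable def nilRes (c : ℝ) (I : Set ℝ) (N : ℝ → Matrix κ κ ℝ) :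
    ℕ → (ℝ → Matrix κ κ ℝ) → ℝ → Matrix κ κ ℝ
  | 0, _ => fun _ => 0
  | j + 1, X => fun t => X t + nilRes c I N j (fun s => (-c) • (N s * matDeriv I X s)) t

theorem smoothMat_nilRes (hI : UniqueDiffOn ℝ I) {p : ℕ∞} (j : ℕ) :
    ∀ {X : ℝ → Matrix κ κ ℝ}, SmoothMat ((p + j : ℕ∞) : WithTop ℕ∞) I N →
      SmoothMat ((p + j : ℕ∞) : WithTop ℕ∞) I X →
      SmoothMat (p : WithTop ℕ∞) I (nilRes c I N j X) := by
  induction j with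
  | zero => exact fun _ _ => smoothMat_const 0
  | succ j ih =>
    intro X hN hX
    rw [Nat.cast_succ, ← add_assoc] at hN hX
    have hN' := hN.of_le (q := p + j) le_self_add
    exact (hX.of_le (by rw [add_assoc]; exact le_self_add)).add
      (ih hN' ((hN'.mul (hX.deriv hI)).smul (-c)))

theorem upperDeg_nilRes (hN : ∀ t ∈ I, UpperDeg b 1 (N t)) {k : ℕ} (j : ℕ) :
    ∀ {X : ℝ → Matrix κ κ ℝ}, (∀ t ∈ I, UpperDeg b k (X t)) →
      ∀ t ∈ I, UpperDeg b k (nilRes c I N j X t) := by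
  induction j with
  | zero => exact fun _ _ _ _ _ _ => rfl
  | succ j ih =>
    intro X hX t ht
    refine (hX t ht).add (ih (fun s hs => ?_) t ht)
    exact (((hN s hs).mul (UpperDeg.matDeriv hX hs)).mono (by omega)).smul _

theorem upperDeg_nilRes_sub (hN : ∀ t ∈ I, UpperDeg b 1 (N t)) (j : ℕ)
    {X : ℝ → Matrix κ κ ℝ} (hX : ∀ t ∈ I, UpperDeg b 1 (X t)) {t : ℝ} (ht : t ∈ I) :
    UpperDeg b 2 (nilRes c I N (j + 1) X t - X t) := by
  have h : nilRes c I N (j + 1) X t - X t =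
      nilRes c I N j (fun s => (-c) • (N s * matDeriv I X s)) t := by
    simp [nilRes]
  rw [h]
  exact upperDeg_nilRes hN j
    (fun s hs => ((hN s hs).mul (UpperDeg.matDeriv hX hs)).smul _) t ht

/-- All factors act from the left and differentiation is entrywise, so columns do not mix. This
locality makes the iteration below stabilize column by column. -/
theorem nilRes_congr_col (j : ℕ) : ∀ {X Y : ℝ → Matrix κ κ ℝ} {z : κ},
    (∀ t ∈ I, ∀ x, X t x z = Y t x z) →
      ∀ t ∈ I, ∀ x, nilRes c I N j X t x z = nilRes c I N j Y t x z := by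
  induction j with
  | zero => exact fun _ _ _ _ => rfl
  | succ j ih =>
    intro X Y z h t ht x
    have h' : ∀ s ∈ I, ∀ y, ((-c) • (N s * matDeriv I X s)) y z =
        ((-c) • (N s * matDeriv I Y s)) y z := by
      intro s hs y
      have hd : ∀ w, matDeriv I X s w z = matDeriv I Y s w z := fun w =>
        derivWithin_congr (fun r hr => h r hr w) (h s hs w)
      simp only [Matrix.smul_apply, Matrix.mul_apply, hd]
    simp only [nilRes, Matrix.add_apply, h t ht x, ih h' t ht x]

/-- The geometric series telescopes. Each application of `N d/dt` annihilates the rows of one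
further grade, so the remainder after `j` terms is zero when `X` has no rows of grade at least `j`.
-/
theorem nilRes_eq (hI : UniqueDiffOn ℝ I) (hN : ∀ t ∈ I, UpperDeg b 1 (N t)) (j : ℕ) :
    ∀ {X : ℝ → Matrix κ κ ℝ}, SmoothMat ((1 + j : ℕ∞) : WithTop ℕ∞) I N →
      SmoothMat ((1 + j : ℕ∞) : WithTop ℕ∞) I X →
      (∀ t ∈ I, ∀ x y, j ≤ b x → X t x y = 0) → ∀ t ∈ I,
      nilRes c I N j X t + c • (N t * matDeriv I (nilRes c I N j X) t) = X t := by
  induction j with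
  | zero =>
    intro X _ _ h t ht
    have : X t = 0 := by ext x y; exact h t ht x y (Nat.zero_le _)
    rw [this]
    have hd : matDeriv I (nilRes c I N 0 X) t = 0 := matDeriv_const 0 t
    rw [hd]
    simp [nilRes]
  | succ j ih =>
    intro X hNs hXs h t ht
    rw [Nat.cast_succ, ← add_assoc] at hNs hXs
    have hNs' := hNs.of_le (q := 1 + j) le_self_add
    have hX2 := (hNs'.mul (hXs.deriv hI)).smul (-c)
    have h2 := ih hNs' hX2 (fun s hs x y hx => by
      rw [Matrix.smul_apply, Matrix.mul_apply, Finset.sum_eq_zero, smul_zero]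
      intro z _
      rcases lt_or_ge (b z) (b x + 1) with hz | hz
      · rw [hN s hs x z hz, zero_mul]
      · rw [matDeriv_entry_zero (fun r hr => h r hr z y (by omega)) hs, mul_zero]) t ht
    have hd : matDeriv I (nilRes c I N (j + 1) X) t = matDeriv I X t +
        matDeriv I (nilRes c I N j (fun s => (-c) • (N s * matDeriv I X s))) t :=
      matDeriv_add (hXs.of_le (by rw [add_assoc]; exact le_self_add))
        (smoothMat_nilRes hI j hNs' hX2) ht
    rw [hd]
    simp only [nilRes]
    rw [Matrix.mul_add, smul_add, add_add_add_comm, h2]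
    simp

/-! ### Intertwining `N` with a constant shift. -/

variable [DecidableEq κ] {μ : ℕ} {M : Matrix κ κ ℝ} {R : ℝ → Matrix κ κ ℝ}

/-- Iteration towards an intertwiner of `N = R M` and `M`. -/
noncomputable def shiftIter (c : ℝ) (I : Set ℝ) (N : ℝ → Matrix κ κ ℝ) (M : Matrix κ κ ℝ)
    (R : ℝ → Matrix κ κ ℝ) (μ : ℕ) : ℕ → ℝ → Matrix κ κ ℝ
  | 0 => fun _ => 1
  | i + 1 => fun t =>
      nilRes c I N (μ + 1) (fun s => N s * shiftIter c I N M R μ i s) t * Mᵀ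
        + R t * (1 - M * Mᵀ)

theorem shiftIter_succ (i : ℕ) (t : ℝ) : shiftIter c I N M R μ (i + 1) t =
    nilRes c I N (μ + 1) (fun s => N s * shiftIter c I N M R μ i s) t * Mᵀ
      + R t * (1 - M * Mᵀ) := rfl

theorem smoothMat_shiftIter (hI : UniqueDiffOn ℝ I) (i : ℕ) : ∀ {p : ℕ∞},
    SmoothMat ((p + ((μ + 1) * i : ℕ) : ℕ∞) : WithTop ℕ∞) I N →
    SmoothMat ((p + ((μ + 1) * i : ℕ) : ℕ∞) : WithTop ℕ∞) I R →
    SmoothMat (p : WithTop ℕ∞) I (shiftIter c I N M R μ i) := by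
  induction i with
  | zero => exact fun _ _ => smoothMat_const 1
  | succ i ih =>
    intro p hN hR
    have e : p + ((μ + 1) * (i + 1) : ℕ) = (p + (μ + 1 : ℕ)) + ((μ + 1) * i : ℕ) := by
      rw [add_assoc]; push_cast; ring
    rw [e] at hN hR
    have hN' := hN.of_le (q := p + (μ + 1 : ℕ)) le_self_add
    have hK := ih hN hR
    exact ((smoothMat_nilRes hI (μ + 1) hN' (hN'.mul hK)).mul (smoothMat_const _)).add
      (((hR.of_le le_self_add).of_le le_self_add).mul (smoothMat_const _))

/-- Modulo degree 1, `nilRes` contributes just its first term, and the next iterate is `R (M K Mᵀ +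
(1 - M Mᵀ))`, a product of two units. -/
theorem shiftIter_upper (hM : IsShift b M) (hNR : ∀ t ∈ I, N t = R t * M)
    (hR : ∀ t ∈ I, UpperDeg b 0 (R t)) (hu : ∀ t ∈ I, IsUnit (R t)) (i : ℕ) :
    ∀ t ∈ I, UpperDeg b 0 (shiftIter c I N M R μ i t) ∧ IsUnit (shiftIter c I N M R μ i t) := by
  have hN : ∀ t ∈ I, UpperDeg b 1 (N t) := fun t ht => by
    rw [hNR t ht]; exact (hR t ht).mul_left hM.upperDeg
  induction i with
  | zero => exact fun t _ => ⟨UpperDeg.one, isUnit_one⟩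
  | succ i ih =>
    intro t ht
    have hNK : ∀ t ∈ I, UpperDeg b 1 (N t * shiftIter c I N M R μ i t) := fun t ht => by
      simpa using (hN t ht).mul (ih t ht).1
    have hd := (hM.mul_transpose (k := 1) (upperDeg_nilRes_sub (c := c) hN μ hNK ht))
    set W := M * shiftIter c I N M R μ i t * Mᵀ + (1 - M * Mᵀ) with hW
    have hWd : UpperDeg b 0 W := hM.conj_upperDeg (ih t ht).1
    have hWu : IsUnit W := hM.isUnit_conj (ih t ht).1 (ih t ht).2
    have e : shiftIter c I N M R μ (i + 1) t = R t * W +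
        (nilRes c I N (μ + 1) (fun s => N s * shiftIter c I N M R μ i s) t
          - N t * shiftIter c I N M R μ i t) * Mᵀ := by
      have hNt := hNR t ht
      rw [hW, shiftIter_succ, Matrix.sub_mul _ (N t * _)]
      rw [hNt]
      noncomm_ring
    have hRW := (hR t ht).mul_left hWd
    rw [e]
    exact ⟨hRW.add (hd.mono (by omega)), hRW.isUnit_add ((hu t ht).mul hWu) hd⟩

/-- Right multiplication by `Mᵀ` makes a column of grade `g` depend only on columns of grade `g + 1`
of the previous iterate. The columns of highest grade settle first, and each iteration settles one
more grade. -/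
theorem shiftIter_stable (hM : IsShift b M) (i : ℕ) :
    ∀ y, μ + 1 ≤ b y + i → (∀ x, b x ≤ μ) → ∀ t ∈ I, ∀ x,
      shiftIter c I N M R μ (i + 1) t x y = shiftIter c I N M R μ i t x y := by
  induction i with
  | zero => exact fun y hy hb => absurd (hb y) (by omega)
  | succ i ih =>
    intro y hy hb t ht x
    rw [shiftIter_succ (i + 1), shiftIter_succ i, Matrix.add_apply, Matrix.add_apply,
      Matrix.mul_apply, Matrix.mul_apply]
    congr 1
    refine Finset.sum_congr rfl fun z _ => ?_
    by_cases hz : b z = b y + 1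
    · rw [nilRes_congr_col (μ + 1) (fun s hs w => ?_) t ht x]
      simp only [Matrix.mul_apply]
      exact Finset.sum_congr rfl fun v _ => by rw [ih z (by omega) hb s hs v]
    · simp only [Matrix.transpose_apply, hM.entry y z hz, mul_zero]

/-- With `Y = K M` the equation reads `Y + c N Y' = N K`, solved by `Y = nilRes (N K)`. This
prescribes `K` on the range of `M`; on the complement it is set equal to `R`, which keeps `K`
nonsingular. The fixed-point equation holds exactly after `μ + 1` iterations. The sign `c` is `1`
for a left factor `R` and `-1` for the transposed problem. -/
theorem exists_intertwiner (hI : UniqueDiffOn ℝ I) (c : ℝ) {p : ℕ∞} (hp : 1 ≤ p)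
    (hb : ∀ x, b x ≤ μ) (hM : IsShift b M)
    (hNR : ∀ t ∈ I, N t = R t * M) (hR : ∀ t ∈ I, UpperDeg b 0 (R t))
    (hu : ∀ t ∈ I, IsUnit (R t))
    (hNs : SmoothMat ((p + ((μ + 1) * (μ + 2) : ℕ) : ℕ∞) : WithTop ℕ∞) I N)
    (hRs : SmoothMat ((p + ((μ + 1) * (μ + 2) : ℕ) : ℕ∞) : WithTop ℕ∞) I R) :
    ∃ K : ℝ → Matrix κ κ ℝ, SmoothMat (p : WithTop ℕ∞) I K ∧ (∀ t ∈ I, UpperDeg b 0 (K t)) ∧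
      (∀ t ∈ I, IsUnit (K t)) ∧
      ∀ t ∈ I, K t * M + c • (N t * matDeriv I K t * M) = N t * K t := by
  have hN : ∀ t ∈ I, UpperDeg b 1 (N t) := fun t ht => by
    rw [hNR t ht]; exact (hR t ht).mul_left hM.upperDeg
  -- The iterations consume `(μ + 1)²` derivatives; the remaining `μ + 1` are kept for applying
  -- `nilRes_eq` to `N K`.
  have e : p + ((μ + 1) * (μ + 2) : ℕ) = (p + (μ + 1 : ℕ)) + ((μ + 1) * (μ + 1) : ℕ) := by
    rw [add_assoc]; push_cast; ring
  rw [e] at hNs hRs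
  have hKs := smoothMat_shiftIter (c := c) (M := M) hI (μ + 1) hNs hRs
  have hup := shiftIter_upper (c := c) (μ := μ) hM hNR hR hu (μ + 1)
  have hst : ∀ t ∈ I, shiftIter c I N M R μ (μ + 1) t = shiftIter c I N M R μ (μ + 2) t :=
    fun t ht => by
      ext x y
      exact (shiftIter_stable hM (μ + 1) y (by omega) hb t ht x).symm
  set K := shiftIter c I N M R μ (μ + 1) with hK
  have hKs1 : SmoothMat (p : WithTop ℕ∞) I K := hKs.of_le le_self_add
  refine ⟨K, hKs1, fun t ht => (hup t ht).1, fun t ht => (hup t ht).2, fun t ht => ?_⟩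
  have hNK : ∀ t ∈ I, UpperDeg b 1 (N t * K t) := fun t ht => by
    simpa using (hN t ht).mul (hup t ht).1
  have hle : (1 + (μ + 1 : ℕ) : ℕ∞) ≤ p + (μ + 1 : ℕ) := by gcongr
  have hNs' := (hNs.of_le (q := p + (μ + 1 : ℕ)) le_self_add)
  have hY : ∀ t ∈ I, K t * M = nilRes c I N (μ + 1) (fun s => N s * K s) t := fun t ht => by
    rw [hst t ht, shiftIter_succ, Matrix.add_mul, Matrix.mul_assoc _ Mᵀ M,
      hM.mul_gram (upperDeg_nilRes hN _ hNK t ht), Matrix.mul_assoc, Matrix.sub_mul,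
      hM.mul_gram_self]
    simp
  have hd : matDeriv I K t * M = matDeriv I (nilRes c I N (μ + 1) (fun s => N s * K s)) t := by
    rw [← matDeriv_mul_const M (hKs1.of_le hp) ht]
    exact matDeriv_congr hY ht
  rw [Matrix.mul_assoc, hd, hY t ht]
  -- No index has grade above `μ`, so the condition on vanishing rows is empty for `μ + 1` terms.
  exact nilRes_eq hI hN (μ + 1) (hNs'.of_le hle) ((hNs'.mul hKs).of_le hle)
    (fun s _ x _ hx => absurd (hb x) (by omega)) t ht

/-- If `N = R M` with `R` block upper triangular and nonsingular, then `{N, 1} ∼ {M, 1}`. -/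
theorem exists_transforms_shift_left (hI : UniqueDiffOn ℝ I) {m : ℕ∞}
    (hb : ∀ x, b x ≤ μ) (hM : IsShift b M)
    (hNR : ∀ t ∈ I, N t = R t * M) (hR : ∀ t ∈ I, UpperDeg b 0 (R t))
    (hu : ∀ t ∈ I, IsUnit (R t))
    (hNs : SmoothMat ((m + 1 + ((μ + 1) * (μ + 2) : ℕ) : ℕ∞) : WithTop ℕ∞) I N)
    (hRs : SmoothMat ((m + 1 + ((μ + 1) * (μ + 2) : ℕ) : ℕ∞) : WithTop ℕ∞) I R) :
    ∃ L K, Transforms m I L K N (fun _ => 1) (fun _ => M) fun _ => 1 := by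
  have hN : ∀ t ∈ I, UpperDeg b 1 (N t) := fun t ht => by
    rw [hNR t ht]; exact (hR t ht).mul_left hM.upperDeg
  obtain ⟨K, hKs, hKd, hKu, hK⟩ := exists_intertwiner hI 1 le_add_self hb hM hNR hR hu hNs hRs
  refine ⟨_, _, (transforms_strict hI hN hKd hKu
    (hNs.of_le (by rw [add_assoc]; exact le_self_add)) hKs).congr (fun t ht => ?_)
      fun _ _ => rfl⟩
  -- For `c = 1` the relation is `(K + N K') M = N K`, exactly what turns `(K + N K')⁻¹ N K` into
  -- `M`.
  have h := hK t ht
  rw [one_smul, ← Matrix.add_mul] at h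
  rw [Matrix.mul_assoc, ← h, ← Matrix.mul_assoc,
    inv_mul_of_isUnit (isUnit_add_mul_deriv hN hKd hKu ht), Matrix.one_mul]

/-- If `N = M R` with `R` block upper triangular and nonsingular, then `{N, 1} ∼ {M, 1}`. -/
theorem exists_transforms_shift_right (hI : UniqueDiffOn ℝ I) {m : ℕ∞}
    (hb : ∀ x, b x ≤ μ) (hM₁ : UpperDeg b 1 M) (hM : IsShift (fun x => μ - b x) Mᵀ)
    (hNR : ∀ t ∈ I, N t = M * R t) (hR : ∀ t ∈ I, UpperDeg b 0 (R t))
    (hu : ∀ t ∈ I, IsUnit (R t))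
    (hNs : SmoothMat ((m + 1 + ((μ + 1) * (μ + 2) : ℕ) : ℕ∞) : WithTop ℕ∞) I N)
    (hRs : SmoothMat ((m + 1 + ((μ + 1) * (μ + 2) : ℕ) : ℕ∞) : WithTop ℕ∞) I R) :
    ∃ L K, Transforms m I L K N (fun _ => 1) (fun _ => M) fun _ => 1 := by
  have hN : ∀ t ∈ I, UpperDeg b 1 (N t) := fun t ht => by
    rw [hNR t ht]; simpa using hM₁.mul (hR t ht)
  -- For the transposed data the shift is `Mᵀ` with the reversed grade. The right factor will be the
  -- inverse of `J = J'ᵀ`; since `J (J⁻¹)' = -J' J⁻¹`, with the derivative of `J` on the right, the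
  -- sign must be `-1`.
  obtain ⟨J', hJs', hJd', hJu', hJ'⟩ := exists_intertwiner (p := m + 1) (N := fun t => (N t)ᵀ)
    (R := fun t => (R t)ᵀ) hI (-1) le_add_self
    (fun x => Nat.sub_le μ (b x)) hM (fun t ht => by rw [hNR t ht, Matrix.transpose_mul])
    (fun t ht => (hR t ht).transpose hb) (fun t ht => (Matrix.isUnit_transpose _).2 (hu t ht))
    hNs.transpose hRs.transpose
  set J : ℝ → Matrix κ κ ℝ := fun t => (J' t)ᵀ with hJdef
  have hJs : SmoothMat ((m + 1 : ℕ∞) : WithTop ℕ∞) I J := hJs'.transpose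
  have hJu : ∀ t ∈ I, IsUnit (J t) := fun t ht => (Matrix.isUnit_transpose _).2 (hJu' t ht)
  have hJd : ∀ t ∈ I, UpperDeg b 0 (J t)⁻¹ := fun t ht =>
    (UpperDeg.of_transpose hb (hJd' t ht)).inv (hJu t ht)
  have hJi : ∀ t ∈ I, IsUnit (J t)⁻¹ := fun t ht => isUnit_inv (hJu t ht)
  refine ⟨_, _, (transforms_strict hI hN hJd hJi
    (hNs.of_le (by rw [add_assoc]; exact le_self_add)) (hJs.inv hJu)).congr (fun t ht => ?_)
      fun _ _ => rfl⟩
  have h : J t * N t + M * matDeriv I J t * N t = M * J t := by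
    have := congrArg Matrix.transpose (hJ' t ht)
    rw [neg_smul, one_smul] at this
    simp only [Matrix.transpose_add, Matrix.transpose_mul, Matrix.transpose_neg,
      Matrix.transpose_transpose, ← matDeriv_transpose] at this
    simp only [hJdef]
    rw [← this]
    noncomm_ring
  have hd : matDeriv I J t * (J t)⁻¹ + J t * matDeriv I (fun s => (J s)⁻¹) t = 0 := by
    rw [← matDeriv_mul hJs.one_of_succ (hJs.inv hJu).one_of_succ ht,
      matDeriv_congr (B := fun _ => 1) (fun s hs => mul_inv_of_isUnit (hJu s hs)) ht,
      matDeriv_const]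
  have hJJ := mul_inv_of_isUnit (hJu t ht)
  -- The left factor is explicit: `J + M J'` inverts `J⁻¹ + N (J⁻¹)'`, because `h` turns `(J + M J')
  -- N` into `M J`.
  have hL : (J t + M * matDeriv I J t) *
      ((J t)⁻¹ + N t * matDeriv I (fun s => (J s)⁻¹) t) = 1 := by
    calc _ = J t * (J t)⁻¹ + M * matDeriv I J t * (J t)⁻¹
          + (J t * N t + M * matDeriv I J t * N t) * matDeriv I (fun s => (J s)⁻¹) t := by
          noncomm_ring
      _ = J t * (J t)⁻¹
          + M * (matDeriv I J t * (J t)⁻¹ + J t * matDeriv I (fun s => (J s)⁻¹) t) := by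
          rw [h]; noncomm_ring
      _ = 1 := by rw [hd, hJJ]; simp
  rw [Matrix.inv_eq_left_inv hL, Matrix.add_mul, h, Matrix.mul_assoc, hJJ, Matrix.mul_one]

end ShiftForm

end DAE

namespace DAE

/-! ### Completion of a smooth frame on an interval -/

section Completion

variable {n r : ℕ} {p : ℕ∞} {I : Set ℝ}

/-- The vector of cofactors completes a basis of a hyperplane. -/
theorem notMem_span_cofactors {v : Fin r → Fin (r + 1) → ℝ} (hv : LinearIndependent ℝ v) :
    (fun j => (Matrix.of (Fin.snoc v (Pi.single j 1) : Fin (r + 1) → Fin (r + 1) → ℝ)).det) ∉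
      Submodule.span ℝ (Set.range v) := by
  set w : Fin (r + 1) → ℝ := fun j =>
    (Matrix.of (Fin.snoc v (Pi.single j 1) : Fin (r + 1) → Fin (r + 1) → ℝ)).det with hw
  intro hmem
  have hdet : ∀ x ∈ Submodule.span ℝ (Set.range v),
      (Matrix.of (Fin.snoc v x : Fin (r + 1) → Fin (r + 1) → ℝ)).det = 0 := by
    intro x hx
    by_contra h
    have hu : IsUnit (Matrix.of (Fin.snoc v x : Fin (r + 1) → Fin (r + 1) → ℝ)) :=
      (Matrix.isUnit_iff_isUnit_det _).2 (Ne.isUnit h)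
    have hli : LinearIndependent ℝ (Fin.snoc v x : Fin (r + 1) → Fin (r + 1) → ℝ) :=
      Matrix.linearIndependent_rows_iff_isUnit.2 hu
    exact (linearIndependent_finSnoc.1 hli).2 hx
  -- The determinant is linear in its last row, so it is the scalar product with the cofactor vector
  -- `w`.
  have hlin : ∀ x : Fin (r + 1) → ℝ,
      (Matrix.of (Fin.snoc v x : Fin (r + 1) → Fin (r + 1) → ℝ)).det = ∑ j, x j * w j := by
    intro x
    have h1 : ∀ y : Fin (r + 1) → ℝ,
        (Matrix.of (Fin.snoc v y : Fin (r + 1) → Fin (r + 1) → ℝ)).det =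
        (Matrix.detRowAlternating (R := ℝ) (n := Fin (r + 1))).toMultilinearMap.toLinearMap
          (Fin.snoc v 0) (Fin.last r) y := by
      intro y
      rw [MultilinearMap.toLinearMap_apply, Fin.update_snoc_last]
      rfl
    rw [h1, LinearMap.pi_apply_eq_sum_univ]
    refine Finset.sum_congr rfl fun j _ => ?_
    rw [smul_eq_mul, ← h1]
    simp only [hw]
    congr 4
    ext i
    simp [Pi.single_apply, eq_comm]
  -- If `w` lay in the span it would be orthogonal to itself, hence zero; then every unit vector
  -- would lie in a span of dimension `r`.
  have hzero : ∑ j, w j * w j = 0 := by rw [← hlin, hdet w hmem]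
  have hw0 : ∀ j, w j = 0 := fun j => by
    have := (Finset.sum_eq_zero_iff_of_nonneg fun j _ => mul_self_nonneg (w j)).1 hzero j
      (Finset.mem_univ j)
    exact mul_self_eq_zero.1 this
  have htop : Submodule.span ℝ (Set.range v) = ⊤ := by
    rw [eq_top_iff, ← (Pi.basisFun ℝ (Fin (r + 1))).span_eq, Submodule.span_le]
    rintro _ ⟨j, rfl⟩
    by_contra h
    have hli := linearIndependent_finSnoc.2 ⟨hv, h⟩
    rw [Pi.basisFun_apply] at hli
    have hu : IsUnit (Matrix.of
        (Fin.snoc v (Pi.single j 1) : Fin (r + 1) → Fin (r + 1) → ℝ)) :=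
      Matrix.linearIndependent_rows_iff_isUnit.1 hli
    exact ((Matrix.isUnit_iff_isUnit_det _).1 hu).ne_zero (hw0 j)
  have h1 := finrank_span_eq_card hv
  rw [htop, finrank_top] at h1
  simp at h1

/-- The moving span sweeps out the `C¹` image of a set of dimension `r + 1`. For `r + 1 < n` its
complement is dense, and a constant vector outside it works at all times. For `r + 1 = n` this count
fails and the cofactor vector is used instead. -/
theorem exists_snoc_linearIndependent (hI : I.OrdConnected) (hp : 1 ≤ p) (hr : r < n)
    {v : ℝ → Fin r → Fin n → ℝ} (hv : ∀ i j, ContDiffOn ℝ p (fun t => v t i j) I)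
    (hli : ∀ t ∈ I, LinearIndependent ℝ (v t)) :
    ∃ w : ℝ → Fin n → ℝ, (∀ j, ContDiffOn ℝ p (fun t => w t j) I) ∧
      ∀ t ∈ I, LinearIndependent ℝ (Fin.snoc (v t) (w t) : Fin (r + 1) → Fin n → ℝ) := by
  rcases Nat.lt_or_ge (r + 1) n with h | h
  · let f : ℝ × (Fin r → ℝ) → Fin n → ℝ := fun x => ∑ i, x.2 i • v x.1 i
    have hf : ContDiffOn ℝ 1 f (I ×ˢ Set.univ) := by
      rw [contDiffOn_pi]
      intro j
      simp only [f, Finset.sum_apply, Pi.smul_apply, smul_eq_mul]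
      refine ContDiffOn.sum fun i _ => ?_
      have h1 : ContDiffOn ℝ 1 (fun x : ℝ × (Fin r → ℝ) => x.2 i) (I ×ˢ Set.univ) := by
        fun_prop
      refine h1.mul (((hv i j).of_le (by exact_mod_cast hp)).comp contDiffOn_fst ?_)
      exact fun x hx => hx.1
    have hd := hf.dense_compl_image_of_dimH_lt_finrank (hI.convex.prod convex_univ)
      subset_rfl (by
        refine (dimH_mono (Set.subset_univ _)).trans_lt ?_
        rw [Real.dimH_univ_eq_finrank]
        simp only [Module.finrank_prod, Module.finrank_self, Module.finrank_fin_fun]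
        exact_mod_cast (by omega : 1 + r < n))
    obtain ⟨w, hw⟩ := hd.nonempty
    refine ⟨fun _ => w, fun j => contDiffOn_const, fun t ht =>
      linearIndependent_finSnoc.2 ⟨hli t ht, fun hmem => hw ?_⟩⟩
    obtain ⟨c, hc⟩ := (Submodule.mem_span_range_iff_exists_fun ℝ).1 hmem
    exact ⟨(t, c), ⟨ht, Set.mem_univ _⟩, hc⟩
  · obtain rfl : n = r + 1 := by omega
    refine ⟨fun t j => (Matrix.of
        (Fin.snoc (v t) (Pi.single j 1) : Fin (r + 1) → Fin (r + 1) → ℝ)).det, fun j => ?_,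
      fun t ht => linearIndependent_finSnoc.2 ⟨hli t ht, notMem_span_cofactors (hli t ht)⟩⟩
    refine SmoothMat.contDiffOn_det fun i k => ?_
    refine Fin.lastCases ?_ (fun i => ?_) i
    · simpa using contDiffOn_const
    · simpa using hv i k

theorem exists_frame (hI : I.OrdConnected) (hp : 1 ≤ p) (s : ℕ) : ∀ {r : ℕ} (_ : r + s = n)
    {v : ℝ → Fin r → Fin n → ℝ} (_ : ∀ i j, ContDiffOn ℝ p (fun t => v t i j) I)
    (_ : ∀ t ∈ I, LinearIndependent ℝ (v t)),
    ∃ u : ℝ → Fin n → Fin n → ℝ, (∀ i j, ContDiffOn ℝ p (fun t => u t i j) I) ∧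
      (∀ t ∈ I, LinearIndependent ℝ (u t)) ∧
      ∀ t (i : Fin r) (i' : Fin n), i'.val = i.val → u t i' = v t i := by
  induction s with
  | zero =>
    intro r hr v hv hli
    obtain rfl : r = n := hr
    exact ⟨v, hv, hli, fun t i i' h => by rw [Fin.ext h]⟩
  | succ s ih =>
    intro r hr v hv hli
    obtain ⟨w, hw, hwli⟩ := exists_snoc_linearIndependent hI hp (by omega) hv hli
    obtain ⟨u, hu, huli, huv⟩ := ih (r := r + 1) (by omega)
      (v := fun t => (Fin.snoc (v t) (w t) : Fin (r + 1) → Fin n → ℝ))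
      (fun i j => by
        refine Fin.lastCases ?_ (fun i => ?_) i
        · simpa using hw j
        · simpa using hv i j) hwli
    refine ⟨u, hu, huli, fun t i i' h => ?_⟩
    rw [huv t i.castSucc i' h]
    exact Fin.snoc_castSucc (α := fun _ => Fin n → ℝ) _ _ _

/-- A smooth matrix function of full row rank on an interval extends to a smooth nonsingular
matrix function. -/
theorem exists_row_completion (hI : I.OrdConnected) (hp : 1 ≤ p)
    {A : ℝ → Matrix (Fin r) (Fin n) ℝ} (hA : SmoothMat (p : WithTop ℕ∞) I A)
    (hrk : ∀ t ∈ I, (A t).rank = r) (hr : r ≤ n) :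
    ∃ W : ℝ → Matrix (Fin n) (Fin n) ℝ, SmoothMat (p : WithTop ℕ∞) I W ∧
      (∀ t ∈ I, IsUnit (W t)) ∧
      ∀ t (i : Fin r) (i' : Fin n), i'.val = i.val → ∀ j, W t i' j = A t i j := by
  obtain ⟨u, hu, huli, huv⟩ := exists_frame hI hp (n - r) (by omega : r + (n - r) = n)
    (v := fun t => (A t).row) hA (fun t ht => by
      rw [linearIndependent_iff_card_eq_finrank_span, Fintype.card_fin]
      exact (hrk t ht).symm.trans (A t).rank_eq_finrank_span_row)
  exact ⟨fun t => Matrix.of (u t), hu,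
    fun t ht => Matrix.linearIndependent_rows_iff_isUnit.1 (huli t ht),
    fun t i i' h j => congrFun (huv t i i' h) j⟩

/-- A smooth matrix function of full column rank on an interval extends to a smooth nonsingular
matrix function. -/
theorem exists_column_completion (hI : I.OrdConnected) (hp : 1 ≤ p)
    {A : ℝ → Matrix (Fin n) (Fin r) ℝ} (hA : SmoothMat (p : WithTop ℕ∞) I A)
    (hrk : ∀ t ∈ I, (A t).rank = r) (hr : r ≤ n) :
    ∃ V : ℝ → Matrix (Fin n) (Fin n) ℝ, SmoothMat (p : WithTop ℕ∞) I V ∧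
      (∀ t ∈ I, IsUnit (V t)) ∧
      ∀ t (i : Fin r) (i' : Fin n), i'.val = i.val → ∀ j, V t j i' = A t j i := by
  obtain ⟨W, hW, hWu, hWA⟩ := exists_row_completion hI hp hA.transpose
    (fun t ht => by rw [Matrix.rank_transpose, hrk t ht]) hr
  exact ⟨fun t => (W t)ᵀ, hW.transpose, fun t ht => (Matrix.isUnit_transpose _).2 (hWu t ht),
    fun t i i' h j => hWA t i i' h j⟩

end Completion

end DAE

namespace DAE

/-! ### Block index and the elementary nilpotent matrix -/

section Sigma

variable {μ : ℕ} {ℓ : Fin μ → ℕ}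

/-- The number of the block of a coordinate. -/
def blockNo (x : BlockIdx ℓ) : ℕ := x.1.val

theorem blockNo_le (x : BlockIdx ℓ) : blockNo x ≤ μ - 1 := by
  have := x.1.isLt
  unfold blockNo
  omega

theorem isBUT_iff {M : Matrix (BlockIdx ℓ) (BlockIdx ℓ) ℝ} : IsBUT M ↔ UpperDeg blockNo 0 M := by
  constructor
  · rintro h ⟨i, p⟩ ⟨j, q⟩ hij
    exact congrFun (congrFun (h i j hij) p) q
  · intro h i j hij
    ext p q
    exact h ⟨i, p⟩ ⟨j, q⟩ hij

theorem isSUT_iff {M : Matrix (BlockIdx ℓ) (BlockIdx ℓ) ℝ} : IsSUT M ↔ UpperDeg blockNo 1 M := by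
  constructor
  · rintro h ⟨i, p⟩ ⟨j, q⟩ hij
    exact congrFun (congrFun (h i j (Fin.le_def.2 (Nat.lt_succ_iff.1 hij))) p) q
  · intro h i j hij
    ext p q
    exact h ⟨i, p⟩ ⟨j, q⟩ (Nat.lt_succ_iff.2 (Fin.le_def.1 hij))

theorem upperDeg_two_sub {X Y : Matrix (BlockIdx ℓ) (BlockIdx ℓ) ℝ} (hX : UpperDeg blockNo 1 X)
    (hY : UpperDeg blockNo 1 Y)
    (h : ∀ i j : Fin μ, i.val + 1 = j.val → block X i j = block Y i j) :
    UpperDeg blockNo 2 (X - Y) := by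
  rintro ⟨i, p⟩ ⟨j, q⟩ hij
  rw [Matrix.sub_apply, sub_eq_zero]
  by_cases hs : i.val + 1 = j.val
  · exact congrFun (congrFun (h i j hs) p) q
  · have : blockNo (⟨j, q⟩ : BlockIdx ℓ) < blockNo (⟨i, p⟩ : BlockIdx ℓ) + 1 := by
      simp only [blockNo] at hij ⊢
      omega
    rw [hX _ _ this, hY _ _ this]

theorem block_eq_of_upperDeg_two {X Y : Matrix (BlockIdx ℓ) (BlockIdx ℓ) ℝ}
    (h : UpperDeg blockNo 2 (X - Y)) {i j : Fin μ} (hij : i.val + 1 = j.val) :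
    block X i j = block Y i j := by
  ext p q
  have := h ⟨i, p⟩ ⟨j, q⟩ (by simp only [blockNo]; omega)
  rwa [Matrix.sub_apply, sub_eq_zero] at this

/-- The rectangular matrix with ones on its main diagonal. -/
def rectOne (k l : ℕ) : Matrix (Fin k) (Fin l) ℝ :=
  Matrix.of fun p q => if p.val = q.val then 1 else 0

theorem rectOne_transpose (k l : ℕ) : (rectOne k l)ᵀ = rectOne l k := by
  ext p q
  simp [rectOne, eq_comm]

theorem rectOne_mul_apply {k l : ℕ} {ι : Type*} (R : Matrix (Fin l) ι ℝ) (p : Fin k) (q : ι) :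
    (rectOne k l * R) p q = if h : p.val < l then R ⟨p.val, h⟩ q else 0 := by
  rw [Matrix.mul_apply]
  split_ifs with h
  · rw [Finset.sum_eq_single ⟨p.val, h⟩]
    · simp [rectOne]
    · intro r _ hr
      have : p.val ≠ r.val := fun e => hr (Fin.ext e.symm)
      simp [rectOne, this]
    · simp
  · refine Finset.sum_eq_zero fun r _ => ?_
    have : p.val ≠ r.val := fun e => h (e ▸ r.isLt)
    simp [rectOne, this]

theorem mul_rectOne_apply {k l : ℕ} {ι : Type*} (R : Matrix ι (Fin k) ℝ) (p : ι) (q : Fin l) :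
    (R * rectOne k l) p q = if h : q.val < k then R p ⟨q.val, h⟩ else 0 := by
  rw [← Matrix.transpose_apply (R * rectOne k l), Matrix.transpose_mul, rectOne_transpose,
    rectOne_mul_apply]
  rfl

theorem rectOne_gram {k l : ℕ} (h : l ≤ k) : (rectOne k l)ᵀ * rectOne k l = 1 := by
  ext p q
  rw [rectOne_transpose, rectOne_mul_apply, dif_pos (p.isLt.trans_le h)]
  simp [rectOne, Matrix.one_apply, Fin.ext_iff]

theorem rank_rectOne {k l : ℕ} (h : l ≤ k) : (rectOne k l).rank = l := by
  rw [← Matrix.rank_transpose_mul_self, rectOne_gram h, Matrix.rank_one, Fintype.card_fin]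

theorem rank_rectOne_mul {k l : ℕ} (h : l ≤ k) {R : Matrix (Fin l) (Fin l) ℝ} (hR : IsUnit R) :
    (rectOne k l * R).rank = l := by
  rw [Matrix.rank_mul_eq_left_of_isUnit_det _ _ ((Matrix.isUnit_iff_isUnit_det _).1 hR),
    rank_rectOne h]

theorem rank_mul_rectOne {k l : ℕ} (h : k ≤ l) {R : Matrix (Fin k) (Fin k) ℝ} (hR : IsUnit R) :
    (R * rectOne k l).rank = k := by
  rw [Matrix.rank_mul_eq_right_of_isUnit_det _ _ ((Matrix.isUnit_iff_isUnit_det _).1 hR),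
    ← Matrix.rank_transpose, rectOne_transpose, rank_rectOne h]

theorem block_blockDiagonal'_mul (V : ∀ i, Matrix (Fin (ℓ i)) (Fin (ℓ i)) ℝ)
    (X : Matrix (BlockIdx ℓ) (BlockIdx ℓ) ℝ) (i j : Fin μ) :
    block (blockDiagonal' V * X) i j = V i * block X i j := by
  ext p q
  simp only [block, Matrix.of_apply, Matrix.mul_apply]
  rw [Fintype.sum_sigma, Finset.sum_eq_single i]
  · simp
  · intro k _ hk
    exact Finset.sum_eq_zero fun r _ => by rw [blockDiagonal'_apply_ne _ _ _ hk.symm, zero_mul]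
  · simp

theorem block_mul_blockDiagonal' (V : ∀ i, Matrix (Fin (ℓ i)) (Fin (ℓ i)) ℝ)
    (X : Matrix (BlockIdx ℓ) (BlockIdx ℓ) ℝ) (i j : Fin μ) :
    block (X * blockDiagonal' V) i j = block X i j * V j := by
  ext p q
  simp only [block, Matrix.of_apply, Matrix.mul_apply]
  rw [Fintype.sum_sigma, Finset.sum_eq_single j]
  · simp
  · intro k _ hk
    exact Finset.sum_eq_zero fun r _ => by rw [blockDiagonal'_apply_ne _ _ _ hk, mul_zero]
  · simp

theorem block_elemN {i j : Fin μ} (hij : i.val + 1 = j.val) :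
    block (elemN ℓ) i j = rectOne (ℓ i) (ℓ j) := by
  ext p q
  simp [block, elemN, rectOne, hij]

theorem elemN_upperDeg : UpperDeg blockNo 1 (elemN ℓ) := by
  intro x y h
  have : ¬ (x.1.val + 1 = y.1.val) := by simp only [blockNo] at h; omega
  simp [elemN, this]

theorem blockDiagonal'_upperDeg (V : ∀ i, Matrix (Fin (ℓ i)) (Fin (ℓ i)) ℝ) :
    UpperDeg blockNo 0 (blockDiagonal' V) := by
  rintro ⟨i, p⟩ ⟨j, q⟩ h
  refine blockDiagonal'_apply_ne _ _ _ fun e => ?_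
  subst e
  simp [blockNo] at h

theorem isUnit_blockDiagonal' {V : ∀ i, Matrix (Fin (ℓ i)) (Fin (ℓ i)) ℝ}
    (h : ∀ i, IsUnit (V i)) : IsUnit (blockDiagonal' V) := by
  refine .of_mul_eq_one (blockDiagonal' fun i => (V i)⁻¹) ?_
  rw [← blockDiagonal'_mul]
  simp only [mul_inv_of_isUnit (h _)]
  exact blockDiagonal'_one

theorem smoothMat_blockDiagonal' {n : WithTop ℕ∞} {I : Set ℝ}
    {V : ∀ i, ℝ → Matrix (Fin (ℓ i)) (Fin (ℓ i)) ℝ} (h : ∀ i, SmoothMat n I (V i)) :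
    SmoothMat n I fun t => blockDiagonal' fun i => V i t := by
  rintro ⟨i, p⟩ ⟨j, q⟩
  by_cases hij : i = j
  · subst hij
    simpa using h i p q
  · simpa [blockDiagonal'_apply_ne _ _ _ hij] using contDiffOn_const

/-- Decreasing sizes guarantee that each column of a block `(i, i+1)` contains its one, so the
columns of positive grade are distinct unit vectors. -/
theorem isShift_elemN (hℓ : Antitone ℓ) : IsShift blockNo (elemN ℓ) where
  entry x y h := by
    have : ¬ (x.1.val + 1 = y.1.val) := fun e => h e.symm
    simp [elemN, this]
  gram := by
    ext x y
    rw [Matrix.mul_apply]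
    by_cases h0 : blockNo x = 0
    · rw [Finset.sum_eq_zero fun z _ => ?_, Matrix.diagonal_apply]
      · simp [h0]
      · have : ¬ (z.1.val + 1 = x.1.val) := by simp only [blockNo] at h0; omega
        simp [elemN, this]
    · have hx : x.1.val ≠ 0 := h0
      let k : Fin μ := ⟨x.1.val - 1, by omega⟩
      have hk : k.val + 1 = x.1.val := by simp only [k]; omega
      have hle : ℓ x.1 ≤ ℓ k := hℓ (Fin.le_def.2 (by omega))
      -- Column `x` has its only nonzero entry at the same position within the preceding block.
      rw [Finset.sum_eq_single ⟨k, ⟨x.2.val, x.2.isLt.trans_le hle⟩⟩]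
      · by_cases hxy : x = y
        · subst hxy
          simp [elemN, hk, h0]
        · rw [Matrix.diagonal_apply_ne _ hxy]
          have : ¬ (x.1.val = y.1.val ∧ x.2.val = y.2.val) := by
            rintro ⟨h1, h2⟩
            apply hxy
            obtain ⟨i, p⟩ := x
            obtain ⟨j, q⟩ := y
            obtain rfl : i = j := Fin.ext h1
            obtain rfl : p = q := Fin.ext h2
            rfl
          simp only [elemN, Matrix.transpose_apply, Matrix.of_apply, hk]
          simp [this]
      · rintro ⟨l, r⟩ _ hz
        have : ¬ (l.val + 1 = x.1.val ∧ r.val = x.2.val) := by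
          rintro ⟨h1, h2⟩
          apply hz
          obtain rfl : l = k := Fin.ext (by omega)
          congr
          exact Fin.ext h2
        simp [elemN, this]
      · simp

theorem isShift_elemN_transpose (hℓ : Monotone ℓ) :
    IsShift (fun x => μ - 1 - blockNo x) (elemN ℓ)ᵀ where
  entry x y h := by
    have : ¬ (y.1.val + 1 = x.1.val) := by
      have := x.1.isLt
      simp only [blockNo] at h
      omega
    simp [elemN, this]
  gram := by
    ext x y
    rw [Matrix.transpose_transpose, Matrix.mul_apply]
    by_cases h0 : μ - 1 - blockNo x = 0
    · rw [Finset.sum_eq_zero fun z _ => ?_, Matrix.diagonal_apply]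
      · simp [h0]
      · have : ¬ (x.1.val + 1 = z.1.val) := by simp only [blockNo] at h0; omega
        simp [elemN, this]
    · have hx : x.1.val + 1 < μ := by simp only [blockNo] at h0; omega
      let k : Fin μ := ⟨x.1.val + 1, hx⟩
      have hk : x.1.val + 1 = k.val := rfl
      have hle : ℓ x.1 ≤ ℓ k := hℓ (Fin.le_def.2 (by omega))
      rw [Finset.sum_eq_single ⟨k, ⟨x.2.val, x.2.isLt.trans_le hle⟩⟩]
      · by_cases hxy : x = y
        · subst hxy
          rw [Matrix.diagonal_apply_eq, if_neg h0]
          simp [elemN, k]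
        · rw [Matrix.diagonal_apply_ne _ hxy]
          have : ¬ (y.1.val + 1 = k.val ∧ y.2.val = x.2.val) := by
            rintro ⟨h1, h2⟩
            apply hxy
            obtain ⟨i, p⟩ := x
            obtain ⟨j, q⟩ := y
            obtain rfl : i = j := Fin.ext (by simp only at hk h1; omega)
            obtain rfl : q = p := Fin.ext h2
            rfl
          simp [elemN, this]
      · rintro ⟨l, r⟩ _ hz
        have : ¬ (x.1.val + 1 = l.val ∧ x.2.val = r.val) := by
          rintro ⟨h1, h2⟩
          apply hz
          obtain rfl : l = k := Fin.ext (by omega)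
          congr
          exact Fin.ext h2.symm
        simp [elemN, this]
      · simp

end Sigma

/-! ### Normalization of the secondary diagonal blocks -/

section Normalization

variable {μ d : ℕ} {ℓ : Fin μ → ℕ} {I : Set ℝ} {m : ℕ∞}
  {N : ℝ → Matrix (BlockIdx ℓ) (BlockIdx ℓ) ℝ}

theorem IsSUTColumn.le (h : IsSUTColumn ℓ I N) (hn : I.Nonempty) {i j : Fin μ}
    (hij : i.val + 1 = j.val) : ℓ j ≤ ℓ i := by
  obtain ⟨t, ht⟩ := hn
  rw [← (h t ht).2 i j hij]
  simpa using (block (N t) i j).rank_le_height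

theorem IsSUTRow.le (h : IsSUTRow ℓ I N) (hn : I.Nonempty) {i j : Fin μ}
    (hij : i.val + 1 = j.val) : ℓ i ≤ ℓ j := by
  obtain ⟨t, ht⟩ := hn
  rw [← (h t ht).2 i j hij]
  simpa using (block (N t) i j).rank_le_width

/-- Completing the columns of `N_{i,i+1}` to a nonsingular `V_i` gives `N_{i,i+1} = V_i [I; 0]`. The
last block row has no successor and receives the identity. -/
theorem exists_normalizer_column (hI : I.OrdConnected) (hn : I.Nonempty)
    (hN : IsSUTColumn ℓ I N) (hNs : SmoothMat ((m + 1 : ℕ∞) : WithTop ℕ∞) I N) :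
    ∃ V : ∀ i, ℝ → Matrix (Fin (ℓ i)) (Fin (ℓ i)) ℝ,
      (∀ i, SmoothMat ((m + 1 : ℕ∞) : WithTop ℕ∞) I (V i)) ∧ (∀ i, ∀ t ∈ I, IsUnit (V i t)) ∧
      ∀ t ∈ I, UpperDeg blockNo 2 (N t - blockDiagonal' (fun i => V i t) * elemN ℓ) := by
  have h : ∀ i : Fin μ, ∃ V : ℝ → Matrix (Fin (ℓ i)) (Fin (ℓ i)) ℝ,
      SmoothMat ((m + 1 : ℕ∞) : WithTop ℕ∞) I V ∧ (∀ t ∈ I, IsUnit (V t)) ∧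
      ∀ j : Fin μ, i.val + 1 = j.val → ∀ t,
        block (N t) i j = V t * rectOne (ℓ i) (ℓ j) := by
    intro i
    by_cases hi : i.val + 1 < μ
    · have hle := hN.le hn (i := i) (j := ⟨i.val + 1, hi⟩) rfl
      obtain ⟨V, hV, hVu, hVA⟩ := exists_column_completion hI (le_add_self : 1 ≤ m + 1)
        (A := fun t => block (N t) i ⟨i.val + 1, hi⟩) (fun p q => hNs _ _)
        (fun t ht => (hN t ht).2 _ _ rfl) hle
      refine ⟨V, hV, hVu, fun j hj t => ?_⟩
      obtain rfl : j = ⟨i.val + 1, hi⟩ := Fin.ext hj.symm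
      ext p q
      rw [mul_rectOne_apply, dif_pos (q.isLt.trans_le hle)]
      exact (hVA t q ⟨q.val, q.isLt.trans_le hle⟩ rfl p).symm
    · exact ⟨fun _ => 1, smoothMat_const 1, fun _ _ => isUnit_one,
        fun j hj => absurd j.isLt (by omega)⟩
  choose V hV hVu hVA using h
  refine ⟨V, hV, hVu, fun t ht => upperDeg_two_sub (isSUT_iff.1 (hN t ht).1)
    ((blockDiagonal'_upperDeg _).mul_left elemN_upperDeg) fun i j hij => ?_⟩
  rw [block_blockDiagonal'_mul, block_elemN hij, hVA i j hij t]

theorem exists_normalizer_row (hI : I.OrdConnected) (hn : I.Nonempty)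
    (hN : IsSUTRow ℓ I N) (hNs : SmoothMat ((m + 1 : ℕ∞) : WithTop ℕ∞) I N) :
    ∃ W : ∀ i, ℝ → Matrix (Fin (ℓ i)) (Fin (ℓ i)) ℝ,
      (∀ i, SmoothMat ((m + 1 : ℕ∞) : WithTop ℕ∞) I (W i)) ∧ (∀ i, ∀ t ∈ I, IsUnit (W i t)) ∧
      ∀ t ∈ I, UpperDeg blockNo 2 (N t - elemN ℓ * blockDiagonal' (fun i => W i t)) := by
  have h : ∀ j : Fin μ, ∃ W : ℝ → Matrix (Fin (ℓ j)) (Fin (ℓ j)) ℝ,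
      SmoothMat ((m + 1 : ℕ∞) : WithTop ℕ∞) I W ∧ (∀ t ∈ I, IsUnit (W t)) ∧
      ∀ i : Fin μ, i.val + 1 = j.val → ∀ t,
        block (N t) i j = rectOne (ℓ i) (ℓ j) * W t := by
    intro j
    by_cases hj : j.val = 0
    · exact ⟨fun _ => 1, smoothMat_const 1, fun _ _ => isUnit_one,
        fun i hi => absurd hj (by omega)⟩
    · have hj' : j.val - 1 < μ := by omega
      have hs : (⟨j.val - 1, hj'⟩ : Fin μ).val + 1 = j.val := by simp only; omega
      have hle := hN.le hn hs
      obtain ⟨W, hW, hWu, hWA⟩ := exists_row_completion hI (le_add_self : 1 ≤ m + 1)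
        (A := fun t => block (N t) ⟨j.val - 1, hj'⟩ j) (fun p q => hNs _ _)
        (fun t ht => (hN t ht).2 _ _ hs) hle
      refine ⟨W, hW, hWu, fun i hi t => ?_⟩
      obtain rfl : i = ⟨j.val - 1, hj'⟩ := Fin.ext (by simp only; omega)
      ext p q
      rw [rectOne_mul_apply, dif_pos (p.isLt.trans_le hle)]
      exact (hWA t p ⟨p.val, p.isLt.trans_le hle⟩ rfl q).symm
  choose W hW hWu hWA using h
  refine ⟨W, hW, hWu, fun t ht => upperDeg_two_sub (isSUT_iff.1 (hN t ht).1)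
    (by simpa using elemN_upperDeg.mul (blockDiagonal'_upperDeg _)) fun i j hij => ?_⟩
  rw [block_mul_blockDiagonal', block_elemN hij, hWA j i hij t]

/-- On the secondary diagonal `V⁻¹ N V` equals `V⁻¹ (V elemN) V = elemN V`, whose blocks are `[W_j;
0]`. Moving the completions from the left to the right side thus produces the required pattern. -/
theorem exists_normalized_T (hI : I.OrdConnected) (hn : I.Nontrivial)
    {Ω : ℝ → Matrix (Fin d) (Fin d) ℝ} {F₂₁ : ℝ → Matrix (BlockIdx ℓ) (Fin d) ℝ}
    {E F : ℝ → Matrix (Fin d ⊕ BlockIdx ℓ) (Fin d ⊕ BlockIdx ℓ) ℝ}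
    (h : IsTCanonical I N Ω F₂₁ E F) (hNs : SmoothMat ((m + 1 : ℕ∞) : WithTop ℕ∞) I N)
    (hFs : SmoothMat ((m + 1 : ℕ∞) : WithTop ℕ∞) I F₂₁) :
    ∃ (N₁ : ℝ → Matrix (BlockIdx ℓ) (BlockIdx ℓ) ℝ)
      (G₂₁ : ℝ → Matrix (BlockIdx ℓ) (Fin d) ℝ)
      (E₁ F₁ : ℝ → Matrix (Fin d ⊕ BlockIdx ℓ) (Fin d ⊕ BlockIdx ℓ) ℝ),
      IsTCanonical I N₁ Ω G₂₁ E₁ F₁ ∧ HasColumnPattern ℓ I N₁ ∧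
      SmoothMat (m : WithTop ℕ∞) I N₁ ∧ SmoothMat (m : WithTop ℕ∞) I G₂₁ ∧
      Equivalent m I E F E₁ F₁ := by
  have hU := uniqueDiffOn_interval hI hn
  obtain ⟨W, hWs, hWu, hW⟩ := exists_normalizer_column hI hn.nonempty h.column hNs
  have hN : ∀ t ∈ I, UpperDeg blockNo 1 (N t) := fun t ht => isSUT_iff.1 (h.column t ht).1
  set V : ℝ → Matrix (BlockIdx ℓ) (BlockIdx ℓ) ℝ := fun t => blockDiagonal' fun i => W i t
    with hVdef
  have hV : ∀ t ∈ I, UpperDeg blockNo 0 (V t) := fun t _ => blockDiagonal'_upperDeg _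
  have hVu : ∀ t ∈ I, IsUnit (V t) := fun t ht => isUnit_blockDiagonal' fun i => hWu i t ht
  have hVs : SmoothMat ((m + 1 : ℕ∞) : WithTop ℕ∞) I V := smoothMat_blockDiagonal' hWs
  have hNs' := hNs.of_le (le_self_add : m ≤ m + 1)
  have hT := transforms_strict hU hN hV hVu hNs' hVs
  set L : ℝ → Matrix (BlockIdx ℓ) (BlockIdx ℓ) ℝ := fun t => (V t + N t * matDeriv I V t)⁻¹
    with hL
  set N₁ : ℝ → Matrix (BlockIdx ℓ) (BlockIdx ℓ) ℝ := fun t => L t * N t * V t with hN₁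
  have hblock : ∀ t ∈ I, UpperDeg blockNo 2 (N₁ t - elemN ℓ * V t) := fun t ht => by
    have h1 := strict_transform_sub hN hV hVu ht
    have h2 := (((hV t ht).inv (hVu t ht)).mul_left (hW t ht)).mul (hV t ht)
    have h3 := h1.add h2
    have e : N₁ t - elemN ℓ * V t = (V t + N t * matDeriv I V t)⁻¹ * N t * V t
        - (V t)⁻¹ * N t * V t + (V t)⁻¹ * (N t - V t * elemN ℓ) * V t := by
      have hi := inv_mul_of_isUnit (hVu t ht)
      calc _ = N₁ t - (V t)⁻¹ * V t * elemN ℓ * V t := by rw [hi, Matrix.one_mul]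
        _ = _ := by simp only [hN₁, hL]; noncomm_ring
    rw [e]
    exact h3
  have hN₁d : ∀ t ∈ I, UpperDeg blockNo 1 (N₁ t) := fun t ht => by
    have h2 := elemN_upperDeg.mul (hV t ht)
    have := ((hblock t ht).mono (by omega : 1 ≤ 2)).add h2
    simpa using this
  have hb : ∀ t ∈ I, ∀ i j : Fin μ, i.val + 1 = j.val →
      block (N₁ t) i j = rectOne (ℓ i) (ℓ j) * W j t := fun t ht i j hij => by
    rw [block_eq_of_upperDeg_two (hblock t ht) hij, block_mul_blockDiagonal', block_elemN hij]
  refine ⟨N₁, fun t => L t * F₂₁ t, fun t => fromBlocks 1 0 0 (N₁ t),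
    fun t => fromBlocks (Ω t) 0 (L t * F₂₁ t) 1,
    ⟨fun t ht => ⟨isSUT_iff.2 (hN₁d t ht), fun i j hij => ?_⟩, fun _ _ => rfl, fun _ _ => rfl⟩,
    fun t ht i j hij => ⟨W j t, hWu j t ht, fun p q => ?_⟩,
    (hT.smooth_L.mul hNs').mul (hVs.of_le le_self_add),
    hT.smooth_L.mul (hFs.of_le le_self_add),
    fun t => fromBlocks 1 0 0 (L t), fun t => fromBlocks 1 0 0 (V t), ?_⟩
  · rw [hb t ht i j hij, rank_rectOne_mul (h.column.le hn.nonempty hij) (hWu j t ht)]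
  · rw [hb t ht i j hij, rectOne_mul_apply]
  · have hD := hT.fromBlocks_one Ω
    refine ⟨hD.smooth_L, hD.smooth_K, hD.isUnit_L, hD.isUnit_K, fun t ht => ?_, fun t ht => ?_⟩
    · rw [h.eq_E t ht, hD.eq_E t ht]
    · have hF : L t * V t + L t * N t * matDeriv I V t = 1 := by
        simpa using (hT.eq_F t ht).symm
      rw [h.eq_E t ht, h.eq_F t ht]
      simp [fromBlocks_multiply, matDeriv_fromBlocks, fromBlocks_add, hF]

/-- Here `N` agrees with `elemN D` on the secondary diagonal, and conjugation with `V = D⁻¹` turns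
it into `D elemN`. The coupling `E₁₂` makes `V'` appear in the upper right block of the second
matrix, which requires a correction in the left factor. -/
theorem exists_normalized_S (hI : I.OrdConnected) (hn : I.Nontrivial)
    {Ω : ℝ → Matrix (Fin d) (Fin d) ℝ} {E₁₂ : ℝ → Matrix (Fin d) (BlockIdx ℓ) ℝ}
    {E F : ℝ → Matrix (Fin d ⊕ BlockIdx ℓ) (Fin d ⊕ BlockIdx ℓ) ℝ}
    (h : IsSCanonical I N Ω E₁₂ E F) (hNs : SmoothMat ((m + 1 : ℕ∞) : WithTop ℕ∞) I N)
    (hEs : SmoothMat ((m + 1 : ℕ∞) : WithTop ℕ∞) I E₁₂) :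
    ∃ (N₁ : ℝ → Matrix (BlockIdx ℓ) (BlockIdx ℓ) ℝ)
      (G₁₂ : ℝ → Matrix (Fin d) (BlockIdx ℓ) ℝ)
      (E₁ F₁ : ℝ → Matrix (Fin d ⊕ BlockIdx ℓ) (Fin d ⊕ BlockIdx ℓ) ℝ),
      IsSCanonical I N₁ Ω G₁₂ E₁ F₁ ∧ HasRowPattern ℓ I N₁ ∧
      SmoothMat (m : WithTop ℕ∞) I N₁ ∧ SmoothMat (m : WithTop ℕ∞) I G₁₂ ∧
      Equivalent m I E F E₁ F₁ := by
  have hU := uniqueDiffOn_interval hI hn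
  obtain ⟨W, hWs, hWu, hW⟩ := exists_normalizer_row hI hn.nonempty h.row hNs
  have hN : ∀ t ∈ I, UpperDeg blockNo 1 (N t) := fun t ht => isSUT_iff.1 (h.row t ht).1
  set D : ℝ → Matrix (BlockIdx ℓ) (BlockIdx ℓ) ℝ := fun t => blockDiagonal' fun i => W i t
    with hDdef
  have hDd : ∀ t ∈ I, UpperDeg blockNo 0 (D t) := fun t _ => blockDiagonal'_upperDeg _
  have hDu : ∀ t ∈ I, IsUnit (D t) := fun t ht => isUnit_blockDiagonal' fun i => hWu i t ht
  set V : ℝ → Matrix (BlockIdx ℓ) (BlockIdx ℓ) ℝ := fun t => (D t)⁻¹ with hVdef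
  have hV : ∀ t ∈ I, UpperDeg blockNo 0 (V t) := fun t ht => (hDd t ht).inv (hDu t ht)
  have hVu : ∀ t ∈ I, IsUnit (V t) := fun t ht => isUnit_inv (hDu t ht)
  have hVs : SmoothMat ((m + 1 : ℕ∞) : WithTop ℕ∞) I V := (smoothMat_blockDiagonal' hWs).inv hDu
  have hVi : ∀ t ∈ I, (V t)⁻¹ = D t := fun t ht =>
    Matrix.inv_eq_left_inv (mul_inv_of_isUnit (hDu t ht))
  have hNs' := hNs.of_le (le_self_add : m ≤ m + 1)
  have hT := transforms_strict hU hN hV hVu hNs' hVs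
  set L : ℝ → Matrix (BlockIdx ℓ) (BlockIdx ℓ) ℝ := fun t => (V t + N t * matDeriv I V t)⁻¹
    with hL
  set N₁ : ℝ → Matrix (BlockIdx ℓ) (BlockIdx ℓ) ℝ := fun t => L t * N t * V t with hN₁
  have hblock : ∀ t ∈ I, UpperDeg blockNo 2 (N₁ t - D t * elemN ℓ) := fun t ht => by
    have h1 := strict_transform_sub hN hV hVu ht
    have h2 := ((hDd t ht).mul_left (hW t ht)).mul (hV t ht)
    have h3 := h1.add h2
    have e : N₁ t - D t * elemN ℓ = (V t + N t * matDeriv I V t)⁻¹ * N t * V t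
        - (V t)⁻¹ * N t * V t + D t * (N t - elemN ℓ * D t) * V t := by
      have hi : D t * V t = 1 := mul_inv_of_isUnit (hDu t ht)
      rw [hVi t ht]
      calc _ = N₁ t - D t * elemN ℓ * (D t * V t) := by rw [hi, Matrix.mul_one]
        _ = _ := by simp only [hN₁, hL]; noncomm_ring
    rw [e]
    exact h3
  have hN₁d : ∀ t ∈ I, UpperDeg blockNo 1 (N₁ t) := fun t ht => by
    have := ((hblock t ht).mono (by omega : 1 ≤ 2)).add ((hDd t ht).mul_left elemN_upperDeg)
    simpa using this
  have hb : ∀ t ∈ I, ∀ i j : Fin μ, i.val + 1 = j.val →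
      block (N₁ t) i j = W i t * rectOne (ℓ i) (ℓ j) := fun t ht i j hij => by
    rw [block_eq_of_upperDeg_two (hblock t ht) hij, block_blockDiagonal'_mul, block_elemN hij]
  have hLu : ∀ t ∈ I, L t * (V t + N t * matDeriv I V t) = 1 := fun t ht =>
    inv_mul_of_isUnit (isUnit_add_mul_deriv hN hV hVu ht)
  -- `X` solves `E₁₂ V' + X (V + N V') = 0`, the vanishing of the new upper right block of the
  -- second matrix.
  set X : ℝ → Matrix (Fin d) (BlockIdx ℓ) ℝ := fun t => -(E₁₂ t * matDeriv I V t * L t) with hX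
  have hEs' := hEs.of_le (le_self_add : m ≤ m + 1)
  have hXs : SmoothMat (m : WithTop ℕ∞) I X := ((hEs'.mul (hVs.deriv hU)).mul hT.smooth_L).neg
  have hVs' := hVs.of_le (le_self_add : m ≤ m + 1)
  refine ⟨N₁, fun t => (E₁₂ t + X t * N t) * V t,
    fun t => fromBlocks 1 ((E₁₂ t + X t * N t) * V t) 0 (N₁ t),
    fun t => fromBlocks (Ω t) 0 0 1,
    ⟨fun t ht => ⟨isSUT_iff.2 (hN₁d t ht), fun i j hij => ?_⟩, fun t ht p x hx => ?_,
      fun _ _ => rfl, fun _ _ => rfl⟩,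
    fun t ht i j hij => ⟨W i t, hWu i t ht, fun p q => ?_⟩,
    (hT.smooth_L.mul hNs').mul hVs', (hEs'.add (hXs.mul hNs')).mul hVs',
    fun t => fromBlocks 1 (X t) 0 (L t), fun t => fromBlocks 1 0 0 (V t), ?_⟩
  · rw [hb t ht i j hij, rank_mul_rectOne (h.row.le hn.nonempty hij) (hWu i t ht)]
  · rw [Matrix.mul_apply]
    refine Finset.sum_eq_zero fun y _ => ?_
    -- The first block column survives the correction: that of `X N` vanishes since `N` has degree
    -- 1, and `V` is block upper triangular.
    rcases Nat.eq_zero_or_pos (blockNo y) with hy | hy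
    · have h1 : (X t * N t) p y = 0 := by
        rw [Matrix.mul_apply]
        exact Finset.sum_eq_zero fun z _ => by rw [hN t ht z y (by omega), mul_zero]
      rw [Matrix.add_apply, h.first_zero t ht p y hy, h1]
      simp
    · rw [hV t ht y x (by simp only [blockNo] at hy ⊢; omega), mul_zero]
  · rw [hb t ht i j hij, mul_rectOne_apply]
  · have hD := hT.fromBlocks_one Ω
    refine ⟨(smoothMat_const _).fromBlocks hXs (smoothMat_const _) hT.smooth_L, hD.smooth_K,
      fun t ht => isUnit_fromBlocks_zero₂₁ isUnit_one (hT.isUnit_L t ht), hD.isUnit_K,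
      fun t ht => ?_, fun t ht => ?_⟩
    · rw [h.eq_E t ht]
      simp [fromBlocks_multiply, hN₁]
    · have hF : L t * V t + L t * N t * matDeriv I V t = 1 := by
        simpa using (hT.eq_F t ht).symm
      have hz : X t * V t + (E₁₂ t + X t * N t) * matDeriv I V t = 0 := by
        calc _ = E₁₂ t * matDeriv I V t + X t * (V t + N t * matDeriv I V t) := by
              rw [Matrix.add_mul, Matrix.mul_add, Matrix.mul_assoc (X t)]; abel
          _ = 0 := by
              simp only [hX]
              rw [Matrix.neg_mul, Matrix.mul_assoc _ (L t), hLu t ht]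
              simp
      rw [h.eq_E t ht, h.eq_F t ht]
      simp [fromBlocks_multiply, matDeriv_fromBlocks, fromBlocks_add, hF, hz]

end Normalization

end DAE

namespace DAE

/-! ### The matrices `R^c` and `R^r` -/

section Correction

variable {κ : Type*} [Fintype κ] [DecidableEq κ] {b : κ → ℕ} {M N D : Matrix κ κ ℝ}

theorem IsShift.upperDeg_correction (hM : IsShift b M) (hN : UpperDeg b 1 N) :
    UpperDeg b 0 (N * Mᵀ + (1 - M * Mᵀ)) :=
  (hM.mul_transpose hN).add hM.upperDeg_compl

theorem IsShift.correction_mul (hM : IsShift b M) (hN : UpperDeg b 1 N) :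
    (N * Mᵀ + (1 - M * Mᵀ)) * M = N := by
  rw [Matrix.add_mul, Matrix.sub_mul, hM.mul_gram_self, Matrix.mul_assoc, hM.mul_gram hN]
  simp

/-- Replacing `N` by its secondary diagonal part `M D` changes the expression only by terms of
degree 1, and for `M D` it is the unit of `isUnit_conj`. -/
theorem IsShift.isUnit_correction (hM : IsShift b M) (hD : UpperDeg b 0 D) (hu : IsUnit D)
    (hND : UpperDeg b 2 (N - M * D)) : IsUnit (N * Mᵀ + (1 - M * Mᵀ)) := by
  have h : N * Mᵀ + (1 - M * Mᵀ) = (M * D * Mᵀ + (1 - M * Mᵀ)) + (N - M * D) * Mᵀ := by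
    noncomm_ring
  rw [h]
  exact (hM.conj_upperDeg hD).isUnit_add (hM.isUnit_conj hD hu) (hM.mul_transpose hND)

end Correction

section Patterns

variable {μ : ℕ} {ℓ : Fin μ → ℕ} {I : Set ℝ} {N : ℝ → Matrix (BlockIdx ℓ) (BlockIdx ℓ) ℝ}

theorem antitone_of_step (h : ∀ i j : Fin μ, i.val + 1 = j.val → ℓ j ≤ ℓ i) : Antitone ℓ := by
  have key : ∀ k : ℕ, ∀ i j : Fin μ, i.val + k = j.val → ℓ j ≤ ℓ i := by
    intro k
    induction k with
    | zero => intro i j hij; rw [Fin.ext (by omega : i.val = j.val)]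
    | succ k ih =>
      intro i j hij
      have hj := j.isLt
      exact (h ⟨i.val + k, by omega⟩ j (by simp only; omega)).trans (ih i _ rfl)
  exact fun i j hij => key (j.val - i.val) i j (by have := Fin.le_def.1 hij; omega)

theorem monotone_of_step (h : ∀ i j : Fin μ, i.val + 1 = j.val → ℓ i ≤ ℓ j) : Monotone ℓ := by
  have key : ∀ k : ℕ, ∀ i j : Fin μ, i.val + k = j.val → ℓ i ≤ ℓ j := by
    intro k
    induction k with
    | zero => intro i j hij; rw [Fin.ext (by omega : i.val = j.val)]
    | succ k ih =>
      intro i j hij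
      have hj := j.isLt
      exact (ih i ⟨i.val + k, by omega⟩ rfl).trans (h _ j (by simp only; omega))
  exact fun i j hij => key (j.val - i.val) i j (by have := Fin.le_def.1 hij; omega)

theorem IsSUTColumn.antitone (h : IsSUTColumn ℓ I N) (hn : I.Nonempty) : Antitone ℓ :=
  antitone_of_step fun _ _ => h.le hn

theorem IsSUTRow.monotone (h : IsSUTRow ℓ I N) (hn : I.Nonempty) : Monotone ℓ :=
  monotone_of_step fun _ _ => h.le hn

theorem HasColumnPattern.exists_diagonal (hp : HasColumnPattern ℓ I N) {t : ℝ} (ht : t ∈ I)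
    (hN : UpperDeg blockNo 1 (N t)) :
    ∃ D, UpperDeg blockNo 0 D ∧ IsUnit D ∧ UpperDeg blockNo 2 (N t - elemN ℓ * D) := by
  have h : ∀ j : Fin μ, ∃ R : Matrix (Fin (ℓ j)) (Fin (ℓ j)) ℝ, IsUnit R ∧
      ∀ i : Fin μ, i.val + 1 = j.val → block (N t) i j = rectOne (ℓ i) (ℓ j) * R := by
    intro j
    by_cases hj : j.val = 0
    · exact ⟨1, isUnit_one, fun i hi => absurd hj (by omega)⟩
    · have hj' : j.val - 1 < μ := by omega
      have hs : (⟨j.val - 1, hj'⟩ : Fin μ).val + 1 = j.val := by simp only; omega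
      obtain ⟨R, hR, hRe⟩ := hp t ht _ j hs
      refine ⟨R, hR, fun i hi => ?_⟩
      obtain rfl : i = ⟨j.val - 1, hj'⟩ := Fin.ext (by simp only; omega)
      ext p q
      rw [rectOne_mul_apply, hRe p q]
  choose R hR hRe using h
  refine ⟨blockDiagonal' R, blockDiagonal'_upperDeg R, isUnit_blockDiagonal' hR,
    upperDeg_two_sub hN (by simpa using elemN_upperDeg.mul (blockDiagonal'_upperDeg R))
      fun i j hij => ?_⟩
  rw [block_mul_blockDiagonal', block_elemN hij, hRe j i hij]

theorem HasRowPattern.exists_diagonal (hp : HasRowPattern ℓ I N) {t : ℝ} (ht : t ∈ I)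
    (hN : UpperDeg blockNo 1 (N t)) :
    ∃ D, UpperDeg blockNo 0 D ∧ IsUnit D ∧ UpperDeg blockNo 2 (N t - D * elemN ℓ) := by
  have h : ∀ i : Fin μ, ∃ R : Matrix (Fin (ℓ i)) (Fin (ℓ i)) ℝ, IsUnit R ∧
      ∀ j : Fin μ, i.val + 1 = j.val → block (N t) i j = R * rectOne (ℓ i) (ℓ j) := by
    intro i
    by_cases hi : i.val + 1 < μ
    · obtain ⟨R, hR, hRe⟩ := hp t ht i ⟨i.val + 1, hi⟩ rfl
      refine ⟨R, hR, fun j hj => ?_⟩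
      obtain rfl : j = ⟨i.val + 1, hi⟩ := Fin.ext hj.symm
      ext p q
      rw [mul_rectOne_apply, hRe p q]
    · exact ⟨1, isUnit_one, fun j hj => absurd j.isLt (by omega)⟩
  choose R hR hRe using h
  refine ⟨blockDiagonal' R, blockDiagonal'_upperDeg R, isUnit_blockDiagonal' hR,
    upperDeg_two_sub hN ((blockDiagonal'_upperDeg R).mul_left elemN_upperDeg)
      fun i j hij => ?_⟩
  rw [block_blockDiagonal'_mul, block_elemN hij, hRe i j hij]

theorem Rc_spec (hℓ : Antitone ℓ) (hp : HasColumnPattern ℓ I N) {t : ℝ} (ht : t ∈ I)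
    (hN : UpperDeg blockNo 1 (N t)) :
    UpperDeg blockNo 0 (Rc ℓ N t) ∧ IsUnit (Rc ℓ N t) ∧ N t = Rc ℓ N t * elemN ℓ := by
  have hM := isShift_elemN hℓ
  obtain ⟨D, hD, hDu, hND⟩ := hp.exists_diagonal ht hN
  exact ⟨hM.upperDeg_correction hN, hM.isUnit_correction hD hDu hND, (hM.correction_mul hN).symm⟩

/-- `(R^r)ᵀ` is the column-type correction of `Nᵀ` with respect to the shift `(N^(E_r))ᵀ` and the
reversed grade. -/
theorem Rr_spec (hℓ : Monotone ℓ) (hp : HasRowPattern ℓ I N) {t : ℝ} (ht : t ∈ I)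
    (hN : UpperDeg blockNo 1 (N t)) :
    UpperDeg blockNo 0 (Rr ℓ N t) ∧ IsUnit (Rr ℓ N t) ∧ N t = elemN ℓ * Rr ℓ N t := by
  have hM := isShift_elemN_transpose hℓ
  obtain ⟨D, hD, hDu, hND⟩ := hp.exists_diagonal ht hN
  have e : (Rr ℓ N t)ᵀ =
      (N t)ᵀ * (elemN ℓ)ᵀᵀ + (1 - (elemN ℓ)ᵀ * (elemN ℓ)ᵀᵀ) := by
    simp [Rr, Matrix.transpose_mul]
  have hN' := hN.transpose blockNo_le
  refine ⟨UpperDeg.of_transpose blockNo_le ?_, (Matrix.isUnit_transpose _).1 ?_, ?_⟩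
  · rw [e]
    exact hM.upperDeg_correction hN'
  · rw [e]
    refine hM.isUnit_correction (hD.transpose blockNo_le) ((Matrix.isUnit_transpose _).2 hDu) ?_
    rw [← Matrix.transpose_mul, ← Matrix.transpose_sub]
    exact hND.transpose blockNo_le
  · rw [← Matrix.transpose_inj, Matrix.transpose_mul, e]
    exact (hM.correction_mul hN').symm

end Patterns

/-! ### The elimination steps -/

section Elimination

variable {ι κ : Type*} [Fintype ι] [DecidableEq ι] [Fintype κ] [DecidableEq κ]
  {I : Set ℝ} {M : Matrix κ κ ℝ} {F : ℝ → Matrix (ι ⊕ κ) (ι ⊕ κ) ℝ} {m p : ℕ∞}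

omit [Fintype ι] [DecidableEq ι] [Fintype κ] [DecidableEq κ] in
theorem SmoothMat.toBlocks {n : WithTop ℕ∞} (h : SmoothMat n I F) :
    SmoothMat n I (fun t => (F t).toBlocks₁₂) ∧ SmoothMat n I (fun t => (F t).toBlocks₂₁) ∧
      SmoothMat n I (fun t => (F t).toBlocks₂₂) :=
  ⟨fun _ _ => h _ _, fun _ _ => h _ _, fun _ _ => h _ _⟩

omit [Fintype ι] [DecidableEq ι] in
theorem smoothMat_coefA {n : WithTop ℕ∞} (h : SmoothMat n I F)
    (hu : ∀ t ∈ I, IsUnit (F t).toBlocks₂₂) : SmoothMat n I (coefA M F) :=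
  (h.toBlocks.1.mul (h.toBlocks.2.2.inv hu)).mul (smoothMat_const M)

omit [Fintype ι] [DecidableEq ι] in
theorem smoothMat_coefB {n : WithTop ℕ∞} (h : SmoothMat n I F)
    (hu : ∀ t ∈ I, IsUnit (F t).toBlocks₂₂) : SmoothMat n I (coefB F) :=
  ((h.toBlocks.2.2.inv hu).mul h.toBlocks.2.1).neg

theorem isUnit_unipotent_upper (X : Matrix ι κ ℝ) :
    IsUnit (fromBlocks (1 : Matrix ι ι ℝ) X 0 (1 : Matrix κ κ ℝ)) :=
  isUnit_fromBlocks_zero₂₁ isUnit_one isUnit_one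

theorem isUnit_unipotent_lower (X : Matrix κ ι ℝ) :
    IsUnit (fromBlocks (1 : Matrix ι ι ℝ) 0 X (1 : Matrix κ κ ℝ)) :=
  isUnit_fromBlocks_zero₁₂ isUnit_one isUnit_one

theorem step1_transforms (h : SmoothMat ((m + 1 : ℕ∞) : WithTop ℕ∞) I F)
    (hu : ∀ t ∈ I, IsUnit (F t).toBlocks₂₂) :
    Transforms m I (fun t => fromBlocks 1 (-((F t).toBlocks₁₂ * ((F t).toBlocks₂₂)⁻¹)) 0 1)
      (fun t => fromBlocks 1 (coefA M F t) 0 1) (leading M) F (leading M) (step1 I M F) where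
  smooth_L := by
    have h' := (h.of_le (le_self_add : m ≤ m + 1)).toBlocks
    exact (smoothMat_const _).fromBlocks (h'.1.mul (h'.2.2.inv hu)).neg (smoothMat_const _)
      (smoothMat_const _)
  smooth_K := (smoothMat_const _).fromBlocks (smoothMat_coefA h hu) (smoothMat_const _)
    (smoothMat_const _)
  isUnit_L _ _ := isUnit_unipotent_upper _
  isUnit_K _ _ := isUnit_unipotent_upper _
  eq_E t _ := by simp [leading, fromBlocks_multiply, coefA]
  eq_F t _ := by
    rw [matDeriv_fromBlocks]
    simp [leading, fromBlocks_multiply, step1]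

theorem step2_transforms (h : SmoothMat ((m + 1 : ℕ∞) : WithTop ℕ∞) I F)
    (hu : ∀ t ∈ I, IsUnit (F t).toBlocks₂₂) :
    Transforms m I (fun t => fromBlocks 1 0 (-(M * coefB F t)) 1)
      (fun t => fromBlocks 1 0 (coefB F t) 1) (leading M) F (leading M) (step2 I M F) where
  smooth_L := (smoothMat_const _).fromBlocks (smoothMat_const _) ((smoothMat_const _).mul
    (smoothMat_coefB (h.of_le le_self_add) hu)).neg (smoothMat_const _)
  smooth_K := (smoothMat_const _).fromBlocks (smoothMat_const _) (smoothMat_coefB h hu)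
    (smoothMat_const _)
  isUnit_L _ _ := isUnit_unipotent_lower _
  isUnit_K _ _ := isUnit_unipotent_lower _
  eq_E t _ := by simp [leading, fromBlocks_multiply]
  eq_F t _ := by
    rw [matDeriv_fromBlocks]
    simp [leading, fromBlocks_multiply, step2]

theorem smoothMat_step1 (hI : UniqueDiffOn ℝ I) (h : SmoothMat ((p + 1 : ℕ∞) : WithTop ℕ∞) I F)
    (hu : ∀ t ∈ I, IsUnit (F t).toBlocks₂₂) : SmoothMat (p : WithTop ℕ∞) I (step1 I M F) := by
  have hT := step1_transforms (M := M) h hu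
  exact ((hT.smooth_L.mul (h.of_le le_self_add)).mul (hT.smooth_K.of_le le_self_add)).add
    ((smoothMat_const _).fromBlocks ((smoothMat_coefA h hu).deriv hI) (smoothMat_const _)
      (smoothMat_const _))

theorem smoothMat_step2 (hI : UniqueDiffOn ℝ I) (h : SmoothMat ((p + 1 : ℕ∞) : WithTop ℕ∞) I F)
    (hu : ∀ t ∈ I, IsUnit (F t).toBlocks₂₂) : SmoothMat (p : WithTop ℕ∞) I (step2 I M F) := by
  have hT := step2_transforms (M := M) h hu
  exact ((hT.smooth_L.mul (h.of_le le_self_add)).mul (hT.smooth_K.of_le le_self_add)).add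
    ((smoothMat_const _).fromBlocks (smoothMat_const _)
      ((smoothMat_const _).mul ((smoothMat_coefB h hu).deriv hI)) (smoothMat_const _))

omit [Fintype ι] [DecidableEq ι] [Fintype κ] [DecidableEq κ] in
theorem smoothMat_iterate {S : (ℝ → Matrix (ι ⊕ κ) (ι ⊕ κ) ℝ) → ℝ → Matrix (ι ⊕ κ) (ι ⊕ κ) ℝ}
    (hS : ∀ (j : ℕ) (p : ℕ∞), SmoothMat ((p + 1 : ℕ∞) : WithTop ℕ∞) I (S^[j] F) →
      SmoothMat (p : WithTop ℕ∞) I (S (S^[j] F))) (j : ℕ) :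
    ∀ {p : ℕ∞}, SmoothMat ((p + j : ℕ∞) : WithTop ℕ∞) I F →
      SmoothMat (p : WithTop ℕ∞) I (S^[j] F) := by
  induction j with
  | zero => intro p h; simpa using h
  | succ j ih =>
    intro p h
    rw [Function.iterate_succ_apply']
    refine hS j p (ih ?_)
    rwa [add_assoc, add_comm 1 (j : ℕ∞), ← Nat.cast_succ]

/-- Unipotent right factors multiply by adding their corners, which is why the sum of the `A_i` is
the corner of the total transformation. -/
theorem step1_iterate_transforms (n : ℕ)
    (h : ∀ j < n, SmoothMat ((m + 1 : ℕ∞) : WithTop ℕ∞) I ((step1 I M)^[j] F))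
    (hu : ∀ j < n, ∀ t ∈ I, IsUnit ((step1 I M)^[j] F t).toBlocks₂₂) :
    ∃ L, Transforms m I L
      (fun t => fromBlocks 1 (∑ j ∈ Finset.range n, coefA M ((step1 I M)^[j] F) t) 0 1)
      (leading M) F (leading M) ((step1 I M)^[n] F) := by
  induction n with
  | zero =>
    refine ⟨fun _ => 1, smoothMat_const _, ?_, fun _ _ => isUnit_one, ?_, ?_, ?_⟩
    · exact smoothMat_const (fromBlocks 1 0 0 1)
    · exact fun _ _ => isUnit_unipotent_upper _
    · intro t _; simp
    · intro t _; simp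
  | succ n ih =>
    obtain ⟨L, hL⟩ := ih (fun j hj => h j (by omega)) (fun j hj => hu j (by omega))
    have h2 := hL.trans (step1_transforms (h n (by omega)) (hu n (by omega)))
    rw [← Function.iterate_succ_apply' (step1 I M) n F] at h2
    refine ⟨_, Eq.subst (motive := fun K => Transforms m I _ K _ _ _ _) ?_ h2⟩
    funext t
    simp [fromBlocks_multiply, Finset.sum_range_succ, add_comm]

theorem step2_iterate_transforms (n : ℕ)
    (h : ∀ j < n, SmoothMat ((m + 1 : ℕ∞) : WithTop ℕ∞) I ((step2 I M)^[j] F))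
    (hu : ∀ j < n, ∀ t ∈ I, IsUnit ((step2 I M)^[j] F t).toBlocks₂₂) :
    ∃ L, Transforms m I L
      (fun t => fromBlocks 1 0 (∑ j ∈ Finset.range n, coefB ((step2 I M)^[j] F) t) 1)
      (leading M) F (leading M) ((step2 I M)^[n] F) := by
  induction n with
  | zero =>
    refine ⟨fun _ => 1, smoothMat_const _, ?_, fun _ _ => isUnit_one, ?_, ?_, ?_⟩
    · exact smoothMat_const (fromBlocks 1 0 0 1)
    · exact fun _ _ => isUnit_unipotent_lower _
    · intro t _; simp
    · intro t _; simp
  | succ n ih =>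
    obtain ⟨L, hL⟩ := ih (fun j hj => h j (by omega)) (fun j hj => hu j (by omega))
    have h2 := hL.trans (step2_transforms (h n (by omega)) (hu n (by omega)))
    rw [← Function.iterate_succ_apply' (step2 I M) n F] at h2
    refine ⟨_, Eq.subst (motive := fun K => Transforms m I _ K _ _ _ _) ?_ h2⟩
    funext t
    simp [fromBlocks_multiply, Finset.sum_range_succ]

omit [Fintype ι] [DecidableEq ι] in
theorem coefA_eq_zero (h : ∀ t, (F t).toBlocks₁₂ = 0) : coefA M F = fun _ => 0 := by
  funext t
  simp [coefA, h t]

theorem step1_eq_self (h : ∀ t, (F t).toBlocks₁₂ = 0) : step1 I M F = F := by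
  funext t
  simp [step1, coefA_eq_zero h, h t, fromBlocks_one]

/-! ### Block structure of the iterates for triangular `F`. -/

variable {b : κ → ℕ} {Ω : ℝ → Matrix ι ι ℝ} {H : ℝ → Matrix κ κ ℝ}

/-- For lower block triangular `F`, each iteration of Step 2 annihilates a block row of
`F₂₁`. -/
theorem step2_iterate_form (hM : UpperDeg b 1 M) {μ : ℕ} (hb : ∀ x, b x < μ)
    (hH : ∀ t ∈ I, UpperDeg b 0 (H t)) (hHu : ∀ t ∈ I, IsUnit (H t))
    (hF : ∀ t ∈ I, F t = fromBlocks (Ω t) 0 (F t).toBlocks₂₁ (H t)) (j : ℕ) :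
    ∀ t ∈ I, (step2 I M)^[j] F t =
        fromBlocks (Ω t) 0 ((step2 I M)^[j] F t).toBlocks₂₁ (H t) ∧
      ∀ x i, μ ≤ b x + j → ((step2 I M)^[j] F t).toBlocks₂₁ x i = 0 := by
  induction j with
  | zero => exact fun t ht => ⟨hF t ht, fun x i hx => absurd (hb x) (by omega)⟩
  | succ j ih =>
    intro t ht
    rw [Function.iterate_succ_apply']
    set G := (step2 I M)^[j] F with hG
    have hB : ∀ t ∈ I, coefB G t = -((H t)⁻¹ * (G t).toBlocks₂₁) := fun t ht => by
      simp only [coefB]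
      rw [(ih t ht).1, toBlocks_fromBlocks₂₂, toBlocks_fromBlocks₂₁]
    have hB0 : ∀ t ∈ I, ∀ x i, μ ≤ b x + j → coefB G t x i = 0 := by
      intro t ht x i hx
      rw [hB t ht, Matrix.neg_apply, Matrix.mul_apply, Finset.sum_eq_zero, neg_zero]
      intro y _
      rcases lt_or_ge (b y) (b x) with hxy | hxy
      · rw [(hH t ht).inv (hHu t ht) x y (by omega), zero_mul]
      · rw [(ih t ht).2 y i (by omega), mul_zero]
    have hz : (G t).toBlocks₂₁ + H t * coefB G t = 0 := by
      rw [hB t ht, Matrix.mul_neg, ← Matrix.mul_assoc, mul_inv_of_isUnit (hHu t ht)]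
      simp
    -- As `B` is chosen with `G₂₁ + H B = 0`, only `M (B' - B Ω)` remains. `B` inherits the zero
    -- rows of `G₂₁` because `H⁻¹` is block upper triangular, and `M` adds one more.
    have e : step2 I M G t = fromBlocks (Ω t) 0
        (M * (matDeriv I (coefB G) t - coefB G t * Ω t)) (H t) := by
      have h1 := (ih t ht).1
      have : step2 I M G t = fromBlocks 1 0 (-(M * coefB G t)) 1
          * fromBlocks (Ω t) 0 (G t).toBlocks₂₁ (H t) * fromBlocks 1 0 (coefB G t) 1
          + fromBlocks 0 0 (M * matDeriv I (coefB G) t) 0 := by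
        rw [← h1]; rfl
      rw [this]
      simp only [fromBlocks_multiply, fromBlocks_add, Matrix.one_mul, Matrix.zero_mul,
        Matrix.mul_zero, Matrix.mul_one, add_zero, zero_add]
      rw [add_assoc (_ * Ω t), hz, add_zero, Matrix.mul_sub, Matrix.neg_mul, Matrix.mul_assoc,
        neg_add_eq_sub]
    rw [e, toBlocks_fromBlocks₂₁]
    refine ⟨rfl, fun x i hx => ?_⟩
    rw [Matrix.mul_apply]
    refine Finset.sum_eq_zero fun y _ => ?_
    rcases lt_or_ge (b y) (b x + 1) with hxy | hxy
    · rw [hM x y hxy, zero_mul]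
    · have h1 : matDeriv I (coefB G) t y i = 0 :=
        matDeriv_entry_zero (fun s hs => hB0 s hs y i (by omega)) ht
      have h2 : (coefB G t * Ω t) y i = 0 := by
        rw [Matrix.mul_apply]
        exact Finset.sum_eq_zero fun k _ => by rw [hB0 t ht y k (by omega), zero_mul]
      rw [Matrix.sub_apply, h1, h2, sub_zero, mul_zero]

/-- For upper block triangular `F`, each iteration of Step 1 annihilates a block column of
`F₁₂`. -/
theorem step1_iterate_form (hM : UpperDeg b 1 M)
    (hH : ∀ t ∈ I, UpperDeg b 0 (H t)) (hHu : ∀ t ∈ I, IsUnit (H t))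
    (hF : ∀ t ∈ I, F t = fromBlocks (Ω t) (F t).toBlocks₁₂ 0 (H t)) (j : ℕ) :
    ∀ t ∈ I, (step1 I M)^[j] F t =
        fromBlocks (Ω t) ((step1 I M)^[j] F t).toBlocks₁₂ 0 (H t) ∧
      ∀ i x, b x < j → ((step1 I M)^[j] F t).toBlocks₁₂ i x = 0 := by
  induction j with
  | zero => exact fun t ht => ⟨hF t ht, fun i x hx => absurd hx (by omega)⟩
  | succ j ih =>
    intro t ht
    rw [Function.iterate_succ_apply']
    set G := (step1 I M)^[j] F with hG
    have hA : ∀ t ∈ I, coefA M G t = (G t).toBlocks₁₂ * ((H t)⁻¹ * M) := fun t ht => by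
      simp only [coefA]
      rw [(ih t ht).1, toBlocks_fromBlocks₂₂, toBlocks_fromBlocks₁₂, Matrix.mul_assoc]
    -- The new zero block column already appears in `A = G₁₂ H⁻¹ M`, as `H⁻¹ M` has degree 1; the
    -- remainder `Ω A + A'` inherits it.
    have hA0 : ∀ t ∈ I, ∀ i x, b x < j + 1 → coefA M G t i x = 0 := by
      intro t ht i x hx
      rw [hA t ht, Matrix.mul_apply]
      refine Finset.sum_eq_zero fun y _ => ?_
      rcases lt_or_ge (b x) (b y + 1) with hxy | hxy
      · rw [((hH t ht).inv (hHu t ht)).mul_left hM y x hxy, mul_zero]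
      · rw [(ih t ht).2 i y (by omega), zero_mul]
    have e : step1 I M G t = fromBlocks (Ω t)
        (Ω t * coefA M G t + matDeriv I (coefA M G) t) 0 (H t) := by
      have h1 := (ih t ht).1
      have h2 : (G t).toBlocks₂₂ = H t := by rw [h1, toBlocks_fromBlocks₂₂]
      have : step1 I M G t = fromBlocks 1 (-((G t).toBlocks₁₂ * (H t)⁻¹)) 0 1
          * fromBlocks (Ω t) (G t).toBlocks₁₂ 0 (H t) * fromBlocks 1 (coefA M G t) 0 1
          + fromBlocks 0 (matDeriv I (coefA M G) t) 0 0 := by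
        rw [← h1, ← h2]; rfl
      rw [this]
      have hi : (G t).toBlocks₁₂ * (H t)⁻¹ * H t = (G t).toBlocks₁₂ := by
        rw [Matrix.mul_assoc, inv_mul_of_isUnit (hHu t ht), Matrix.mul_one]
      simp [fromBlocks_multiply, fromBlocks_add, hi]
    rw [e, toBlocks_fromBlocks₁₂]
    refine ⟨rfl, fun i x hx => ?_⟩
    have h1 : matDeriv I (coefA M G) t i x = 0 :=
      matDeriv_entry_zero (fun s hs => hA0 s hs i x hx) ht
    have h2 : (Ω t * coefA M G t) i x = 0 := by
      rw [Matrix.mul_apply]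
      exact Finset.sum_eq_zero fun k _ => by rw [hA0 t ht k x hx, mul_zero]
    rw [Matrix.add_apply, h1, h2, add_zero]

end Elimination

end DAE

namespace DAE

/-! ### The canonical projector from a transformation into the constant form -/

section Canonical

variable {μ d : ℕ} {ℓ : Fin μ → ℕ} {I : Set ℝ}

/-- The enumeration runs through the blocks consecutively, so the block shift becomes strictly upper
triangular in the entrywise sense required of an SCF. -/
theorem finSigmaFinEquiv_lt {x y : BlockIdx ℓ} (h : x.1.val + 1 = y.1.val) :
    finSigmaFinEquiv x < finSigmaFinEquiv y := by
  obtain ⟨⟨i, hi⟩, p⟩ := x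
  obtain ⟨⟨j, hj⟩, q⟩ := y
  obtain rfl : i + 1 = j := h
  rw [Fin.lt_def, finSigmaFinEquiv_apply, finSigmaFinEquiv_apply]
  simp only [Fin.sum_univ_castSucc]
  have hp := p.isLt
  exact Nat.lt_of_lt_of_le (Nat.add_lt_add_left hp _) (Nat.le_add_right _ _)

theorem isTheCanonicalProjector_of_transforms
    {E F L K P : ℝ → Matrix (Fin d ⊕ BlockIdx ℓ) (Fin d ⊕ BlockIdx ℓ) ℝ}
    {Ω : ℝ → Matrix (Fin d) (Fin d) ℝ}
    (h : Transforms 0 I L K E F (leading (elemN ℓ)) (fun t => fromBlocks (Ω t) 0 0 1))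
    (hP : ∀ t ∈ I, P t * K t = K t * fromBlocks 1 0 0 0) : IsTheCanonicalProjector I E F P := by
  have hcan : IsCanonicalProjector I E F P := by
    refine ⟨d, ∑ i, ℓ i, Equiv.sumCongr (Equiv.refl _) finSigmaFinEquiv, Ω,
      fun _ => (elemN ℓ).submatrix finSigmaFinEquiv.symm finSigmaFinEquiv.symm, L, K,
      Or.inl fun t _ i j hij => ?_, h.congr (fun t _ => ?_) (fun t _ => ?_), fun t ht => ?_⟩
    · have : ¬ ((finSigmaFinEquiv.symm i).1.val + 1 = (finSigmaFinEquiv.symm j).1.val) := by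
        intro e
        have := finSigmaFinEquiv_lt e
        rw [Equiv.apply_symm_apply, Equiv.apply_symm_apply] at this
        exact absurd this (not_lt.2 hij)
      simp [elemN, this]
    · ext (i | i) (j | j) <;> simp [leading, Matrix.one_apply]
    · ext (i | i) (j | j) <;> simp [Matrix.one_apply]
    · have e : (fromBlocks 1 0 0 0 : Matrix (Fin d ⊕ Fin (∑ i, ℓ i)) _ ℝ).submatrix
          (Equiv.sumCongr (Equiv.refl (Fin d)) (finSigmaFinEquiv (n := ℓ)))
          (Equiv.sumCongr (Equiv.refl (Fin d)) (finSigmaFinEquiv (n := ℓ)))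
          = fromBlocks 1 0 0 0 := by
        ext (i | i) (j | j) <;> simp [Matrix.one_apply]
      rw [e, ← hP t ht, Matrix.mul_assoc, mul_inv_of_isUnit (h.isUnit_K t ht), Matrix.mul_one]
  exact ⟨hcan, fun Q hQ => hcan.unique hQ⟩

theorem SmoothMat.of_add {ι κ : Type*} {m : ℕ∞} {A : ℝ → Matrix ι κ ℝ} {k c : ℕ}
    (h : SmoothMat ((m + k : ℕ∞) : WithTop ℕ∞) I A) (hc : c ≤ k) :
    SmoothMat ((m + c : ℕ∞) : WithTop ℕ∞) I A :=
  h.of_le (by gcongr)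

theorem smoothMat_Rc {n : WithTop ℕ∞} {N : ℝ → Matrix (BlockIdx ℓ) (BlockIdx ℓ) ℝ}
    (h : SmoothMat n I N) : SmoothMat n I (Rc ℓ N) :=
  (h.mul (smoothMat_const _)).add (smoothMat_const _)

theorem smoothMat_Rr {n : WithTop ℕ∞} {N : ℝ → Matrix (BlockIdx ℓ) (BlockIdx ℓ) ℝ}
    (h : SmoothMat n I N) : SmoothMat n I (Rr ℓ N) :=
  ((smoothMat_const _).mul h).add (smoothMat_const _)

end Canonical

/-! ### Normalized T-canonical forms -/

section TForm

variable {μ d : ℕ} {ℓ : Fin μ → ℕ} {I : Set ℝ} {m : ℕ∞}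
  {N : ℝ → Matrix (BlockIdx ℓ) (BlockIdx ℓ) ℝ} {Ω : ℝ → Matrix (Fin d) (Fin d) ℝ}
  {F₂₁ : ℝ → Matrix (BlockIdx ℓ) (Fin d) ℝ}
  {E F : ℝ → Matrix (Fin d ⊕ BlockIdx ℓ) (Fin d ⊕ BlockIdx ℓ) ℝ}

theorem IsTCanonical.Rc_spec (hn : I.Nonempty) (h : IsTCanonical I N Ω F₂₁ E F)
    (hp : HasColumnPattern ℓ I N) {t : ℝ} (ht : t ∈ I) :
    UpperDeg blockNo 0 (Rc ℓ N t) ∧ IsUnit (Rc ℓ N t) ∧ N t = Rc ℓ N t * elemN ℓ :=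
  DAE.Rc_spec (h.column.antitone hn) hp ht (isSUT_iff.1 (h.column t ht).1)

theorem Rc_inv_mul {t : ℝ} (hu : IsUnit (Rc ℓ N t)) (h : N t = Rc ℓ N t * elemN ℓ) :
    (Rc ℓ N t)⁻¹ * N t = elemN ℓ := by
  calc (Rc ℓ N t)⁻¹ * N t = (Rc ℓ N t)⁻¹ * (Rc ℓ N t * elemN ℓ) := congrArg _ h
    _ = elemN ℓ := by rw [← Matrix.mul_assoc, inv_mul_of_isUnit hu, Matrix.one_mul]

theorem IsTCanonical.transforms_preT (hn : I.Nonempty) (h : IsTCanonical I N Ω F₂₁ E F)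
    (hp : HasColumnPattern ℓ I N) (hNs : SmoothMat (m : WithTop ℕ∞) I N) :
    Transforms m I (Lc ℓ N) (fun _ => 1) E F (leading (elemN ℓ)) (preT ℓ N Ω F₂₁) := by
  have hspec := fun t ht => h.Rc_spec hn hp (t := t) ht
  refine ⟨(smoothMat_const _).fromBlocks (smoothMat_const _) (smoothMat_const _)
    ((smoothMat_Rc hNs).inv fun t ht => (hspec t ht).2.1), smoothMat_const _,
    fun t ht => isUnit_fromBlocks_zero₂₁ isUnit_one (isUnit_inv (hspec t ht).2.1),
    fun _ _ => isUnit_one, fun t ht => ?_, fun t ht => ?_⟩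
  · rw [h.eq_E t ht]
    simp [leading, Lc, fromBlocks_multiply, Rc_inv_mul (hspec t ht).2.1 (hspec t ht).2.2]
  · rw [h.eq_F t ht]
    simp [preT, Lc, fromBlocks_multiply]

theorem IsTCanonical.isPreSCF (hn : I.Nonempty) (h : IsTCanonical I N Ω F₂₁ E F)
    (hp : HasColumnPattern ℓ I N) :
    IsPreSCF ℓ I (leading (elemN ℓ)) (preT ℓ N Ω F₂₁) := by
  have hspec := fun t ht => h.Rc_spec hn hp (t := t) ht
  refine ⟨Or.inl (h.column.antitone hn), fun _ _ => rfl,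
    fun t ht => isBUT_iff.2 ((hspec t ht).1.inv (hspec t ht).2.1),
    fun t ht => isUnit_inv (hspec t ht).2.1, fun t _ => isBUT_iff.2 ?_⟩
  intro x y _
  simp [preT]

theorem step1_preT : step1 I (elemN ℓ) (preT ℓ N Ω F₂₁) = preT ℓ N Ω F₂₁ :=
  step1_eq_self fun t => by simp [preT]

theorem afterStep1_preT : afterStep1 μ I (elemN ℓ) (preT ℓ N Ω F₂₁) = preT ℓ N Ω F₂₁ :=
  Function.iterate_fixed step1_preT μ

theorem totalA_preT (t : ℝ) : totalA μ I (elemN ℓ) (preT ℓ N Ω F₂₁) t = 0 := by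
  refine Finset.sum_eq_zero fun i _ => ?_
  rw [Function.iterate_fixed step1_preT i, coefA_eq_zero fun t => by simp [preT]]

theorem IsTCanonical.step2_form (hn : I.Nonempty) (h : IsTCanonical I N Ω F₂₁ E F)
    (hp : HasColumnPattern ℓ I N) (j : ℕ) : ∀ t ∈ I,
    (step2 I (elemN ℓ))^[j] (preT ℓ N Ω F₂₁) t = fromBlocks (Ω t) 0
        ((step2 I (elemN ℓ))^[j] (preT ℓ N Ω F₂₁) t).toBlocks₂₁ (Rc ℓ N t)⁻¹ ∧
      ∀ x i, μ ≤ blockNo x + j →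
        ((step2 I (elemN ℓ))^[j] (preT ℓ N Ω F₂₁) t).toBlocks₂₁ x i = 0 := by
  have hspec := fun t ht => h.Rc_spec hn hp (t := t) ht
  exact step2_iterate_form elemN_upperDeg (fun x => x.1.isLt)
    (fun t ht => (hspec t ht).1.inv (hspec t ht).2.1) (fun t ht => isUnit_inv (hspec t ht).2.1)
    (fun t _ => by simp [preT]) j

theorem IsTCanonical.afterStep2_preT (hn : I.Nonempty) (h : IsTCanonical I N Ω F₂₁ E F)
    (hp : HasColumnPattern ℓ I N) {t : ℝ} (ht : t ∈ I) :
    afterStep2 μ I (elemN ℓ) (preT ℓ N Ω F₂₁) t = fromBlocks (Ω t) 0 0 (Rc ℓ N t)⁻¹ := by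
  rw [afterStep2, afterStep1_preT]
  obtain ⟨h1, h2⟩ := h.step2_form hn hp μ t ht
  have h3 : ((step2 I (elemN ℓ))^[μ] (preT ℓ N Ω F₂₁) t).toBlocks₂₁ = 0 := by
    ext x i
    exact h2 x i (by omega)
  rw [h1, h3]

/-- Each iteration costs one derivative, and the right factor must still be of class `m + 1`; `m +
(μ + 1)` covers both. -/
theorem IsTCanonical.exists_transforms_step2 (hI : UniqueDiffOn ℝ I) (hn : I.Nonempty)
    (h : IsTCanonical I N Ω F₂₁ E F) (hp : HasColumnPattern ℓ I N)
    (hNs : SmoothMat ((m + (μ + 1 : ℕ) : ℕ∞) : WithTop ℕ∞) I N)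
    (hΩs : SmoothMat ((m + (μ + 1 : ℕ) : ℕ∞) : WithTop ℕ∞) I Ω)
    (hFs : SmoothMat ((m + (μ + 1 : ℕ) : ℕ∞) : WithTop ℕ∞) I F₂₁) :
    ∃ L, Transforms m I L
      (fun t => fromBlocks 1 0 (totalB μ I (elemN ℓ) (preT ℓ N Ω F₂₁) t) 1)
      (leading (elemN ℓ)) (preT ℓ N Ω F₂₁) (leading (elemN ℓ))
      (fun t => fromBlocks (Ω t) 0 0 (Rc ℓ N t)⁻¹) := by
  have hspec := fun t ht => h.Rc_spec hn hp (t := t) ht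
  have hRs := (smoothMat_Rc hNs).inv fun t ht => (hspec t ht).2.1
  have hs : SmoothMat ((m + (μ + 1 : ℕ) : ℕ∞) : WithTop ℕ∞) I (preT ℓ N Ω F₂₁) :=
    hΩs.fromBlocks (smoothMat_const _) (hRs.mul hFs) hRs
  have hu : ∀ j, ∀ t ∈ I,
      IsUnit ((step2 I (elemN ℓ))^[j] (preT ℓ N Ω F₂₁) t).toBlocks₂₂ := fun j t ht => by
    rw [(h.step2_form hn hp j t ht).1, toBlocks_fromBlocks₂₂]
    exact isUnit_inv (hspec t ht).2.1
  obtain ⟨L, hL⟩ := step2_iterate_transforms (m := m) (M := elemN ℓ) (F := preT ℓ N Ω F₂₁) μ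
    (fun j hj => smoothMat_iterate (fun j p hj' => smoothMat_step2 hI hj' (hu j)) j (by
      rw [add_assoc, add_comm 1 (j : ℕ∞), ← Nat.cast_succ]
      exact hs.of_add (by omega))) (fun j _ => hu j)
  refine ⟨L, ?_⟩
  simp only [totalB, afterStep1_preT]
  refine hL.congr (fun _ _ => rfl) fun t ht => ?_
  rw [← h.afterStep2_preT hn hp ht, afterStep2, afterStep1_preT]

/-- Left multiplication by `R^c` turns `{N^(E_c), (R^c)⁻¹}` back into `{N, 1}`, to which the
reduction to a shift applies. The exponent uses `μ - 1`, the largest block number counted from zero.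
-/
theorem IsTCanonical.exists_transforms_one (hI : UniqueDiffOn ℝ I) (hn : I.Nonempty)
    (h : IsTCanonical I N Ω F₂₁ E F) (hp : HasColumnPattern ℓ I N)
    (hNs : SmoothMat ((m + 1 + ((μ - 1 + 1) * (μ - 1 + 2) : ℕ) : ℕ∞) : WithTop ℕ∞) I N) :
    ∃ (L : ℝ → Matrix (Fin d ⊕ BlockIdx ℓ) (Fin d ⊕ BlockIdx ℓ) ℝ)
      (K : ℝ → Matrix (BlockIdx ℓ) (BlockIdx ℓ) ℝ),
      Transforms m I L (fun t => fromBlocks (1 : Matrix (Fin d) (Fin d) ℝ) 0 0 (K t))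
      (leading (elemN ℓ)) (fun t => fromBlocks (Ω t) 0 0 (Rc ℓ N t)⁻¹)
      (leading (elemN ℓ)) (fun t => fromBlocks (Ω t) 0 0 1) := by
  have hspec := fun t ht => h.Rc_spec hn hp (t := t) ht
  obtain ⟨L, K, hT⟩ := exists_transforms_shift_left hI blockNo_le
    (isShift_elemN (h.column.antitone hn)) (fun t ht => (hspec t ht).2.2)
    (fun t ht => (hspec t ht).1) (fun t ht => (hspec t ht).2.1) hNs (smoothMat_Rc hNs)
  have hR : Transforms m I (Rc ℓ N) (fun _ => 1) (fun _ => elemN ℓ) (fun t => (Rc ℓ N t)⁻¹) N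
      (fun _ => 1) :=
    ⟨smoothMat_Rc (hNs.of_le (by rw [add_assoc]; exact le_self_add)), smoothMat_const _,
      fun t ht => (hspec t ht).2.1, fun _ _ => isUnit_one,
      fun t ht => by rw [Matrix.mul_one]; exact (hspec t ht).2.2,
      fun t ht => by rw [mul_inv_of_isUnit (hspec t ht).2.1]; simp⟩
  exact ⟨_, _, (hR.trans hT).fromBlocks_one Ω⟩

end TForm

/-! ### Normalized S-canonical forms -/

section SForm

variable {μ d : ℕ} {ℓ : Fin μ → ℕ} {I : Set ℝ} {m : ℕ∞}
  {N : ℝ → Matrix (BlockIdx ℓ) (BlockIdx ℓ) ℝ} {Ω : ℝ → Matrix (Fin d) (Fin d) ℝ}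
  {E₁₂ : ℝ → Matrix (Fin d) (BlockIdx ℓ) ℝ}
  {E F : ℝ → Matrix (Fin d ⊕ BlockIdx ℓ) (Fin d ⊕ BlockIdx ℓ) ℝ}

theorem IsSCanonical.Rr_spec (hn : I.Nonempty) (h : IsSCanonical I N Ω E₁₂ E F)
    (hp : HasRowPattern ℓ I N) {t : ℝ} (ht : t ∈ I) :
    UpperDeg blockNo 0 (Rr ℓ N t) ∧ IsUnit (Rr ℓ N t) ∧ N t = elemN ℓ * Rr ℓ N t :=
  DAE.Rr_spec (h.row.monotone hn) hp ht (isSUT_iff.1 (h.row t ht).1)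

theorem mul_Rr_inv {t : ℝ} (hu : IsUnit (Rr ℓ N t)) (h : N t = elemN ℓ * Rr ℓ N t) :
    N t * (Rr ℓ N t)⁻¹ = elemN ℓ := by
  calc N t * (Rr ℓ N t)⁻¹ = elemN ℓ * Rr ℓ N t * (Rr ℓ N t)⁻¹ :=
        congrArg (· * (Rr ℓ N t)⁻¹) h
    _ = elemN ℓ := by rw [Matrix.mul_assoc, mul_inv_of_isUnit hu, Matrix.mul_one]

theorem matDeriv_Kr (t : ℝ) : matDeriv I (Kr ℓ N E₁₂) t =
    fromBlocks 0 (-matDeriv I (fun s => E₁₂ s * (Rr ℓ N s)⁻¹) t) 0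
      (matDeriv I (fun s => (Rr ℓ N s)⁻¹) t) := by
  unfold Kr
  rw [matDeriv_fromBlocks, matDeriv_const, matDeriv_const, matDeriv_neg]

theorem IsSCanonical.transforms_preS (hn : I.Nonempty) (h : IsSCanonical I N Ω E₁₂ E F)
    (hp : HasRowPattern ℓ I N) (hNs : SmoothMat ((m + 1 : ℕ∞) : WithTop ℕ∞) I N)
    (hEs : SmoothMat ((m + 1 : ℕ∞) : WithTop ℕ∞) I E₁₂) :
    Transforms m I (fun _ => 1) (Kr ℓ N E₁₂) E F (leading (elemN ℓ)) (preS ℓ I N Ω E₁₂) := by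
  have hspec := fun t ht => h.Rr_spec hn hp (t := t) ht
  have hRs := (smoothMat_Rr hNs).inv fun t ht => (hspec t ht).2.1
  refine ⟨smoothMat_const _, (smoothMat_const _).fromBlocks (hEs.mul hRs).neg (smoothMat_const _)
    hRs, fun _ _ => isUnit_one,
    fun t ht => isUnit_fromBlocks_zero₂₁ isUnit_one (isUnit_inv (hspec t ht).2.1),
    fun t ht => ?_, fun t ht => ?_⟩
  · rw [h.eq_E t ht]
    simp [leading, Kr, fromBlocks_multiply, mul_Rr_inv (hspec t ht).2.1 (hspec t ht).2.2]
  · rw [h.eq_E t ht, h.eq_F t ht, matDeriv_Kr]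
    simp only [preS, preS₂₂, Kr, fromBlocks_multiply, fromBlocks_add, Matrix.one_mul,
      Matrix.zero_mul, Matrix.mul_zero, Matrix.mul_one, add_zero, neg_zero, zero_add,
      Matrix.mul_neg, Matrix.mul_assoc]
    congr 1
    abel

theorem IsSCanonical.preS₂₂_spec (hn : I.Nonempty) (h : IsSCanonical I N Ω E₁₂ E F)
    (hp : HasRowPattern ℓ I N) {t : ℝ} (ht : t ∈ I) :
    UpperDeg blockNo 0 (preS₂₂ ℓ I N t) ∧ IsUnit (preS₂₂ ℓ I N t) := by
  have hspec := fun t ht => h.Rr_spec hn hp (t := t) ht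
  have hN : ∀ t ∈ I, UpperDeg blockNo 1 (N t) := fun t ht => isSUT_iff.1 (h.row t ht).1
  have hd : ∀ t ∈ I, UpperDeg blockNo 0 (Rr ℓ N t)⁻¹ :=
    fun t ht => (hspec t ht).1.inv (hspec t ht).2.1
  exact ⟨(hd t ht).add (((hN t ht).mul (UpperDeg.matDeriv hd ht)).mono (by omega)),
    isUnit_add_mul_deriv hN hd (fun t ht => isUnit_inv (hspec t ht).2.1) ht⟩

theorem IsSCanonical.isPreSCF (hn : I.Nonempty) (h : IsSCanonical I N Ω E₁₂ E F)
    (hp : HasRowPattern ℓ I N) :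
    IsPreSCF ℓ I (leading (elemN ℓ)) (preS ℓ I N Ω E₁₂) := by
  refine ⟨Or.inr (h.row.monotone hn), fun _ _ => rfl,
    fun t ht => isBUT_iff.2 (h.preS₂₂_spec hn hp ht).1,
    fun t ht => (h.preS₂₂_spec hn hp ht).2, fun t _ => isBUT_iff.2 ?_⟩
  intro x y _
  simp [preS]

theorem IsSCanonical.step1_form (hn : I.Nonempty) (h : IsSCanonical I N Ω E₁₂ E F)
    (hp : HasRowPattern ℓ I N) (j : ℕ) : ∀ t ∈ I,
    (step1 I (elemN ℓ))^[j] (preS ℓ I N Ω E₁₂) t = fromBlocks (Ω t)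
        ((step1 I (elemN ℓ))^[j] (preS ℓ I N Ω E₁₂) t).toBlocks₁₂ 0 (preS₂₂ ℓ I N t) ∧
      ∀ i x, blockNo x < j →
        ((step1 I (elemN ℓ))^[j] (preS ℓ I N Ω E₁₂) t).toBlocks₁₂ i x = 0 :=
  step1_iterate_form elemN_upperDeg (fun _ ht => (h.preS₂₂_spec hn hp ht).1)
    (fun _ ht => (h.preS₂₂_spec hn hp ht).2) (fun t _ => by simp [preS]) j

theorem IsSCanonical.afterStep1_preS (hn : I.Nonempty) (h : IsSCanonical I N Ω E₁₂ E F)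
    (hp : HasRowPattern ℓ I N) {t : ℝ} (ht : t ∈ I) :
    afterStep1 μ I (elemN ℓ) (preS ℓ I N Ω E₁₂) t = fromBlocks (Ω t) 0 0 (preS₂₂ ℓ I N t) := by
  rw [afterStep1]
  obtain ⟨h1, h2⟩ := h.step1_form hn hp μ t ht
  have h3 : ((step1 I (elemN ℓ))^[μ] (preS ℓ I N Ω E₁₂) t).toBlocks₁₂ = 0 := by
    ext i x
    exact h2 i x x.1.isLt
  rw [h1, h3]

theorem IsSCanonical.step2_iterate_preS (hn : I.Nonempty) (h : IsSCanonical I N Ω E₁₂ E F)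
    (hp : HasRowPattern ℓ I N) (j : ℕ) : ∀ t ∈ I,
    (step2 I (elemN ℓ))^[j] (afterStep1 μ I (elemN ℓ) (preS ℓ I N Ω E₁₂)) t =
      fromBlocks (Ω t) 0 0 (preS₂₂ ℓ I N t) := by
  induction j with
  | zero => exact fun t ht => h.afterStep1_preS hn hp ht
  | succ j ih =>
    intro t ht
    rw [Function.iterate_succ_apply']
    set G := (step2 I (elemN ℓ))^[j] (afterStep1 μ I (elemN ℓ) (preS ℓ I N Ω E₁₂)) with hG
    have hB : ∀ t ∈ I, coefB G t = 0 := fun t ht => by simp [coefB, ih t ht]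
    have hB' : matDeriv I (coefB G) t = 0 := by
      rw [matDeriv_congr (B := fun _ => 0) hB ht, matDeriv_const]
    simp [step2, hB t ht, hB', ih t ht, fromBlocks_one]

theorem IsSCanonical.totalB_preS (hn : I.Nonempty) (h : IsSCanonical I N Ω E₁₂ E F)
    (hp : HasRowPattern ℓ I N) {t : ℝ} (ht : t ∈ I) :
    totalB μ I (elemN ℓ) (preS ℓ I N Ω E₁₂) t = 0 :=
  Finset.sum_eq_zero fun j _ => by simp [coefB, h.step2_iterate_preS hn hp j t ht]

theorem IsSCanonical.exists_transforms_step1 (hI : UniqueDiffOn ℝ I) (hn : I.Nonempty)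
    (h : IsSCanonical I N Ω E₁₂ E F) (hp : HasRowPattern ℓ I N)
    (hNs : SmoothMat ((m + (μ + 1 : ℕ) + 1 : ℕ∞) : WithTop ℕ∞) I N)
    (hΩs : SmoothMat ((m + (μ + 1 : ℕ) + 1 : ℕ∞) : WithTop ℕ∞) I Ω)
    (hEs : SmoothMat ((m + (μ + 1 : ℕ) + 1 : ℕ∞) : WithTop ℕ∞) I E₁₂) :
    ∃ L, Transforms m I L
      (fun t => fromBlocks 1 (totalA μ I (elemN ℓ) (preS ℓ I N Ω E₁₂) t) 0 1)
      (leading (elemN ℓ)) (preS ℓ I N Ω E₁₂) (leading (elemN ℓ))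
      (fun t => fromBlocks (Ω t) 0 0 (preS₂₂ ℓ I N t)) := by
  have hspec := fun t ht => h.Rr_spec hn hp (t := t) ht
  have hRs := (smoothMat_Rr hNs).inv fun t ht => (hspec t ht).2.1
  have hNs' := hNs.of_le (q := m + (μ + 1 : ℕ)) le_self_add
  have hΩs' := hΩs.of_le (q := m + (μ + 1 : ℕ)) le_self_add
  have hEs' := hEs.of_le (q := m + (μ + 1 : ℕ)) le_self_add
  have hRs' := hRs.of_le (q := m + (μ + 1 : ℕ)) le_self_add
  have hs : SmoothMat ((m + (μ + 1 : ℕ) : ℕ∞) : WithTop ℕ∞) I (preS ℓ I N Ω E₁₂) :=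
    hΩs'.fromBlocks ((((hΩs'.mul hEs').mul hRs').neg.sub ((hEs.mul hRs).deriv hI)).add
      (hEs'.mul (hRs.deriv hI))) (smoothMat_const _) (hRs'.add (hNs'.mul (hRs.deriv hI)))
  have hu : ∀ j, ∀ t ∈ I,
      IsUnit ((step1 I (elemN ℓ))^[j] (preS ℓ I N Ω E₁₂) t).toBlocks₂₂ := fun j t ht => by
    rw [(h.step1_form hn hp j t ht).1, toBlocks_fromBlocks₂₂]
    exact (h.preS₂₂_spec hn hp ht).2
  obtain ⟨L, hL⟩ := step1_iterate_transforms (m := m) (M := elemN ℓ) (F := preS ℓ I N Ω E₁₂) μ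
    (fun j hj => smoothMat_iterate (fun j p hj' => smoothMat_step1 hI hj' (hu j)) j (by
      rw [add_assoc, add_comm 1 (j : ℕ∞), ← Nat.cast_succ]
      exact hs.of_add (by omega))) (fun j _ => hu j)
  exact ⟨L, hL.congr (fun _ _ => rfl) fun t ht => (h.afterStep1_preS hn hp ht).symm⟩

/-- The right factor `R^r` leads back to `{N, 1}`: in the second matrix the derivative terms combine
to `N ((R⁻¹)' R + R⁻¹ R') = 0`. -/
theorem IsSCanonical.exists_transforms_one (hI : UniqueDiffOn ℝ I) (hn : I.Nonempty)
    (h : IsSCanonical I N Ω E₁₂ E F) (hp : HasRowPattern ℓ I N)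
    (hNs : SmoothMat ((m + 1 + ((μ - 1 + 1) * (μ - 1 + 2) : ℕ) : ℕ∞) : WithTop ℕ∞) I N) :
    ∃ (L : ℝ → Matrix (Fin d ⊕ BlockIdx ℓ) (Fin d ⊕ BlockIdx ℓ) ℝ)
      (K : ℝ → Matrix (BlockIdx ℓ) (BlockIdx ℓ) ℝ),
      Transforms m I L (fun t => fromBlocks (1 : Matrix (Fin d) (Fin d) ℝ) 0 0 (K t))
      (leading (elemN ℓ)) (fun t => fromBlocks (Ω t) 0 0 (preS₂₂ ℓ I N t))
      (leading (elemN ℓ)) (fun t => fromBlocks (Ω t) 0 0 1) := by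
  have hspec := fun t ht => h.Rr_spec hn hp (t := t) ht
  obtain ⟨L, K, hT⟩ := exists_transforms_shift_right hI blockNo_le elemN_upperDeg
    (isShift_elemN_transpose (h.row.monotone hn)) (fun t ht => (hspec t ht).2.2)
    (fun t ht => (hspec t ht).1) (fun t ht => (hspec t ht).2.1) hNs (smoothMat_Rr hNs)
  have hRs : SmoothMat ((m + 1 : ℕ∞) : WithTop ℕ∞) I (Rr ℓ N) :=
    smoothMat_Rr (hNs.of_le le_self_add)
  have hR : Transforms m I (fun _ => 1) (Rr ℓ N) (fun _ => elemN ℓ) (preS₂₂ ℓ I N) N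
      (fun _ => 1) := by
    refine ⟨smoothMat_const _, hRs, fun _ _ => isUnit_one, fun t ht => (hspec t ht).2.1,
      fun t ht => by rw [Matrix.one_mul]; exact (hspec t ht).2.2, fun t ht => ?_⟩
    have hi := inv_mul_of_isUnit (hspec t ht).2.1
    have hd := matDeriv_inv_mul hRs.one_of_succ (fun t ht => (hspec t ht).2.1) ht
    have hM := mul_Rr_inv (hspec t ht).2.1 (hspec t ht).2.2
    rw [Matrix.one_mul, Matrix.one_mul, preS₂₂, ← hM, Matrix.add_mul, hi, Matrix.mul_assoc,
      Matrix.mul_assoc, add_assoc, ← Matrix.mul_add, hd, Matrix.mul_zero, add_zero]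
  exact ⟨_, _, (hR.trans hT).fromBlocks_one Ω⟩

end SForm

end DAE

/-! ### Assembly of the transformations and the derivative count. -/

theorem mainTheorem4 (μ : ℕ) :
    ∃ k : ℕ, ∀ (m : ℕ∞) (d : ℕ) (ℓ : Fin μ → ℕ) (I : Set ℝ), I.OrdConnected → I.Nontrivial →
      -- T-canonical form: normalization of the secondary diagonal blocks
      (∀ (N : ℝ → Matrix (DAE.BlockIdx ℓ) (DAE.BlockIdx ℓ) ℝ)
          (Ω : ℝ → Matrix (Fin d) (Fin d) ℝ) (F₂₁ : ℝ → Matrix (DAE.BlockIdx ℓ) (Fin d) ℝ)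
          (E F : ℝ → Matrix (Fin d ⊕ DAE.BlockIdx ℓ) (Fin d ⊕ DAE.BlockIdx ℓ) ℝ),
        DAE.IsTCanonical I N Ω F₂₁ E F →
        DAE.SmoothMat ((m + 1 : ℕ∞) : WithTop ℕ∞) I N →
        DAE.SmoothMat ((m + 1 : ℕ∞) : WithTop ℕ∞) I Ω →
        DAE.SmoothMat ((m + 1 : ℕ∞) : WithTop ℕ∞) I F₂₁ →
        ∃ (N₁ : ℝ → Matrix (DAE.BlockIdx ℓ) (DAE.BlockIdx ℓ) ℝ)
          (G₂₁ : ℝ → Matrix (DAE.BlockIdx ℓ) (Fin d) ℝ)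
          (E₁ F₁ : ℝ → Matrix (Fin d ⊕ DAE.BlockIdx ℓ) (Fin d ⊕ DAE.BlockIdx ℓ) ℝ),
          DAE.IsTCanonical I N₁ Ω G₂₁ E₁ F₁ ∧ DAE.HasColumnPattern ℓ I N₁ ∧
          DAE.SmoothMat (m : WithTop ℕ∞) I N₁ ∧ DAE.SmoothMat (m : WithTop ℕ∞) I G₂₁ ∧
          DAE.Equivalent m I E F E₁ F₁) ∧
      -- T-canonical form with normalized secondary diagonal blocks
      (∀ (N : ℝ → Matrix (DAE.BlockIdx ℓ) (DAE.BlockIdx ℓ) ℝ)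
          (Ω : ℝ → Matrix (Fin d) (Fin d) ℝ) (F₂₁ : ℝ → Matrix (DAE.BlockIdx ℓ) (Fin d) ℝ)
          (E F : ℝ → Matrix (Fin d ⊕ DAE.BlockIdx ℓ) (Fin d ⊕ DAE.BlockIdx ℓ) ℝ),
        DAE.IsTCanonical I N Ω F₂₁ E F → DAE.HasColumnPattern ℓ I N →
        DAE.SmoothMat ((m + k : ℕ∞) : WithTop ℕ∞) I N →
        DAE.SmoothMat ((m + k : ℕ∞) : WithTop ℕ∞) I Ω →
        DAE.SmoothMat ((m + k : ℕ∞) : WithTop ℕ∞) I F₂₁ →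
        Antitone ℓ ∧
        (∀ t ∈ I, IsUnit (DAE.Rc ℓ N t) ∧ DAE.IsBUT (DAE.Rc ℓ N t) ∧
          DAE.IsBUT (DAE.Rc ℓ N t)⁻¹ ∧ (DAE.Rc ℓ N t)⁻¹ * N t = DAE.elemN ℓ) ∧
        DAE.Transforms m I (DAE.Lc ℓ N) (fun _ => 1) E F
          (DAE.leading (DAE.elemN ℓ)) (DAE.preT ℓ N Ω F₂₁) ∧
        DAE.IsPreSCF ℓ I (DAE.leading (DAE.elemN ℓ)) (DAE.preT ℓ N Ω F₂₁) ∧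
        (∀ t ∈ I, DAE.afterStep1 μ I (DAE.elemN ℓ) (DAE.preT ℓ N Ω F₂₁) t
            = DAE.preT ℓ N Ω F₂₁ t ∧
          DAE.afterStep2 μ I (DAE.elemN ℓ) (DAE.preT ℓ N Ω F₂₁) t
            = Matrix.fromBlocks (Ω t) 0 0 (DAE.Rc ℓ N t)⁻¹) ∧
        DAE.Equivalent m I (DAE.leading (DAE.elemN ℓ)) (DAE.preT ℓ N Ω F₂₁)
          (DAE.leading (DAE.elemN ℓ))
          (fun t => Matrix.fromBlocks (Ω t) 0 0 (DAE.Rc ℓ N t)⁻¹) ∧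
        DAE.Equivalent m I (DAE.leading (DAE.elemN ℓ))
          (fun t => Matrix.fromBlocks (Ω t) 0 0 (DAE.Rc ℓ N t)⁻¹)
          (DAE.leading (DAE.elemN ℓ)) (fun t => Matrix.fromBlocks (Ω t) 0 0 1) ∧
        (∀ t ∈ I, DAE.totalA μ I (DAE.elemN ℓ) (DAE.preT ℓ N Ω F₂₁) t = 0) ∧
        (∀ E₀ F₀ LT KT : ℝ → Matrix (Fin d ⊕ DAE.BlockIdx ℓ) (Fin d ⊕ DAE.BlockIdx ℓ) ℝ,
          DAE.Transforms 0 I LT KT E₀ F₀ E F →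
          DAE.IsTheCanonicalProjector I E₀ F₀ (fun t =>
            KT t * Matrix.fromBlocks 1 0
              (DAE.totalB μ I (DAE.elemN ℓ) (DAE.preT ℓ N Ω F₂₁) t) 0 * (KT t)⁻¹))) ∧
      -- S-canonical form: normalization of the secondary diagonal blocks
      (∀ (N : ℝ → Matrix (DAE.BlockIdx ℓ) (DAE.BlockIdx ℓ) ℝ)
          (Ω : ℝ → Matrix (Fin d) (Fin d) ℝ) (E₁₂ : ℝ → Matrix (Fin d) (DAE.BlockIdx ℓ) ℝ)
          (E F : ℝ → Matrix (Fin d ⊕ DAE.BlockIdx ℓ) (Fin d ⊕ DAE.BlockIdx ℓ) ℝ),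
        DAE.IsSCanonical I N Ω E₁₂ E F →
        DAE.SmoothMat ((m + 1 : ℕ∞) : WithTop ℕ∞) I N →
        DAE.SmoothMat ((m + 1 : ℕ∞) : WithTop ℕ∞) I Ω →
        DAE.SmoothMat ((m + 1 : ℕ∞) : WithTop ℕ∞) I E₁₂ →
        ∃ (N₁ : ℝ → Matrix (DAE.BlockIdx ℓ) (DAE.BlockIdx ℓ) ℝ)
          (G₁₂ : ℝ → Matrix (Fin d) (DAE.BlockIdx ℓ) ℝ)
          (E₁ F₁ : ℝ → Matrix (Fin d ⊕ DAE.BlockIdx ℓ) (Fin d ⊕ DAE.BlockIdx ℓ) ℝ),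
          DAE.IsSCanonical I N₁ Ω G₁₂ E₁ F₁ ∧ DAE.HasRowPattern ℓ I N₁ ∧
          DAE.SmoothMat (m : WithTop ℕ∞) I N₁ ∧ DAE.SmoothMat (m : WithTop ℕ∞) I G₁₂ ∧
          DAE.Equivalent m I E F E₁ F₁) ∧
      -- S-canonical form with normalized secondary diagonal blocks
      (∀ (N : ℝ → Matrix (DAE.BlockIdx ℓ) (DAE.BlockIdx ℓ) ℝ)
          (Ω : ℝ → Matrix (Fin d) (Fin d) ℝ) (E₁₂ : ℝ → Matrix (Fin d) (DAE.BlockIdx ℓ) ℝ)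
          (E F : ℝ → Matrix (Fin d ⊕ DAE.BlockIdx ℓ) (Fin d ⊕ DAE.BlockIdx ℓ) ℝ),
        DAE.IsSCanonical I N Ω E₁₂ E F → DAE.HasRowPattern ℓ I N →
        DAE.SmoothMat ((m + k : ℕ∞) : WithTop ℕ∞) I N →
        DAE.SmoothMat ((m + k : ℕ∞) : WithTop ℕ∞) I Ω →
        DAE.SmoothMat ((m + k : ℕ∞) : WithTop ℕ∞) I E₁₂ →
        Monotone ℓ ∧
        (∀ t ∈ I, IsUnit (DAE.Rr ℓ N t) ∧ DAE.IsBUT (DAE.Rr ℓ N t) ∧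
          DAE.IsBUT (DAE.Rr ℓ N t)⁻¹ ∧ N t * (DAE.Rr ℓ N t)⁻¹ = DAE.elemN ℓ) ∧
        DAE.Transforms m I (fun _ => 1) (DAE.Kr ℓ N E₁₂) E F
          (DAE.leading (DAE.elemN ℓ)) (DAE.preS ℓ I N Ω E₁₂) ∧
        DAE.IsPreSCF ℓ I (DAE.leading (DAE.elemN ℓ)) (DAE.preS ℓ I N Ω E₁₂) ∧
        (∀ t ∈ I, DAE.afterStep1 μ I (DAE.elemN ℓ) (DAE.preS ℓ I N Ω E₁₂) t
            = Matrix.fromBlocks (Ω t) 0 0 (DAE.preS₂₂ ℓ I N t) ∧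
          DAE.afterStep2 μ I (DAE.elemN ℓ) (DAE.preS ℓ I N Ω E₁₂) t
            = Matrix.fromBlocks (Ω t) 0 0 (DAE.preS₂₂ ℓ I N t)) ∧
        DAE.Equivalent m I (DAE.leading (DAE.elemN ℓ)) (DAE.preS ℓ I N Ω E₁₂)
          (DAE.leading (DAE.elemN ℓ))
          (fun t => Matrix.fromBlocks (Ω t) 0 0 (DAE.preS₂₂ ℓ I N t)) ∧
        DAE.Equivalent m I (DAE.leading (DAE.elemN ℓ))
          (fun t => Matrix.fromBlocks (Ω t) 0 0 (DAE.preS₂₂ ℓ I N t))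
          (DAE.leading (DAE.elemN ℓ)) (fun t => Matrix.fromBlocks (Ω t) 0 0 1) ∧
        (∀ t ∈ I, DAE.totalB μ I (DAE.elemN ℓ) (DAE.preS ℓ I N Ω E₁₂) t = 0) ∧
        (∀ E₀ F₀ LS KS : ℝ → Matrix (Fin d ⊕ DAE.BlockIdx ℓ) (Fin d ⊕ DAE.BlockIdx ℓ) ℝ,
          DAE.Transforms 0 I LS KS E₀ F₀ E F →
          DAE.IsTheCanonicalProjector I E₀ F₀ (fun t =>
            KS t * DAE.Kr ℓ N E₁₂ t * Matrix.fromBlocks 1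
              (-(DAE.totalA μ I (DAE.elemN ℓ) (DAE.preS ℓ I N Ω E₁₂) t)) 0 0 *
              (DAE.Kr ℓ N E₁₂ t)⁻¹ * (KS t)⁻¹))) := by
  -- A generous bound: the quadratic term pays for the intertwiner, the linear one for the `μ`
  -- elimination steps and the derivatives needed by right factors and by `preS`.
  refine ⟨(μ + 1) * (μ + 2) + μ + 3, fun m d ℓ I hI hn => ?_⟩
  have hU := DAE.uniqueDiffOn_interval hI hn
  have hmul : (μ - 1 + 1) * (μ - 1 + 2) ≤ (μ + 1) * (μ + 2) :=
    Nat.mul_le_mul (by omega) (by omega)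
  have hk₁ : m ≤ m + ((μ + 1) * (μ + 2) + μ + 3 : ℕ) := le_self_add
  have hk₂ : m + 1 ≤ m + ((μ + 1) * (μ + 2) + μ + 3 : ℕ) :=
    add_le_add le_rfl (by exact_mod_cast (by omega : 1 ≤ (μ + 1) * (μ + 2) + μ + 3))
  have hk₃ : m + (μ + 1 : ℕ) ≤ m + ((μ + 1) * (μ + 2) + μ + 3 : ℕ) :=
    add_le_add le_rfl (by exact_mod_cast (by omega : μ + 1 ≤ (μ + 1) * (μ + 2) + μ + 3))
  have hk₄ : m + (μ + 1 : ℕ) + 1 ≤ m + ((μ + 1) * (μ + 2) + μ + 3 : ℕ) := by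
    rw [add_assoc]
    gcongr
    exact_mod_cast (by omega : μ + 1 + 1 ≤ (μ + 1) * (μ + 2) + μ + 3)
  have hk₅ : m + 1 + ((μ - 1 + 1) * (μ - 1 + 2) : ℕ) ≤
      m + ((μ + 1) * (μ + 2) + μ + 3 : ℕ) := by
    rw [add_assoc]
    gcongr
    exact_mod_cast (by omega :
      1 + (μ - 1 + 1) * (μ - 1 + 2) ≤ (μ + 1) * (μ + 2) + μ + 3)
  refine ⟨fun N Ω F₂₁ E F h hN _ hF => DAE.exists_normalized_T hI hn h hN hF, ?_,
    fun N Ω E₁₂ E F h hN _ hE => DAE.exists_normalized_S hI hn h hN hE, ?_⟩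
  · intro N Ω F₂₁ E F h hp hN hΩ hF
    have hne := hn.nonempty
    have hspec := fun t ht => h.Rc_spec hne hp (t := t) ht
    have T₁ := h.transforms_preT hne hp (hN.of_le hk₁)
    obtain ⟨L₂, T₂⟩ := h.exists_transforms_step2 hU hne hp (hN.of_le hk₃) (hΩ.of_le hk₃)
      (hF.of_le hk₃)
    obtain ⟨L₃, K₃, T₃⟩ := h.exists_transforms_one hU hne hp (hN.of_le hk₅)
    refine ⟨h.column.antitone hne, fun t ht => ⟨(hspec t ht).2.1, DAE.isBUT_iff.2 (hspec t ht).1,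
        DAE.isBUT_iff.2 ((hspec t ht).1.inv (hspec t ht).2.1),
        DAE.Rc_inv_mul (hspec t ht).2.1 (hspec t ht).2.2⟩, T₁, h.isPreSCF hne hp,
      fun t ht => ⟨by rw [DAE.afterStep1_preT], h.afterStep2_preT hne hp ht⟩,
      ⟨_, _, T₂⟩, ⟨_, _, T₃⟩, fun t _ => DAE.totalA_preT t, fun E₀ F₀ LT KT hT => ?_⟩
    refine DAE.isTheCanonicalProjector_of_transforms (((hT.trans (T₁.of_le (zero_le))).trans
      (T₂.of_le (zero_le))).trans (T₃.of_le (zero_le))) fun t ht => ?_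
    have hi := DAE.inv_mul_of_isUnit (hT.isUnit_K t ht)
    simp only [Matrix.mul_assoc, Matrix.one_mul]
    rw [← Matrix.mul_assoc (KT t)⁻¹, hi]
    -- The block diagonal factor of `T₃` commutes with `diag(I, 0)`, so only the unipotent factor
    -- with corner `B` enters the projector.
    simp [Matrix.fromBlocks_multiply]
  · intro N Ω E₁₂ E F h hp hN hΩ hE
    have hne := hn.nonempty
    have hspec := fun t ht => h.Rr_spec hne hp (t := t) ht
    have T₁ := h.transforms_preS hne hp (hN.of_le hk₂) (hE.of_le hk₂)
    obtain ⟨L₂, T₂⟩ := h.exists_transforms_step1 hU hne hp (hN.of_le hk₄) (hΩ.of_le hk₄)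
      (hE.of_le hk₄)
    obtain ⟨L₃, K₃, T₃⟩ := h.exists_transforms_one hU hne hp (hN.of_le hk₅)
    refine ⟨h.row.monotone hne, fun t ht => ⟨(hspec t ht).2.1, DAE.isBUT_iff.2 (hspec t ht).1,
        DAE.isBUT_iff.2 ((hspec t ht).1.inv (hspec t ht).2.1),
        DAE.mul_Rr_inv (hspec t ht).2.1 (hspec t ht).2.2⟩, T₁, h.isPreSCF hne hp,
      fun t ht => ⟨h.afterStep1_preS hne hp ht, h.step2_iterate_preS hne hp μ t ht⟩,
      ⟨_, _, T₂⟩, ⟨_, _, T₃⟩, fun t ht => h.totalB_preS hne hp ht, fun E₀ F₀ LS KS hS => ?_⟩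
    refine DAE.isTheCanonicalProjector_of_transforms (((hS.trans (T₁.of_le (zero_le))).trans
      (T₂.of_le (zero_le))).trans (T₃.of_le (zero_le))) fun t ht => ?_
    have hi := DAE.inv_mul_of_isUnit (hS.isUnit_K t ht)
    have hi' := DAE.inv_mul_of_isUnit (T₁.isUnit_K t ht)
    simp only [Matrix.mul_assoc]
    rw [← Matrix.mul_assoc (KS t)⁻¹, hi, Matrix.one_mul,
      ← Matrix.mul_assoc (DAE.Kr ℓ N E₁₂ t)⁻¹, hi']
    -- Conjugating `diag(I, 0)` by the unipotent factor with corner `A` produces the entry `-A`.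
    simp [Matrix.fromBlocks_multiply]
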